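/- **Setting.** Let $Y(0),Y(1),D\in\{0,1\}$ and $X\in\mathbb R^p$, put $Y=DY(1)+(1-D)Y(0)$ and $O=(Y,D,X)$, and let $P_0$ be the law of $O$, $F_0$ the law of $X$, $\pi_0(x)=P_0(D=1\mid X=x)$, $m_0(d,x)=P_0(Y=1\mid D=d,X=x)$ and $\chi_0=\mathbb E_0[Y(1)-Y(0)]$. One observes i.i.d. copies $O_1,O_2,\dots$ of $O$; $\boldsymbol O^{(n)}=(O_1,\dots,O_n)$. For $\pi:\mathbb R^p\to(0,1)$ and $m:\{0,1\}\times\mathbb R^p\to\mathbb R$ write $\gamma_\pi(d,x)=\frac{d}{\pi(x)}-\frac{1-d}{1-\pi(x)}$, $\gamma_0=\gamma_{\pi_0}$, $\bar m(x)=m(1,x)-m(0,x)$, and let $$\widetilde\chi_0(o)=\bar m_0(x)+\gamma_0(d,x)\,(y-m_0(d,x))-\chi_0,\qquad \mathrm v_0=P_0[\widetilde\chi_0^2]$$ be the efficient influence function and the efficiency bound. $\mathbb P_n$ is the empirical measure and $\mathbb G_n=\sqrt n(\mathbb P_n-P_0)$. Let $\widehat\pi$ (with values in $(0,1)$) and $\widehat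 m$ be pilot estimators of $\pi_0$ and $m_0$ based on an auxiliary sample that is independent of $\boldsymbol O^{(n)}$, and $\widehat\gamma=\gamma_{\widehat\pi}$. *Prior and posterior.* Put $\Psi(t)=1/(1+e^{-t})$, $m_\eta=\Psi(\eta^m)$ and $\eta^m=W^m+\lambda\widehat\gamma$, where the process $W^m$ (whose law may depend on $n$) is measurable with sample paths $W^m(d,\cdot)$ continuous on the support of $F_0$, and is independent of $\lambda\sim N(0,\sigma_n^2)$, $\sigma_n>0$. The posterior of $(W^m,\lambda)$ is given by Bayes' rule with the likelihood $\prod_{i\le n}m_\eta(D_i,X_i)^{Y_i}(1-m_\eta(D_i,X_i))^{1-Y_i}$. Independently of it, the posterior of the law $F$ of $X$ is the Bayesian bootstrap: $F=\sum_{i\le n}M_{ni}\delta_{X_i}$, $M_{ni}=e_i/\sum_{j\le n}e_j$, with $e_i$ i.i.d. standard exponential. $\Pi(\cdot\mid\boldsymbol O^{(n)})$ is the resulting joint posterior and $\chi_\eta=\int\bar m_\eta\,dF$. Let $\mathcal H_n$ be measurable sets of functions $\eta^m$ (which may depend on the auxiliary sample, but not on $\boldsymbol O^{(n)}$) with $\Pi(\eta^m\in\mathcal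 H_n\mid\boldsymbol O^{(n)})\to_{P_0}1$. Below, suprema are treated through outer probability. **Theorem.** Assume: 1. (Unconfoundedness and overlap) $(Y(0),Y(1))$ and $D$ are conditionally independent given $X$, and for some $\bar\pi>0$, $\bar\pi<\pi_0(x)<1-\bar\pi$ for all $x$ in the support of $F_0$. 2. (Rates) For deterministic $r_n\to0$, $\varepsilon_n\to0$ with $\sqrt n\,\varepsilon_nr_n\to0$, with probability tending to one, $\|\widehat\pi-\pi_0\|_{L^2(F_0)}\le r_n$ and, for $d=0,1$, $\|\widehat m(d,\cdot)-m_0(d,\cdot)\|_{L^2(F_0)}\le\varepsilon_n$ and $\sup_{\eta^m\in\mathcal H_n}\|m_\eta(d,\cdot)-m_0(d,\cdot)\|_{L^2(F_0)}\le\varepsilon_n$. Moreover $\sup_{d,\,x\in\mathrm{supp}F_0}|\widehat\gamma(d,x)|=O_{P_0}(1)$. 3. (Complexity) $\sup_{\eta^m\in\mathcal H_n}|(\mathbb P_n-P_0)\bar m_\eta|=o_{P_0}(1)$ and $\sup_{\eta^m\in\mathcal H_n}|\mathbb G_n[(\widehat\gamma-\gamma_0)(m_\eta-m_0)]|=o_{P_0}(1)$.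 4. (Prior stability) $n\sigma_n^2\to\infty$; for some deterministic $u_n\to0$, $\Pi(|\lambda|\le u_n\sigma_n^2\sqrt n\mid\boldsymbol O^{(n)})\to_{P_0}1$; and for every $t\in\mathbb R$, $\Pi\big((w,\lambda):w+(\lambda+tn^{-1/2})\widehat\gamma\in\mathcal H_n\mid\boldsymbol O^{(n)}\big)\to_{P_0}1$. Let $\widehat\chi$ be any asymptotically efficient estimator, that is, $\widehat\chi=\chi_0+\mathbb P_n[\widetilde\chi_0]+o_{P_0}(n^{-1/2})$, and let $b_{0,\eta}=\mathbb P_n[\gamma_0m_0-\bar m_0]-\mathbb P_n[\gamma_0m_\eta-\bar m_\eta]$. Then the marginal posterior law of $\sqrt n(\chi_\eta-\widehat\chi-b_{0,\eta})$ satisfies $$d_{BL}\Big(\mathcal L_\Pi\big(\sqrt n(\chi_\eta-\widehat\chi-b_{0,\eta})\mid\boldsymbol O^{(n)}\big),\,N(0,\mathrm v_0)\Big)\longrightarrow_{P_0}0,$$ where $d_{BL}(P,Q)=\sup_f|\int f\,dP-\int f\,dQ|$ over $f:\mathbb R\to\mathbb R$ with $\sup|f|+\sup_{x\ne y}|f(x)-f(y)|/|x-y|\le1$.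 -/

import Mathlib

open MeasureTheory ProbabilityTheory Filter Topology
open scoped NNReal ENNReal

noncomputable section

namespace DRBayes

/-! ### Population: potential outcomes, treatment, covariates -/

/-- Covariates are vectors in `ℝ^p`. -/
abbrev Cov (p : ℕ) := EuclideanSpace ℝ (Fin p)

/-- A unit of the population: `((Y(0), Y(1)), D, X)`, with binary outcomes and treatment. -/
abbrev Unit0 (p : ℕ) := (Bool × Bool) × (Bool × Cov p)

/-- An observation `O = (Y, D, X)`. -/
abbrev Obs (p : ℕ) := Bool × (Bool × Cov p)

/-- The numerical value `0` or `1` of a binary variable. -/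
def num (b : Bool) : ℝ := if b then 1 else 0

/-- `Y = D Y(1) + (1 - D) Y(0)`. -/
def observe {p : ℕ} (z : Unit0 p) : Obs p := (if z.2.1 then z.1.2 else z.1.1, z.2)

/-- The covariate of a unit. -/
def covariate {p : ℕ} (z : Unit0 p) : Cov p := z.2.2

lemma measurable_covariate {p : ℕ} : Measurable (covariate (p := p)) :=
  measurable_snd.comp measurable_snd

/-- The law `P₀` of one observation, given the law `Q` of a unit. -/
def obsLaw {p : ℕ} (Q : Measure (Unit0 p)) : Measure (Obs p) := Q.map observe

/-- The covariate law `F₀`. -/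
def covLaw {p : ℕ} (Q : Measure (Unit0 p)) : Measure (Cov p) := Q.map covariate

/-- `π₀(x) = P₀(D = 1 | X = x)`. -/
def IsPropensityScore {p : ℕ} (Q : Measure (Unit0 p)) (π₀ : Cov p → ℝ) : Prop :=
  Measurable π₀ ∧
    (fun o : Obs p => π₀ o.2.2) =ᵐ[obsLaw Q]
      (obsLaw Q)[fun o : Obs p => num o.2.1 |
        MeasurableSpace.comap (fun o : Obs p => o.2.2) inferInstance]

/-- `m₀(d, x) = P₀(Y = 1 | D = d, X = x)`. -/
def IsConditionalMean {p : ℕ} (Q : Measure (Unit0 p)) (m₀ : Bool → Cov p → ℝ) : Prop :=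
  (∀ d, Measurable (m₀ d)) ∧
    (fun o : Obs p => m₀ o.2.1 o.2.2) =ᵐ[obsLaw Q]
      (obsLaw Q)[fun o : Obs p => num o.1 |
        MeasurableSpace.comap (fun o : Obs p => o.2) inferInstance]

/-- `(Y(0), Y(1))` and `D` are conditionally independent given `X`. -/
def Unconfounded {p : ℕ} (Q : Measure (Unit0 p)) [IsFiniteMeasure Q] : Prop :=
  CondIndepFun (MeasurableSpace.comap (covariate (p := p)) inferInstance)
    measurable_covariate.comap_le
    (fun z : Unit0 p => z.1) (fun z : Unit0 p => z.2.1) Q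

/-- The propensity score is bounded away from `0` and `1` on the support of `F₀`. -/
def Overlap {p : ℕ} (Q : Measure (Unit0 p)) (π₀ : Cov p → ℝ) : Prop :=
  ∃ c : ℝ, 0 < c ∧ ∀ x ∈ (covLaw Q).support, c < π₀ x ∧ π₀ x < 1 - c

/-- The average treatment effect `χ₀ = E[Y(1) - Y(0)]`. -/
def ate {p : ℕ} (Q : Measure (Unit0 p)) : ℝ := ∫ z, (num z.1.2 - num z.1.1) ∂Q

/-- Riesz representor `γ(d,x) = d / π(x) - (1 - d) / (1 - π(x))`. -/
def riesz {p : ℕ} (π : Cov p → ℝ) (d : Bool) (x : Cov p) : ℝ :=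
  num d / π x - (1 - num d) / (1 - π x)

/-- `m̄(x) = m(1,x) - m(0,x)`. -/
def bar {p : ℕ} (m : Bool → Cov p → ℝ) (x : Cov p) : ℝ := m true x - m false x

/-- The efficient influence function at the truth. -/
def eif {p : ℕ} (Q : Measure (Unit0 p)) (π₀ : Cov p → ℝ) (m₀ : Bool → Cov p → ℝ)
    (o : Obs p) : ℝ :=
  bar m₀ o.2.2 + riesz π₀ o.2.1 o.2.2 * (num o.1 - m₀ o.2.1 o.2.2) - ate Q

/-- The efficiency bound `v₀ = P₀[χ̃₀²]`. -/
def effBound {p : ℕ} (Q : Measure (Unit0 p)) (π₀ : Cov p → ℝ) (m₀ : Bool → Cov p → ℝ) : ℝ≥0 :=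
  (∫ o, (eif Q π₀ m₀ o) ^ 2 ∂(obsLaw Q)).toNNReal

/-! ### Empirical measure and empirical process -/

/-- `ℙₙ[h]`. -/
def empMean {p n : ℕ} (o : Fin n → Obs p) (h : Obs p → ℝ) : ℝ := (∑ i, h (o i)) / n

/-- `𝔾ₙ[h] = √n (ℙₙ - P)[h]`. -/
def empProc {p n : ℕ} (P : Measure (Obs p)) (o : Fin n → Obs p) (h : Obs p → ℝ) : ℝ :=
  √(n : ℝ) * (empMean o h - ∫ z, h z ∂P)

/-- The first `n` observations. -/
def sample {Ω : Type*} {p : ℕ} (O : ℕ → Ω → Obs p) (n : ℕ) (ω : Ω) : Fin n → Obs p :=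
  fun i => O i ω

/-! ### Prior and posterior -/

/-- The function `η^m = w + l γ`. -/
def tilt {p : ℕ} (w : Bool → Cov p → ℝ) (l : ℝ) (γ : Bool → Cov p → ℝ) : Bool → Cov p → ℝ :=
  fun d x => w d x + l * γ d x

/-- `m_η = Ψ(η^m)`, with `Ψ` the logistic function. -/
def condMean {p : ℕ} (η : Bool → Cov p → ℝ) : Bool → Cov p → ℝ :=
  fun d x => Real.sigmoid (η d x)

/-- The factor of the likelihood that involves `η^m`:
`∏ᵢ m_η(Dᵢ,Xᵢ)^{Yᵢ} (1 - m_η(Dᵢ,Xᵢ))^{1 - Yᵢ}`. -/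
def likelihood {p n : ℕ} (η : Bool → Cov p → ℝ) (o : Fin n → Obs p) : ℝ :=
  ∏ i, if (o i).1 then condMean η (o i).2.1 (o i).2.2 else 1 - condMean η (o i).2.1 (o i).2.2

/-- The posterior distribution of `(W, λ)`, by Bayes' rule, when `W` is a process on the
probability space `(Ξ, ν)`, independent of `λ ∼ N(0, σ²)`, and `η^m = W + λ γ`. -/
def posterior {p n : ℕ} {Ξ : Type*} [MeasurableSpace Ξ] (ν : Measure Ξ)
    (W : Ξ → Bool → Cov p → ℝ) (σ : ℝ) (γ : Bool → Cov p → ℝ) (o : Fin n → Obs p) :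
    Measure (Ξ × ℝ) :=
  let U : Measure (Ξ × ℝ) :=
    (ν.prod (gaussianReal 0 (σ ^ 2).toNNReal)).withDensity
      fun θ => ENNReal.ofReal (likelihood (tilt (W θ.1) θ.2 γ) o)
  (U Set.univ)⁻¹ • U

/-- The law of the Bayesian bootstrap weights `Mᵢ = eᵢ / ∑ⱼ eⱼ`, `eᵢ` i.i.d. standard
exponential. -/
def bootstrapWeights (n : ℕ) : Measure (Fin n → ℝ) :=
  (Measure.pi fun _ : Fin n => expMeasure 1).map fun e i => e i / ∑ j, e j

/-- `χ_η = ∫ m̄_η dF` for `F = ∑ᵢ Mᵢ δ_{Xᵢ}`. -/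
def ateFunctional {p n : ℕ} (M : Fin n → ℝ) (η : Bool → Cov p → ℝ) (o : Fin n → Obs p) : ℝ :=
  ∑ i, M i * bar (condMean η) (o i).2.2

/-- The bias term `b_{0,η} = ℙₙ[γ₀ m₀ - m̄₀] - ℙₙ[γ₀ m_η - m̄_η]`. -/
def bias {p n : ℕ} (π₀ : Cov p → ℝ) (m₀ : Bool → Cov p → ℝ) (η : Bool → Cov p → ℝ)
    (o : Fin n → Obs p) : ℝ :=
  empMean o (fun z => riesz π₀ z.2.1 z.2.2 * m₀ z.2.1 z.2.2 - bar m₀ z.2.2)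
    - empMean o (fun z => riesz π₀ z.2.1 z.2.2 * condMean η z.2.1 z.2.2 - bar (condMean η) z.2.2)

/-- The marginal posterior distribution of `√n (χ_η - χ̂ - b_{0,η})`; the posteriors of `η^m`
and of `F` are independent, the latter being the Bayesian bootstrap. -/
def marginalPosterior {p n : ℕ} {Ξ : Type*} [MeasurableSpace Ξ] (ν : Measure Ξ)
    (W : Ξ → Bool → Cov p → ℝ) (σ : ℝ) (γ : Bool → Cov p → ℝ)
    (π₀ : Cov p → ℝ) (m₀ : Bool → Cov p → ℝ) (χ : ℝ) (o : Fin n → Obs p) : Measure ℝ :=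
  ((posterior ν W σ γ o).prod (bootstrapWeights n)).map fun q =>
    √(n : ℝ) * (ateFunctional q.2 (tilt (W q.1.1) q.1.2 γ) o - χ
      - bias π₀ m₀ (tilt (W q.1.1) q.1.2 γ) o)

/-! ### Bounded Lipschitz distance -/

/-- Functions with `sup |f| + Lip(f) ≤ 1`. -/
def BL1 (E : Type*) [PseudoMetricSpace E] : Set (E → ℝ) :=
  {f | ∃ a b : ℝ, 0 ≤ a ∧ 0 ≤ b ∧ a + b ≤ 1 ∧ (∀ x, |f x| ≤ a) ∧
    ∀ x y, |f x - f y| ≤ b * dist x y}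

/-- The bounded Lipschitz distance between two probability measures. -/
def dBL {E : Type*} [PseudoMetricSpace E] [MeasurableSpace E] (P Q : Measure E) : ℝ :=
  sSup ((fun f : E → ℝ => |∫ x, f x ∂P - ∫ x, f x ∂Q|) '' BL1 E)

/-! ### Assumptions

`S n` is the auxiliary sample, `pihat n s` and `mhat n s` are the pilot estimators computed from
the value `s` of that sample, and `H n s` is the set `ℋₙᵐ` of functions `η^m`.  Events that need
not be measurable are measured by outer probability. -/

/-- Rates of convergence; the bounds hold with probability tending to one. -/
def RateConditions {Ω 𝓢 : Type*} [MeasurableSpace Ω] {p : ℕ} (μ : Measure Ω)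
    (Q : Measure (Unit0 p)) (π₀ : Cov p → ℝ) (m₀ : Bool → Cov p → ℝ) (S : ℕ → Ω → 𝓢)
    (pihat : ℕ → 𝓢 → Cov p → ℝ) (mhat : ℕ → 𝓢 → Bool → Cov p → ℝ)
    (H : ℕ → 𝓢 → Set (Bool → Cov p → ℝ)) (r ε : ℕ → ℝ) : Prop :=
  Tendsto r atTop (𝓝 0) ∧ Tendsto ε atTop (𝓝 0) ∧
  Tendsto (fun n : ℕ => √(n : ℝ) * ε n * r n) atTop (𝓝 0) ∧
  Tendsto (fun n => μ {ω | ¬ (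
      eLpNorm (fun x => pihat n (S n ω) x - π₀ x) 2 (covLaw Q) ≤ ENNReal.ofReal (r n) ∧
      (∀ d, eLpNorm (fun x => mhat n (S n ω) d x - m₀ d x) 2 (covLaw Q)
        ≤ ENNReal.ofReal (ε n)) ∧
      (∀ d, ∀ η ∈ H n (S n ω), eLpNorm (fun x => condMean η d x - m₀ d x) 2 (covLaw Q)
        ≤ ENNReal.ofReal (ε n)))}) atTop (𝓝 0) ∧
  -- the sup norm of the estimated Riesz representor is bounded in probability
  (∀ δ : ℝ≥0∞, 0 < δ → ∃ K : ℝ, ∀ᶠ n in atTop,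
    μ {ω | ¬ ∀ d, ∀ x ∈ (covLaw Q).support, |riesz (pihat n (S n ω)) d x| ≤ K} ≤ δ)

/-- The Glivenko–Cantelli and the product-type stochastic equicontinuity conditions. -/
def ComplexityConditions {Ω 𝓢 : Type*} [MeasurableSpace Ω] {p : ℕ} (μ : Measure Ω)
    (Q : Measure (Unit0 p)) (π₀ : Cov p → ℝ) (m₀ : Bool → Cov p → ℝ) (O : ℕ → Ω → Obs p)
    (S : ℕ → Ω → 𝓢) (pihat : ℕ → 𝓢 → Cov p → ℝ)
    (H : ℕ → 𝓢 → Set (Bool → Cov p → ℝ)) : Prop :=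
  (∀ δ : ℝ, 0 < δ → Tendsto (fun n => μ {ω | ∃ η ∈ H n (S n ω),
    δ < |empMean (sample O n ω) (fun z => bar (condMean η) z.2.2)
      - ∫ z, bar (condMean η) z.2.2 ∂(obsLaw Q)|}) atTop (𝓝 0)) ∧
  (∀ δ : ℝ, 0 < δ → Tendsto (fun n => μ {ω | ∃ η ∈ H n (S n ω),
    δ < |empProc (obsLaw Q) (sample O n ω) (fun z =>
      (riesz (pihat n (S n ω)) z.2.1 z.2.2 - riesz π₀ z.2.1 z.2.2)
        * (condMean η z.2.1 z.2.2 - m₀ z.2.1 z.2.2))|}) atTop (𝓝 0))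

/-- `Π(A | O⁽ⁿ⁾) → 1` in probability, for sets `A = A n s` of parameter values `(W, λ)`. -/
def PosteriorProbToOne {Ω 𝓢 Ξ : Type*} [MeasurableSpace Ω] [MeasurableSpace Ξ] {p : ℕ}
    (μ : Measure Ω) (O : ℕ → Ω → Obs p) (S : ℕ → Ω → 𝓢) (pihat : ℕ → 𝓢 → Cov p → ℝ)
    (ν : Measure Ξ) (W : ℕ → Ξ → Bool → Cov p → ℝ) (σ : ℕ → ℝ)
    (A : ℕ → 𝓢 → Set (Ξ × ℝ)) : Prop :=
  TendstoInMeasure μ (fun n ω =>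
    (posterior ν (W n) (σ n) (riesz (pihat n (S n ω))) (sample O n ω)).real (A n (S n ω)))
    atTop (fun _ => (1 : ℝ))

/-- The parameter values `(w, l)` for which `w + (l + h) γ̂` belongs to `ℋₙᵐ`. -/
def shiftedSieve {𝓢 Ξ : Type*} {p : ℕ} (pihat : ℕ → 𝓢 → Cov p → ℝ)
    (W : ℕ → Ξ → Bool → Cov p → ℝ) (H : ℕ → 𝓢 → Set (Bool → Cov p → ℝ)) (h : ℕ → ℝ)
    (n : ℕ) (s : 𝓢) : Set (Ξ × ℝ) :=
  {θ | tilt (W n θ.1) (θ.2 + h n) (riesz (pihat n s)) ∈ H n s}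

/-- Prior stability. -/
def PriorStability {Ω 𝓢 Ξ : Type*} [MeasurableSpace Ω] [MeasurableSpace Ξ] {p : ℕ}
    (μ : Measure Ω) (O : ℕ → Ω → Obs p) (S : ℕ → Ω → 𝓢) (pihat : ℕ → 𝓢 → Cov p → ℝ)
    (ν : Measure Ξ) (W : ℕ → Ξ → Bool → Cov p → ℝ) (σ : ℕ → ℝ)
    (H : ℕ → 𝓢 → Set (Bool → Cov p → ℝ)) : Prop :=
  (∀ n, 0 < σ n) ∧ Tendsto (fun n : ℕ => (n : ℝ) * σ n ^ 2) atTop atTop ∧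
  (∃ u : ℕ → ℝ, Tendsto u atTop (𝓝 0) ∧
    PosteriorProbToOne μ O S pihat ν W σ
      (fun n _ => {θ | |θ.2| ≤ u n * σ n ^ 2 * √(n : ℝ)})) ∧
  (∀ t : ℝ, PosteriorProbToOne μ O S pihat ν W σ
    (shiftedSieve pihat W H fun n => t / √(n : ℝ)))

end DRBayes

end

/-!
# The semiparametric Bernstein–von Mises theorem for the debiased average treatment effect

Write `γ̂ = γ_π̂` and `γ₀ = γ_π₀` for the estimated and the true Riesz representor. The debiased
parameter has an exact decomposition (`sqrt_mul_ateFunctional_sub`): under the posterior,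
`√n (χ_η - χ̂ - b_{0,η})` equals the score `√n ℙₙ[γ̂ (m_η - y)]`, plus the Bayesian bootstrap
`√n (F - ℙₙ) m̄₀`, plus remainders. Given the data, the score is a function of `(W, λ)` and the
bootstrap a function of the weights, so the law of their sum is a convolution. The score has the
limit `N(0, V₁)` with `V₁ = P₀[γ₀² m₀ (1 - m₀)]`, the bootstrap has the limit `N(0, V₂)` with
`V₂ = Var m̄₀(X)`, and `V₁ + V₂ = v₀` by unconfoundedness (`effBound_eq`).
All estimates for given data are collected in `dBL_marginalPosterior_le`.

*The score.* Replacing `λ` by `λ - t / √n` multiplies the likelihood by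
`exp (t · score - t² · info / 2)`, up to a uniformly negligible factor (`likelihood_shift`), where
`info = ℙₙ[γ̂² m_η (1 - m_η)]`, and it multiplies the normal prior density by
`exp (t λ / (√n σ²) - t² / (2 n σ²))`. As the posterior is invariant under this change of variable
(`lintegral_posterior_tilt`), the exponential tilts of `score + λ / (√n σ²)` have posterior mean
one, whatever the data. Once `info` is close to `V₁` in posterior mean, the moment generating
function is close to that of `N(0, V₁)` (`exists_dBL_map_le_of_tilt`), and this gives a bound on the
bounded Lipschitz distance that is uniform in the data (`exists_dBL_le_of_mgf`,
`exists_dBL_score_le`). The drift `λ / (√n σ²)` is negligible because `|λ| ≤ u_n σ_n² √n` with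
posterior probability tending to one.

*The posterior distance at the data.* Both the convergence of `info` and the replacement of `m̄_η` by
`m̄₀` in the bootstrap need that `ℙₙ|m_η - m₀|` tends to zero in posterior mean, whereas the rate
assumption bounds a population norm. The gap is closed by a leave-one-out argument
(`lintegral_leave_one_out_le`): the `i`th data point enters the posterior through a single Bernoulli
factor, and under the true law, reweighting a measure on regression functions near `m₀` by one such
factor costs at most a constant.

*The bootstrap.* Normalized exponential weights are handled through sums of independent exponential
variables, whose moment generating function is explicit (`mgf_expSum`, `exists_dBL_bootMean_le`).

*The product of errors.* The remainder `√n ℙₙ[(γ̂ - γ₀)(y - m_η)]` splits (`nuisance_eq`) into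
`√n ℙₙ[(γ̂ - γ₀)(y - m₀)]`, which is centred with variance at most a multiple of `‖π̂ - π₀‖²` given
the auxiliary sample, the empirical process `𝔾ₙ[(γ̂ - γ₀)(m_η - m₀)]`, which is negligible by
assumption, and a population product, which is at most a multiple of `√n r_n ε_n`.

The estimated representor is bounded only in probability, so the convergence is shown on the event
that it is at most `K` (`whp_dBL_marginalPosterior_lt`), for every `K`.
-/

noncomputable section

namespace DRBayes

universe u

/-! ### The bounded Lipschitz distance -/

lemma BL1.abs_le_one {E : Type*} [PseudoMetricSpace E] {f : E → ℝ} (hf : f ∈ BL1 E) (x : E) :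
    |f x| ≤ 1 := by
  obtain ⟨a, b, ha, hb, hab, h1, -⟩ := hf
  exact (h1 x).trans (by linarith)

lemma BL1.abs_sub_le_dist {E : Type*} [PseudoMetricSpace E] {f : E → ℝ} (hf : f ∈ BL1 E)
    (x y : E) : |f x - f y| ≤ dist x y := by
  obtain ⟨a, b, ha, hb, hab, -, h2⟩ := hf
  have : b ≤ 1 := by linarith
  exact (h2 x y).trans (mul_le_of_le_one_left dist_nonneg this)

lemma BL1.continuous {E : Type*} [PseudoMetricSpace E] {f : E → ℝ} (hf : f ∈ BL1 E) :
    Continuous f := by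
  refine (LipschitzWith.of_dist_le_mul (K := 1) fun x y => ?_).continuous
  simpa [Real.dist_eq] using BL1.abs_sub_le_dist hf x y

lemma BL1.abs_sub_le_min {E : Type*} [PseudoMetricSpace E] {f : E → ℝ} (hf : f ∈ BL1 E)
    (x y : E) : |f x - f y| ≤ 2 * min 1 (dist x y) := by
  have h1 := BL1.abs_sub_le_dist hf x y
  have h2 : |f x - f y| ≤ 2 := by
    have := abs_sub (f x) (f y)
    linarith [BL1.abs_le_one hf x, BL1.abs_le_one hf y]
  have h3 : (0 : ℝ) ≤ dist x y := dist_nonneg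
  rcases min_cases (1 : ℝ) (dist x y) with h | h <;> rw [h.1] <;> linarith

lemma BL1.integrable {E : Type*} [PseudoMetricSpace E] [MeasurableSpace E] [BorelSpace E]
    {f : E → ℝ} (hf : f ∈ BL1 E) (P : Measure E) [IsFiniteMeasure P] : Integrable f P :=
  Integrable.of_bound (BL1.continuous hf).measurable.aestronglyMeasurable 1
    (ae_of_all _ fun x => by simpa using BL1.abs_le_one hf x)

lemma zero_mem_BL1 (E : Type*) [PseudoMetricSpace E] : (0 : E → ℝ) ∈ BL1 E :=
  ⟨0, 0, le_rfl, le_rfl, by norm_num, by simp, by simp⟩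

lemma dBL_le {E : Type*} [PseudoMetricSpace E] [MeasurableSpace E] {P Q : Measure E} {c : ℝ}
    (h : ∀ f ∈ BL1 E, |∫ x, f x ∂P - ∫ x, f x ∂Q| ≤ c) : dBL P Q ≤ c := by
  refine csSup_le ⟨_, Set.mem_image_of_mem _ (zero_mem_BL1 E)⟩ ?_
  rintro _ ⟨f, hf, rfl⟩
  exact h f hf

lemma abs_integral_sub_le_dBL {E : Type*} [PseudoMetricSpace E] [MeasurableSpace E] [BorelSpace E]
    {P Q : Measure E} [IsProbabilityMeasure P] [IsProbabilityMeasure Q]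
    {f : E → ℝ} (hf : f ∈ BL1 E) : |∫ x, f x ∂P - ∫ x, f x ∂Q| ≤ dBL P Q := by
  refine le_csSup ⟨2, ?_⟩ (Set.mem_image_of_mem _ hf)
  rintro _ ⟨g, hg, rfl⟩
  have key : ∀ ρ : Measure E, [IsProbabilityMeasure ρ] → |∫ x, g x ∂ρ| ≤ 1 := fun ρ _ => by
    simpa using norm_integral_le_of_norm_le_const (μ := ρ) (f := g) (C := 1)
      (ae_of_all _ fun x => by simpa using BL1.abs_le_one hg x)
  have := abs_sub (∫ x, g x ∂P) (∫ x, g x ∂Q)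
  linarith [key P, key Q]

lemma dBL_nonneg {E : Type*} [PseudoMetricSpace E] [MeasurableSpace E] (P Q : Measure E) :
    0 ≤ dBL P Q := by
  refine Real.sSup_nonneg ?_
  rintro _ ⟨f, -, rfl⟩
  exact abs_nonneg _

lemma BL1.comp_add_right {f : ℝ → ℝ} (hf : f ∈ BL1 ℝ) (y : ℝ) : (fun x => f (x + y)) ∈ BL1 ℝ := by
  obtain ⟨a, b, ha, hb, hab, h1, h2⟩ := hf
  exact ⟨a, b, ha, hb, hab, fun x => h1 _, fun x z => by simpa using h2 (x + y) (z + y)⟩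

lemma BL1.comp_add_left {f : ℝ → ℝ} (hf : f ∈ BL1 ℝ) (y : ℝ) : (fun x => f (y + x)) ∈ BL1 ℝ := by
  simpa [add_comm] using BL1.comp_add_right hf y

/-- The bounded Lipschitz distance is subadditive under convolution. -/
lemma dBL_conv_le (P P' Q Q' : Measure ℝ) [IsProbabilityMeasure P] [IsProbabilityMeasure P']
    [IsProbabilityMeasure Q] [IsProbabilityMeasure Q'] :
    dBL (P.conv Q) (P'.conv Q') ≤ dBL P P' + dBL Q Q' := by
  refine dBL_le fun f hf => ?_
  have hint : ∀ A B : Measure ℝ, [IsProbabilityMeasure A] → [IsProbabilityMeasure B] →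
      Integrable (fun z : ℝ × ℝ => f (z.1 + z.2)) (A.prod B) := fun A B _ _ =>
    Integrable.of_bound ((BL1.continuous hf).comp (by fun_prop)).measurable.aestronglyMeasurable 1
      (ae_of_all _ fun z => by simpa using BL1.abs_le_one hf _)
  have h1 : ∀ A B : Measure ℝ, [IsProbabilityMeasure A] → [IsProbabilityMeasure B] →
      ∫ x, f x ∂(A.conv B) = ∫ x, ∫ y, f (x + y) ∂B ∂A := fun A B _ _ => by
    rw [Measure.conv, integral_map (by fun_prop) (BL1.continuous hf).aestronglyMeasurable,
      integral_prod _ (hint A B)]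
  have h2 : ∀ A B : Measure ℝ, [IsProbabilityMeasure A] → [IsProbabilityMeasure B] →
      ∫ x, f x ∂(A.conv B) = ∫ y, ∫ x, f (x + y) ∂A ∂B := fun A B _ _ => by
    rw [Measure.conv, integral_map (by fun_prop) (BL1.continuous hf).aestronglyMeasurable,
      integral_prod_symm _ (hint A B)]
  have a1 : |∫ x, f x ∂(P.conv Q) - ∫ x, f x ∂(P'.conv Q)| ≤ dBL P P' := by
    rw [h2 P Q, h2 P' Q, ← integral_sub (hint P Q).integral_prod_right
      (hint P' Q).integral_prod_right]
    have := norm_integral_le_of_norm_le_const (μ := Q) (C := dBL P P')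
      (f := fun y => ∫ x, f (x + y) ∂P - ∫ x, f (x + y) ∂P')
      (ae_of_all _ fun y => abs_integral_sub_le_dBL (BL1.comp_add_right hf y))
    simpa using this
  have a2 : |∫ x, f x ∂(P'.conv Q) - ∫ x, f x ∂(P'.conv Q')| ≤ dBL Q Q' := by
    rw [h1 P' Q, h1 P' Q', ← integral_sub (hint P' Q).integral_prod_left
      (hint P' Q').integral_prod_left]
    have := norm_integral_le_of_norm_le_const (μ := P') (C := dBL Q Q')
      (f := fun x => ∫ y, f (x + y) ∂Q - ∫ y, f (x + y) ∂Q')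
      (ae_of_all _ fun x => abs_integral_sub_le_dBL (BL1.comp_add_left hf x))
    simpa using this
  calc _ = |(∫ x, f x ∂(P.conv Q) - ∫ x, f x ∂(P'.conv Q))
        + (∫ x, f x ∂(P'.conv Q) - ∫ x, f x ∂(P'.conv Q'))| := by congr 1; ring
    _ ≤ _ := (abs_add_le _ _).trans (add_le_add a1 a2)

/-- Two random variables that are close in probability have laws that are close. -/
lemma dBL_map_le {Θ : Type*} [MeasurableSpace Θ] (ρ : Measure Θ) [IsProbabilityMeasure ρ]
    {T U : Θ → ℝ} (hT : Measurable T) (hU : Measurable U) (Q : Measure ℝ) [IsProbabilityMeasure Q] :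
    dBL (ρ.map T) Q ≤ 2 * ∫ θ, min 1 |T θ - U θ| ∂ρ + dBL (ρ.map U) Q := by
  have : IsProbabilityMeasure (ρ.map U) := Measure.isProbabilityMeasure_map hU.aemeasurable
  refine dBL_le fun f hf => ?_
  have hi : ∀ {V : Θ → ℝ}, Measurable V → Integrable (fun θ => f (V θ)) ρ := fun {V} hV =>
    Integrable.of_bound ((BL1.continuous hf).measurable.comp hV).aestronglyMeasurable 1
      (ae_of_all _ fun z => by simpa using BL1.abs_le_one hf _)
  have a1 : |∫ x, f x ∂(ρ.map T) - ∫ x, f x ∂(ρ.map U)| ≤ 2 * ∫ θ, min 1 |T θ - U θ| ∂ρ := by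
    rw [integral_map hT.aemeasurable (BL1.continuous hf).aestronglyMeasurable,
      integral_map hU.aemeasurable (BL1.continuous hf).aestronglyMeasurable,
      ← integral_sub (hi hT) (hi hU), ← integral_const_mul]
    refine norm_integral_le_of_norm_le (f := fun θ => f (T θ) - f (U θ)) ?_
      (ae_of_all _ fun θ => ?_)
    · refine Integrable.const_mul (Integrable.of_bound (C := 1) ?_ (ae_of_all _ fun z => ?_)) _
      · exact (measurable_const.min (hT.sub hU).abs).aestronglyMeasurable
      · rw [Real.norm_of_nonneg (le_min zero_le_one (abs_nonneg _))]
        exact min_le_left _ _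
    · simpa [Real.dist_eq] using BL1.abs_sub_le_min hf (T θ) (U θ)
  calc _ = |(∫ x, f x ∂(ρ.map T) - ∫ x, f x ∂(ρ.map U))
        + (∫ x, f x ∂(ρ.map U) - ∫ x, f x ∂Q)| := by congr 1; ring
    _ ≤ _ := (abs_add_le _ _).trans (add_le_add a1 (abs_integral_sub_le_dBL hf))

lemma BL1.integral_sub_le_of_levyProkhorov {P Q : Measure ℝ} [IsProbabilityMeasure P]
    [IsProbabilityMeasure Q] {ε : ℝ} (hε : 0 < ε)
    (h : levyProkhorovEDist P Q < ENNReal.ofReal ε) {f : ℝ → ℝ} (hf : f ∈ BL1 ℝ) :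
    ∫ x, f x ∂P - ∫ x, f x ∂Q ≤ 3 * ε := by
  let F : BoundedContinuousFunction ℝ ℝ :=
    BoundedContinuousFunction.ofNormedAddCommGroup f (BL1.continuous hf) 1
      fun x => by simpa using BL1.abs_le_one hf x
  let G := F + BoundedContinuousFunction.const ℝ 1
  let K := F + BoundedContinuousFunction.const ℝ (1 + ε)
  have hG : ∀ x, G x = f x + 1 := fun x => rfl
  have hK : ∀ x, K x = f x + (1 + ε) := fun x => rfl
  have hb := fun x => abs_le.1 (BL1.abs_le_one hf x)
  have hG0 : ∀ x, 0 ≤ G x := fun x => by rw [hG]; linarith [(hb x).1]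
  have hGn : ‖G‖ ≤ 2 := by
    refine (BoundedContinuousFunction.norm_le (by norm_num)).2 fun x => ?_
    rw [Real.norm_of_nonneg (hG0 x), hG]; linarith [(hb x).2]
  have hGK : ‖G‖ ≤ ‖K‖ := by
    refine (BoundedContinuousFunction.norm_le (norm_nonneg _)).2 fun x => ?_
    refine le_trans ?_ (K.norm_coe_le_norm x)
    rw [Real.norm_of_nonneg (hG0 x), hG, hK, Real.norm_of_nonneg (by linarith [(hb x).1])]
    linarith
  have h1 := BoundedContinuousFunction.integral_le_of_levyProkhorovEDist_lt P Q hε h G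
    (ae_of_all _ hG0)
  have h2 := BoundedContinuousFunction.integral_eq_integral_meas_le K Q
    (ae_of_all _ fun x => by
      change (0 : ℝ) ≤ K x
      rw [hK]; linarith [(hb x).1])
  have hanti : Antitone fun t : ℝ => Q.real {a | t ≤ K a} := fun s t hst =>
    measureReal_mono fun _ h => hst.trans h
  have hKi : IntegrableOn (fun t : ℝ => Q.real {a | t ≤ K a}) (Set.Ioc 0 ‖K‖) :=
    Measure.integrableOn_of_bounded (M := 1) measure_Ioc_lt_top.ne
      hanti.measurable.aestronglyMeasurable
      (ae_of_all _ fun t => by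
        rw [Real.norm_of_nonneg measureReal_nonneg]; exact measureReal_le_one)
  have h3 : (∫ t in Set.Ioc 0 ‖G‖, Q.real (Metric.thickening ε {a | t ≤ G a}))
      ≤ ∫ t in Set.Ioc 0 ‖K‖, Q.real {a | t ≤ K a} := by
    refine le_trans ?_ (setIntegral_mono_set hKi (ae_of_all _ fun t => measureReal_nonneg)
      (Set.Ioc_subset_Ioc_right hGK).eventuallyLE)
    refine setIntegral_mono ?_ (hKi.mono_set (Set.Ioc_subset_Ioc_right hGK)) fun t => ?_
    · have hanti' : Antitone fun t : ℝ => Q.real (Metric.thickening ε {a | t ≤ G a}) :=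
        fun s t hst => measureReal_mono
          (Metric.thickening_subset_of_subset ε fun _ h => hst.trans h)
      exact Measure.integrableOn_of_bounded (M := 1) measure_Ioc_lt_top.ne
        hanti'.measurable.aestronglyMeasurable
        (ae_of_all _ fun t => by
          rw [Real.norm_of_nonneg measureReal_nonneg]; exact measureReal_le_one)
    · refine measureReal_mono fun x hx => ?_
      obtain ⟨y, hy, hxy⟩ := Metric.mem_thickening_iff.1 hx
      have hy' : t ≤ G y := hy
      change t ≤ K x
      rw [hG] at hy'
      rw [hK]
      have := (abs_le.1 (BL1.abs_sub_le_dist hf x y)).1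
      linarith
  have e1 : ∫ x, G x ∂P = ∫ x, f x ∂P + 1 := by
    simp only [hG]
    rw [integral_add (BL1.integrable hf P) (integrable_const _)]; simp
  have e2 : ∫ x, K x ∂Q = ∫ x, f x ∂Q + (1 + ε) := by
    simp only [hK]
    rw [integral_add (BL1.integrable hf Q) (integrable_const _)]; simp
  rw [e1] at h1
  rw [e2] at h2
  nlinarith

/-- Weak convergence implies convergence in the bounded Lipschitz distance. -/
lemma tendsto_dBL_of_tendsto {ι : Type*} {l : Filter ι} {P : ι → ProbabilityMeasure ℝ}
    {Q : ProbabilityMeasure ℝ} (h : Tendsto P l (𝓝 Q)) :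
    Tendsto (fun i => dBL (P i : Measure ℝ) (Q : Measure ℝ)) l (𝓝 0) := by
  have h' := (LevyProkhorov.continuous_ofMeasure_probabilityMeasure (Ω := ℝ)).tendsto Q |>.comp h
  rw [Metric.tendsto_nhds]
  intro ε hε
  rw [tendsto_iff_edist_tendsto_0] at h'
  have h4 := h'.eventually_lt_const (u := ENNReal.ofReal (ε / 6)) (by simpa using hε)
  filter_upwards [h4] with i hi
  have hi' : levyProkhorovEDist (P i : Measure ℝ) (Q : Measure ℝ) < ENNReal.ofReal (ε / 6) := hi
  rw [Real.dist_eq, sub_zero, abs_of_nonneg (dBL_nonneg _ _)]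
  refine lt_of_le_of_lt (dBL_le (c := 3 * (ε / 6)) fun f hf => abs_le.2 ⟨?_, ?_⟩) (by linarith)
  · have := BL1.integral_sub_le_of_levyProkhorov (by positivity)
      (levyProkhorovEDist_comm (P i : Measure ℝ) (Q : Measure ℝ) ▸ hi') hf
    linarith
  · exact BL1.integral_sub_le_of_levyProkhorov (by positivity) hi' hf

/-! ### Convergence of moment generating functions -/

/-- The part of `exp (t x)` above the level `M` is dominated by `exp (2 t x) / M`. -/
lemma exp_le_min_add {M : ℝ} (hM : 0 < M) (y : ℝ) :
    Real.exp y ≤ min (Real.exp y) M + Real.exp (2 * y) / M := by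
  have h2 : Real.exp (2 * y) = Real.exp y * Real.exp y := by rw [← Real.exp_add]; ring_nf
  rcases le_total (Real.exp y) M with h | h
  · rw [min_eq_left h]
    have : 0 ≤ Real.exp (2 * y) / M := by positivity
    linarith
  · rw [min_eq_right h, h2]
    have : Real.exp y ≤ Real.exp y * Real.exp y / M := by
      rw [le_div_iff₀ hM]
      exact mul_le_mul_of_nonneg_left h (Real.exp_pos _).le
    linarith

/-- A probability measure on `ℝ` with the moment generating function of a centred Gaussian measure
is this Gaussian measure. -/
lemma eq_gaussianReal_of_mgf {P : Measure ℝ} [IsProbabilityMeasure P] {v : ℝ≥0}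
    (h : ∀ t : ℝ, mgf id P t = Real.exp (v * t ^ 2 / 2)) : P = gaussianReal 0 v := by
  have hm : mgf id P = mgf id (gaussianReal 0 v) := by
    rw [mgf_id_gaussianReal]
    ext t
    simpa using h t
  have hset : integrableExpSet id P = Set.univ := by
    refine Set.eq_univ_of_forall fun t => ?_
    have : mgf id P t ≠ 0 := by rw [h]; exact (Real.exp_pos _).ne'
    by_contra hn
    exact this (mgf_undef hn)
  refine Measure.ext_of_complexMGF_id_eq ?_
  ext z
  exact eqOn_complexMGF_of_mgf hm (by simp [hset])

lemma integrable_min_exp (P : Measure ℝ) [IsFiniteMeasure P] (t : ℝ) {M : ℝ} (hM : 0 < M) :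
    Integrable (fun x => min (Real.exp (t * x)) M) P :=
  Integrable.of_bound (by fun_prop) M (ae_of_all _ fun x => by
    rw [Real.norm_of_nonneg (le_min (Real.exp_pos _).le hM.le)]; exact min_le_right _ _)

/-- If the moment generating functions along a weakly convergent ultrafilter converge everywhere
to that of a centred Gaussian measure, then the weak limit is this Gaussian measure. -/
lemma eq_gaussianReal_of_tendsto_mgf {ι : Type*} {l : Filter ι} [l.NeBot]
    {P : ι → ProbabilityMeasure ℝ} {Q : ProbabilityMeasure ℝ} (hQ : Tendsto P l (𝓝 Q)) {v : ℝ≥0}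
    (hint : ∀ t : ℝ, ∀ᶠ i in l, Integrable (fun x => Real.exp (t * x)) (P i : Measure ℝ))
    (h : ∀ t : ℝ, Tendsto (fun i => mgf id (P i : Measure ℝ) t) l
      (𝓝 (Real.exp (v * t ^ 2 / 2)))) : (Q : Measure ℝ) = gaussianReal 0 v := by
  refine eq_gaussianReal_of_mgf fun t => ?_
  have hmgf : ∀ i s, mgf id (P i : Measure ℝ) s = ∫ x, Real.exp (s * x) ∂(P i : Measure ℝ) :=
    fun i s => rfl
  -- truncated exponentials are bounded and continuous
  have htr : ∀ M : ℝ, 0 < M → Tendsto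
      (fun i => ∫ x, min (Real.exp (t * x)) M ∂(P i : Measure ℝ)) l
      (𝓝 (∫ x, min (Real.exp (t * x)) M ∂(Q : Measure ℝ))) := fun M hM => by
    let F : BoundedContinuousFunction ℝ ℝ := BoundedContinuousFunction.ofNormedAddCommGroup
      (fun x => min (Real.exp (t * x)) M) (by fun_prop) M fun x => by
        rw [Real.norm_of_nonneg (le_min (Real.exp_pos _).le hM.le)]; exact min_le_right _ _
    exact (ProbabilityMeasure.tendsto_iff_forall_integral_tendsto.1 hQ) F
  set e := Real.exp (v * t ^ 2 / 2)
  set e2 := Real.exp (v * (2 * t) ^ 2 / 2)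
  have hup : ∀ M : ℝ, 0 < M → ∫ x, min (Real.exp (t * x)) M ∂(Q : Measure ℝ) ≤ e :=
    fun M hM => by
      refine le_of_tendsto_of_tendsto (htr M hM) (h t) ?_
      filter_upwards [hint t] with i hi
      rw [hmgf]
      exact integral_mono (integrable_min_exp _ t hM) hi fun x => min_le_left _ _
  have hlo : ∀ M : ℝ, 0 < M → e ≤ ∫ x, min (Real.exp (t * x)) M ∂(Q : Measure ℝ) + e2 / M :=
    fun M hM => by
      refine le_of_tendsto_of_tendsto (h t) ((htr M hM).add ((h (2 * t)).div_const M)) ?_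
      filter_upwards [hint t, hint (2 * t)] with i hi hi2
      rw [hmgf, hmgf, ← integral_div, ← integral_add (integrable_min_exp _ t hM) (hi2.div_const M)]
      refine integral_mono hi ((integrable_min_exp _ t hM).add (hi2.div_const M)) fun x => ?_
      simpa [mul_assoc] using exp_le_min_add hM (t * x)
  have hmono : Monotone fun (k : ℕ) (x : ℝ) => min (Real.exp (t * x)) ((k : ℝ) + 1) := by
    intro k k' hk x
    exact min_le_min_left _ (by simpa using hk)
  have hpt : ∀ x, Tendsto (fun k : ℕ => min (Real.exp (t * x)) ((k : ℝ) + 1)) atTop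
      (𝓝 (Real.exp (t * x))) := fun x => by
    refine tendsto_const_nhds.congr' ?_
    filter_upwards [eventually_ge_atTop ⌈Real.exp (t * x)⌉₊] with k hk
    have : Real.exp (t * x) ≤ k := (Nat.le_ceil _).trans (by exact_mod_cast hk)
    rw [min_eq_left (by linarith)]
  have hQi : Integrable (fun x => Real.exp (t * x)) (Q : Measure ℝ) := by
    refine ⟨by fun_prop, ?_⟩
    rw [hasFiniteIntegral_iff_ofReal (ae_of_all _ fun x => (Real.exp_pos _).le)]
    have := lintegral_tendsto_of_tendsto_of_monotone (μ := (Q : Measure ℝ))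
      (f := fun (k : ℕ) x => ENNReal.ofReal (min (Real.exp (t * x)) ((k : ℝ) + 1)))
      (F := fun x => ENNReal.ofReal (Real.exp (t * x)))
      (fun k => by fun_prop)
      (ae_of_all _ fun x k k' hk => ENNReal.ofReal_le_ofReal (hmono hk x))
      (ae_of_all _ fun x => (ENNReal.continuous_ofReal.tendsto _).comp (hpt x))
    refine lt_of_le_of_lt (le_of_tendsto' this fun k => ?_) (ENNReal.ofReal_lt_top (r := e))
    rw [← ofReal_integral_eq_lintegral_ofReal (integrable_min_exp _ t (by positivity))
      (ae_of_all _ fun x => le_min (Real.exp_pos _).le (by positivity))]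
    exact ENNReal.ofReal_le_ofReal (hup _ (by positivity))
  have hconv := integral_tendsto_of_tendsto_of_monotone (μ := (Q : Measure ℝ))
    (fun k : ℕ => integrable_min_exp (Q : Measure ℝ) t (M := (k : ℝ) + 1) (by positivity)) hQi
    (ae_of_all _ fun x k k' hk => hmono hk x) (ae_of_all _ hpt)
  have hM0 : Tendsto (fun k : ℕ => e2 / ((k : ℝ) + 1)) atTop (𝓝 0) :=
    tendsto_const_nhds.div_atTop (tendsto_atTop_add_const_right _ _ tendsto_natCast_atTop_atTop)
  refine le_antisymm (le_of_tendsto' hconv fun k => hup _ (by positivity)) ?_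
  simpa [mgf] using ge_of_tendsto' (hconv.add hM0) fun k => hlo _ (by positivity)

/-- The exponential Markov inequality on both sides. -/
lemma measure_compl_Icc_le {P : Measure ℝ} [IsProbabilityMeasure P] {C : ℝ}
    (h : ∀ t : ℝ, |t| ≤ 1 → Integrable (fun x => Real.exp (t * x)) P ∧ mgf id P t ≤ C) (r : ℝ) :
    P (Set.Icc (-r) r)ᶜ ≤ ENNReal.ofReal (2 * C * Real.exp (-r)) := by
  have h1 := h 1 (by simp)
  have h2 := h (-1) (by simp)
  have a1 := measure_ge_le_exp_mul_mgf (X := id) (μ := P) r (t := 1) (by norm_num) h1.1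
  have a2 := measure_le_le_exp_mul_mgf (X := id) (μ := P) (-r) (t := -1) (by norm_num) h2.1
  have hs : (Set.Icc (-r) r)ᶜ ⊆ {x : ℝ | r ≤ id x} ∪ {x : ℝ | id x ≤ -r} := by
    intro x hx
    simp only [Set.mem_compl_iff, Set.mem_Icc, not_and_or, not_le] at hx
    rcases hx with h | h
    · exact Or.inr h.le
    · exact Or.inl h.le
  have e0 := (Real.exp_pos (-r)).le
  have : P.real (Set.Icc (-r) r)ᶜ ≤ 2 * C * Real.exp (-r) := by
    refine (measureReal_mono hs).trans ((measureReal_union_le _ _).trans ?_)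
    have b1 := mul_le_mul_of_nonneg_left h1.2 e0
    have b2 := mul_le_mul_of_nonneg_left h2.2 e0
    simp only [neg_mul, one_mul, neg_neg] at a1 a2
    linarith [a1.trans b1, a2.trans b2]
  rw [measureReal_def] at this
  exact (ENNReal.le_ofReal_iff_toReal_le (measure_ne_top _ _) ((ENNReal.toReal_nonneg).trans this)).2
    this

/-- A quantitative form of the continuity theorem for moment generating functions, uniform over all
probability measures: proximity of the moment generating functions on a large interval implies
proximity to the Gaussian measure in the bounded Lipschitz distance. -/
lemma exists_dBL_le_of_mgf (v : ℝ≥0) {δ : ℝ} (hδ : 0 < δ) :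
    ∃ τ : ℝ, 0 < τ ∧ ∃ T : ℝ, ∀ P : Measure ℝ, IsProbabilityMeasure P →
      (∀ t : ℝ, |t| ≤ T → Integrable (fun x => Real.exp (t * x)) P ∧
        |∫ x, Real.exp (t * x) ∂P - Real.exp (v * t ^ 2 / 2)| ≤ τ) →
      dBL P (gaussianReal 0 v) ≤ δ := by
  by_contra! hcon
  have hN : ∀ N : ℕ, ∃ P : Measure ℝ, IsProbabilityMeasure P ∧
      (∀ t : ℝ, |t| ≤ (N : ℝ) + 1 → Integrable (fun x => Real.exp (t * x)) P ∧
        |∫ x, Real.exp (t * x) ∂P - Real.exp (v * t ^ 2 / 2)| ≤ 1 / ((N : ℝ) + 1)) ∧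
      δ < dBL P (gaussianReal 0 v) := fun N => hcon _ (by positivity) _
  choose P hP hm hd using hN
  let P' : ℕ → ProbabilityMeasure ℝ := fun N => ⟨P N, hP N⟩
  let Q : ProbabilityMeasure ℝ := ⟨gaussianReal 0 v, inferInstance⟩
  have htight : IsTightMeasureSet {((μ : ProbabilityMeasure ℝ) : Measure ℝ) | μ ∈ Set.range P'} := by
    rw [isTightMeasureSet_iff_exists_isCompact_measure_compl_le]
    intro ε hε
    set C := Real.exp (v / 2) + 1
    have hlim : Tendsto (fun r : ℝ => ENNReal.ofReal (2 * C * Real.exp (-r))) atTop (𝓝 0) := by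
      have := (Real.tendsto_exp_atBot.comp tendsto_neg_atTop_atBot).const_mul (2 * C)
      simpa [Function.comp_def] using (ENNReal.continuous_ofReal.tendsto _).comp this
    obtain ⟨r, hr⟩ := (hlim.eventually_le_const hε).exists
    refine ⟨Set.Icc (-r) r, isCompact_Icc, ?_⟩
    rintro _ ⟨_, ⟨N, rfl⟩, rfl⟩
    refine (measure_compl_Icc_le (P := P N) (C := C) (fun t ht => ?_) r).trans hr
    have hN : (0 : ℝ) ≤ N := Nat.cast_nonneg N
    have := hm N t (by linarith)
    refine ⟨this.1, ?_⟩
    have h1 := (abs_le.1 this.2).2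
    have h2 : 1 / ((N : ℝ) + 1) ≤ 1 := by
      rw [div_le_one (by positivity)]; linarith
    have h3 : Real.exp (v * t ^ 2 / 2) ≤ Real.exp (v / 2) := by
      have : t ^ 2 ≤ 1 := by rw [sq_le_one_iff_abs_le_one]; exact ht
      gcongr
      nlinarith [v.2]
    have h4 : mgf id (P N) t = ∫ x, Real.exp (t * x) ∂(P N) := rfl
    rw [h4]
    linarith
  have hlim : Tendsto P' atTop (𝓝 Q) := by
    refine (Filter.tendsto_iff_ultrafilter _ _ _).2 fun U hU => ?_
    obtain ⟨μ', -, hμ'⟩ := (isCompact_closure_of_isTightMeasureSet htight).ultrafilter_le_nhds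
      (U.map P') (.trans (by simp) (Filter.monotone_principal subset_closure))
    have hμ'' : Tendsto P' U (𝓝 μ') := hμ'
    suffices μ' = Q by rwa [← this]
    refine Subtype.ext (eq_gaussianReal_of_tendsto_mgf hμ'' (fun t => ?_) fun t => ?_)
    · refine hU ?_
      filter_upwards [eventually_ge_atTop ⌈|t|⌉₊] with N hN
      have : |t| ≤ N := (Nat.le_ceil _).trans (by exact_mod_cast hN)
      exact (hm N t (by linarith)).1
    · refine Tendsto.mono_left ?_ hU
      rw [tendsto_iff_dist_tendsto_zero]
      refine squeeze_zero' (Eventually.of_forall fun _ => dist_nonneg) ?_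
        tendsto_one_div_add_atTop_nhds_zero_nat
      filter_upwards [eventually_ge_atTop ⌈|t|⌉₊] with N hN
      have : |t| ≤ N := (Nat.le_ceil _).trans (by exact_mod_cast hN)
      rw [Real.dist_eq]
      exact (hm N t (by linarith)).2
  have := (tendsto_dBL_of_tendsto hlim).eventually_lt_const hδ
  obtain ⟨N, hN⟩ := this.exists
  exact lt_asymm hN (hd N)

/-! ### Sums over product measures and the exponential distribution -/

/-- Second moment of a sum of centred functions of independent coordinates. -/
lemma integral_sq_sum_pi {n : ℕ} {X : Type*} [MeasurableSpace X] (P : Measure X)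
    [IsProbabilityMeasure P] (f : Fin n → X → ℝ) (hf : ∀ i, MemLp (f i) 2 P)
    (h0 : ∀ i, ∫ x, f i x ∂P = 0) :
    MemLp (fun x : Fin n → X => ∑ i, f i (x i)) 2 (Measure.pi fun _ => P) ∧
      ∫ x, (∑ i, f i (x i)) ^ 2 ∂(Measure.pi fun _ : Fin n => P) = ∑ i, ∫ x, f i x ^ 2 ∂P := by
  have hm : ∀ i, MemLp (fun x : Fin n → X => f i (x i)) 2 (Measure.pi fun _ => P) := fun i =>
    (hf i).comp_measurePreserving (measurePreserving_eval _ i)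
  have hmem : MemLp (fun x : Fin n → X => ∑ i, f i (x i)) 2 (Measure.pi fun _ => P) :=
    memLp_finsetSum _ fun i _ => hm i
  have h1 : ∫ x, ∑ i, f i (x i) ∂(Measure.pi fun _ : Fin n => P) = 0 := by
    rw [integral_finsetSum _ fun i _ => (hm i).integrable (by norm_num)]
    refine Finset.sum_eq_zero fun i _ => ?_
    rw [← h0 i]
    exact integral_comp_eval (μ := fun _ : Fin n => P) (i := i) (hf i).aestronglyMeasurable
  have hv := variance_sum_pi (μ := fun _ : Fin n => P) (X := f) hf
  rw [variance_of_integral_eq_zero] at hv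
  · refine ⟨hmem, ?_⟩
    simp only [Finset.sum_apply] at hv
    rw [hv]
    refine Finset.sum_congr rfl fun i _ => ?_
    rw [variance_of_integral_eq_zero (hf i).aestronglyMeasurable.aemeasurable (h0 i)]
  · convert hmem.aestronglyMeasurable.aemeasurable using 1
    ext x; simp
  · simpa using h1

/-- First moments are dominated by second moments. -/
lemma integral_abs_le_sqrt {Θ : Type*} [MeasurableSpace Θ] (P : Measure Θ)
    [IsProbabilityMeasure P] {f : Θ → ℝ} (hf : MemLp f 2 P) :
    ∫ x, |f x| ∂P ≤ √(∫ x, f x ^ 2 ∂P) := by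
  refine Real.le_sqrt_of_sq_le ?_
  have h := variance_nonneg (fun x => |f x|) P
  rw [variance_eq_sub (X := fun x => |f x|) hf.abs] at h
  simp only [Pi.pow_apply, sq_abs] at h
  linarith

instance : IsProbabilityMeasure (expMeasure 1) := isProbabilityMeasure_expMeasure one_pos

lemma expMeasure_one_eq :
    expMeasure 1 = (volume.restrict (Set.Ioi (0 : ℝ))).withDensity
      fun x => ((Real.exp (-x)).toNNReal : ℝ≥0∞) := by
  rw [expMeasure, gammaMeasure, ← withDensity_indicator measurableSet_Ioi]
  refine withDensity_congr_ae ?_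
  have h0 : ∀ᵐ x : ℝ, x ≠ 0 := by simp [ae_iff]
  filter_upwards [h0] with x hx
  rcases lt_or_gt_of_ne hx with h | h
  · rw [gammaPDF_of_neg h, Set.indicator_of_notMem (by simpa using h.le)]
  · rw [gammaPDF_of_nonneg h.le, Set.indicator_of_mem (by simpa using h)]
    simp [ENNReal.ofReal]

lemma integral_expMeasure_one (f : ℝ → ℝ) :
    ∫ x, f x ∂(expMeasure 1) = ∫ x in Set.Ioi 0, Real.exp (-x) * f x := by
  rw [expMeasure_one_eq, integral_withDensity_eq_integral_smul (by fun_prop)]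
  simp [NNReal.smul_def, Real.exp_nonneg]

lemma integrable_expMeasure_one_iff (f : ℝ → ℝ) :
    Integrable f (expMeasure 1) ↔ IntegrableOn (fun x => Real.exp (-x) * f x) (Set.Ioi 0) := by
  rw [expMeasure_one_eq, integrable_withDensity_iff_integrable_smul (by fun_prop)]
  simp [NNReal.smul_def, Real.exp_nonneg, IntegrableOn]

lemma integral_pow_expMeasure_one (k : ℕ) :
    Integrable (fun x : ℝ => x ^ k) (expMeasure 1) ∧
      ∫ x, x ^ k ∂(expMeasure 1) = Nat.factorial k := by
  have h : ∀ x ∈ Set.Ioi (0 : ℝ), Real.exp (-x) * x ^ k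
      = Real.exp (-x) * x ^ (((k : ℝ) + 1) - 1) := fun x _ => by
    rw [add_sub_cancel_right, Real.rpow_natCast]
  constructor
  · rw [integrable_expMeasure_one_iff]
    refine (integrableOn_congr_fun h measurableSet_Ioi).2 ?_
    exact Real.GammaIntegral_convergent (by positivity)
  · rw [integral_expMeasure_one, setIntegral_congr_fun measurableSet_Ioi h,
      ← Real.Gamma_eq_integral (by positivity), Real.Gamma_nat_eq_factorial]

lemma expMeasure_one_centered :
    MemLp (fun x : ℝ => x - 1) 2 (expMeasure 1) ∧ ∫ x, (x - 1) ∂(expMeasure 1) = 0 ∧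
      ∫ x, (x - 1) ^ 2 ∂(expMeasure 1) = 1 := by
  have h1 := integral_pow_expMeasure_one 1
  have h2 := integral_pow_expMeasure_one 2
  simp only [pow_one] at h1
  have e : (fun x : ℝ => (x - 1) ^ 2) = fun x => x ^ 2 - 2 * x + 1 := by ext x; ring
  have hi : Integrable (fun x : ℝ => x ^ 2 - 2 * x) (expMeasure 1) := h2.1.sub (h1.1.const_mul 2)
  refine ⟨?_, ?_, ?_⟩
  · rw [memLp_two_iff_integrable_sq (by fun_prop), e]
    exact hi.add (integrable_const _)
  · rw [integral_sub h1.1 (integrable_const _), h1.2]; simp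
  · rw [e, integral_add hi (integrable_const _), integral_sub h2.1 (h1.1.const_mul 2),
      integral_const_mul, h1.2, h2.2]
    norm_num [Nat.factorial]

lemma mgf_expMeasure_one {s : ℝ} (hs : s < 1) :
    Integrable (fun x => Real.exp (s * x)) (expMeasure 1) ∧
      ∫ x, Real.exp (s * x) ∂(expMeasure 1) = (1 - s)⁻¹ := by
  have hr : 0 < 1 - s := by linarith
  have h : ∀ x : ℝ, Real.exp (-x) * Real.exp (s * x) = Real.exp ((-(1 - s)) * x) := fun x => by
    rw [← Real.exp_add]; ring_nf
  constructor
  · rw [integrable_expMeasure_one_iff]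
    simp only [h]
    exact exp_neg_integrableOn_Ioi 0 hr
  · rw [integral_expMeasure_one]
    simp only [h]
    rw [integral_exp_mul_Ioi (by linarith)]
    have h1 : s - 1 ≠ 0 := by linarith
    simp
    field_simp
    ring

/-! ### The Bayesian bootstrap -/

/-- The law of `n` independent standard exponential variables. -/
abbrev expLaw (n : ℕ) : Measure (Fin n → ℝ) := Measure.pi fun _ => expMeasure 1

/-- The linear statistic `n^{-1/2} ∑ᵢ (eᵢ - 1) cᵢ` of exponential variables. -/
def expSum {n : ℕ} (c e : Fin n → ℝ) : ℝ := (∑ i, (e i - 1) * c i) / √(n : ℝ)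

/-- The average of a finite sequence. -/
def avg {n : ℕ} (c : Fin n → ℝ) : ℝ := (∑ i, c i) / n

/-- The centred weighted mean `√n (∑ᵢ Mᵢ cᵢ - n⁻¹ ∑ᵢ cᵢ)`. -/
def bootMean {n : ℕ} (c M : Fin n → ℝ) : ℝ := √(n : ℝ) * (∑ i, M i * c i - avg c)

lemma avg_sq_sub_avg {n : ℕ} (hn : 0 < n) (c : Fin n → ℝ) :
    avg (fun i => (c i - avg c) ^ 2) = avg (fun i => c i ^ 2) - avg c ^ 2 := by
  have hn' : (n : ℝ) ≠ 0 := by positivity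
  have h1 : ∑ i, c i = n * avg c := by rw [avg]; field_simp
  have : ∑ i, (c i - avg c) ^ 2 = ∑ i, c i ^ 2 - n * avg c ^ 2 := by
    have : ∀ i, (c i - avg c) ^ 2 = c i ^ 2 - 2 * avg c * c i + avg c ^ 2 := fun i => by ring
    simp only [this, Finset.sum_add_distrib, Finset.sum_sub_distrib, ← Finset.mul_sum, h1]
    simp
    ring
  simp only [avg] at this ⊢
  rw [this]
  field_simp

@[fun_prop]
lemma measurable_expSum {n : ℕ} (c : Fin n → ℝ) : Measurable (expSum c) := by
  unfold expSum; fun_prop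

lemma expSum_moments {n : ℕ} (hn : 0 < n) (c : Fin n → ℝ) :
    MemLp (expSum c) 2 (expLaw n) ∧ ∫ e, expSum c e ^ 2 ∂(expLaw n) = avg fun i => c i ^ 2 := by
  obtain ⟨h1, h2, h3⟩ := expMeasure_one_centered
  have hn' : (0 : ℝ) < n := by positivity
  obtain ⟨m1, m2⟩ := integral_sq_sum_pi (expMeasure 1) (fun (i : Fin n) x => (x - 1) * c i)
    (fun i => h1.mul_const (c i)) (fun i => by rw [integral_mul_const, h2, zero_mul])
  constructor
  · have : expSum c = fun e => (∑ i, (e i - 1) * c i) * (√(n : ℝ))⁻¹ := by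
      ext e; rw [expSum, div_eq_mul_inv]
    rw [this]
    exact m1.mul_const (√(n : ℝ))⁻¹
  · simp only [expSum, div_pow, Real.sq_sqrt hn'.le]
    rw [integral_div, m2, avg]
    simp [mul_pow, integral_mul_const, h3]

/-- With `S = n⁻¹ ∑ eⱼ`, normalizing the exponential variables divides the centred linear statistic
by `S`. -/
lemma bootMean_mul_avg {n : ℕ} (hn : 0 < n) (c e : Fin n → ℝ) (he : avg e ≠ 0) :
    bootMean c (fun i => e i / ∑ j, e j) * avg e = expSum (fun i => c i - avg c) e := by
  have hn' : (0 : ℝ) < n := by positivity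
  have hs : √(n : ℝ) ≠ 0 := (Real.sqrt_pos.2 hn').ne'
  have hS : ∑ j, e j = n * avg e := by rw [avg]; field_simp
  have hc : ∑ j, c j = n * avg c := by rw [avg]; field_simp
  have h1 : ∑ i, e i / (∑ j, e j) * c i = (∑ i, e i * c i) / (∑ j, e j) := by
    rw [Finset.sum_div]; exact Finset.sum_congr rfl fun i _ => by ring
  have h2 : ∑ i, (e i - 1) * (c i - avg c) = ∑ i, e i * c i - avg c * (n * avg e) := by
    have : ∀ i, (e i - 1) * (c i - avg c) = e i * c i - avg c * e i - c i + avg c := fun i => by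
      ring
    simp only [this, Finset.sum_add_distrib, Finset.sum_sub_distrib, ← Finset.mul_sum, hc, hS]
    simp
  rw [bootMean, expSum, h1, h2, hS, eq_div_iff hs]
  have hq : √(n : ℝ) * √(n : ℝ) = n := Real.mul_self_sqrt hn'.le
  field_simp
  rw [show √(n : ℝ) ^ 2 = n by rw [sq, hq]]

lemma avg_sub_one_moments {n : ℕ} (hn : 0 < n) :
    MemLp (fun e : Fin n → ℝ => avg e - 1) 2 (expLaw n) ∧
      ∫ e, (avg e - 1) ^ 2 ∂(expLaw n) = 1 / (n : ℝ) := by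
  have hn' : (0 : ℝ) < n := by positivity
  obtain ⟨h1, h2⟩ := expSum_moments hn (fun _ => (1 : ℝ))
  have hs : √(n : ℝ) ≠ 0 := (Real.sqrt_pos.2 hn').ne'
  have he : ∀ e : Fin n → ℝ, avg e - 1 = expSum (fun _ => (1 : ℝ)) e * (√(n : ℝ))⁻¹ := fun e => by
    have hq : √(n : ℝ) ^ 2 = n := Real.sq_sqrt hn'.le
    simp only [avg, expSum, mul_one, Finset.sum_sub_distrib]
    simp
    field_simp
    rw [hq]
    field_simp
  simp only [he]
  refine ⟨h1.mul_const _, ?_⟩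
  simp only [mul_pow, inv_pow, Real.sq_sqrt hn'.le]
  rw [integral_mul_const, h2]
  simp [avg, hn'.ne']

/-- Chebyshev's inequality for the average of the exponential variables. -/
lemma measureReal_avg_sub_one {n : ℕ} (hn : 0 < n) {κ : ℝ} (hκ : 0 < κ) :
    (expLaw n).real {e | κ < |avg e - 1|} ≤ 1 / (n * κ ^ 2) := by
  obtain ⟨h1, h2⟩ := avg_sub_one_moments hn
  have := mul_meas_ge_le_integral_of_nonneg (μ := expLaw n) (f := fun e => (avg e - 1) ^ 2)
    (ae_of_all _ fun e => sq_nonneg _) h1.integrable_sq (κ ^ 2)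
  rw [h2] at this
  have hsub : {e : Fin n → ℝ | κ < |avg e - 1|} ⊆ {e | κ ^ 2 ≤ (avg e - 1) ^ 2} := fun e he => by
    have he' : κ < |avg e - 1| := he
    have := pow_le_pow_left₀ hκ.le he'.le 2
    rwa [sq_abs] at this
  have h3 := measureReal_mono (μ := expLaw n) hsub
  have h4 : κ ^ 2 * (expLaw n).real {e | κ < |avg e - 1|} ≤ 1 / n :=
    (mul_le_mul_of_nonneg_left h3 (by positivity)).trans this
  have hn' : (0 : ℝ) < n := by positivity
  rw [le_div_iff₀ (by positivity)] at h4 ⊢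
  linarith

/-- An expectation of a truncated variable is bounded through its size on a large event. -/
lemma integral_min_one_le {Θ : Type*} [MeasurableSpace Θ] (P : Measure Θ)
    [IsProbabilityMeasure P] {f g : Θ → ℝ} (hg : Integrable g P) (hg0 : ∀ x, 0 ≤ g x)
    {A : Set Θ} (hA : MeasurableSet A) (h : ∀ x, x ∉ A → |f x| ≤ g x) :
    ∫ x, min 1 |f x| ∂P ≤ P.real A + ∫ x, g x ∂P := by
  have hi : Integrable (fun x => A.indicator (fun _ => (1 : ℝ)) x + g x) P :=
    ((integrable_const _).indicator hA).add hg
  calc ∫ x, min 1 |f x| ∂P ≤ ∫ x, (A.indicator (fun _ => (1 : ℝ)) x + g x) ∂P := by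
        refine integral_mono_of_nonneg
          (ae_of_all _ fun x => le_min zero_le_one (abs_nonneg _)) hi (ae_of_all _ fun x => ?_)
        by_cases hx : x ∈ A
        · simp only [Set.indicator_of_mem hx]
          exact (min_le_left _ _).trans (by linarith [hg0 x])
        · simp only [Set.indicator_of_notMem hx, zero_add]
          exact (min_le_right _ _).trans (h x hx)
    _ = _ := by
        rw [integral_add ((integrable_const _).indicator hA) hg, integral_indicator hA]
        simp

lemma measurable_weights (n : ℕ) : Measurable fun (e : Fin n → ℝ) i => e i / ∑ j, e j := by
  fun_prop

instance (n : ℕ) : IsProbabilityMeasure (bootstrapWeights n) :=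
  Measure.isProbabilityMeasure_map (measurable_weights n).aemeasurable

@[fun_prop]
lemma measurable_bootMean {n : ℕ} (c : Fin n → ℝ) : Measurable (bootMean c) := by
  unfold bootMean; fun_prop

lemma integral_abs_expSum_le {n : ℕ} (hn : 0 < n) (c : Fin n → ℝ) :
    ∫ e, |expSum c e| ∂(expLaw n) ≤ √(avg fun i => c i ^ 2) := by
  obtain ⟨h1, h2⟩ := expSum_moments hn c
  rw [← h2]
  exact integral_abs_le_sqrt _ h1

lemma measurableSet_avg (n : ℕ) (κ : ℝ) :
    MeasurableSet {e : Fin n → ℝ | κ < |avg e - 1|} := by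
  refine measurableSet_lt measurable_const ?_
  unfold avg
  fun_prop

/-- Size of the bootstrap fluctuation of a weighted mean. -/
lemma integral_min_one_bootMean_le {n : ℕ} (hn : 0 < n) (c : Fin n → ℝ) :
    ∫ M, min 1 |bootMean c M| ∂(bootstrapWeights n) ≤ 4 / n + 2 * √(avg fun i => c i ^ 2) := by
  rw [bootstrapWeights, integral_map (measurable_weights n).aemeasurable
    (by fun_prop : Measurable fun M => min 1 |bootMean c M|).aestronglyMeasurable]
  obtain ⟨h1, -⟩ := expSum_moments hn (fun i => c i - avg c)
  refine (integral_min_one_le (expLaw n)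
    (g := fun e => 2 * |expSum (fun i => c i - avg c) e|)
    ((h1.integrable (by norm_num)).abs.const_mul 2) (fun e => by positivity)
    (measurableSet_avg n (1 / 2)) fun e he => ?_).trans ?_
  · have he' : |avg e - 1| ≤ 1 / 2 := not_lt.1 he
    have ha : 1 / 2 ≤ avg e := by linarith [(abs_le.1 he').1]
    rw [← bootMean_mul_avg hn c e (by linarith), abs_mul, abs_of_pos (by linarith : 0 < avg e)]
    nlinarith [abs_nonneg (bootMean c fun i => e i / ∑ j, e j)]
  · have h2 := measureReal_avg_sub_one hn (κ := 1 / 2) (by norm_num)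
    have h3 := integral_abs_expSum_le hn (fun i => c i - avg c)
    rw [integral_const_mul]
    have h4 : √(avg fun i => (c i - avg c) ^ 2) ≤ √(avg fun i => c i ^ 2) := by
      refine Real.sqrt_le_sqrt ?_
      rw [avg_sq_sub_avg hn]
      linarith [sq_nonneg (avg c)]
    have hn' : (0 : ℝ) < n := by positivity
    have h5 : 1 / ((n : ℝ) * (1 / 2) ^ 2) = 4 / n := by field_simp; norm_num
    rw [h5] at h2
    linarith

/-- The normalized bootstrap mean is close to the linear statistic in the exponential variables. -/
lemma integral_min_one_bootMean_sub_le {n : ℕ} (hn : 0 < n) (c : Fin n → ℝ) {κ : ℝ} (hκ : 0 < κ)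
    (hκ' : κ ≤ 1 / 2) :
    ∫ e, min 1 |bootMean c (fun i => e i / ∑ j, e j) - expSum (fun i => c i - avg c) e| ∂(expLaw n)
      ≤ 1 / (n * κ ^ 2) + 2 * κ * √(avg fun i => c i ^ 2) := by
  obtain ⟨h1, -⟩ := expSum_moments hn (fun i => c i - avg c)
  refine (integral_min_one_le (expLaw n)
    (g := fun e => 2 * κ * |expSum (fun i => c i - avg c) e|)
    ((h1.integrable (by norm_num)).abs.const_mul _) (fun e => by positivity)
    (measurableSet_avg n κ) fun e he => ?_).trans ?_
  · have he' : |avg e - 1| ≤ κ := not_lt.1 he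
    have ha : 1 / 2 ≤ avg e := by linarith [(abs_le.1 he').1]
    rw [← bootMean_mul_avg hn c e (by linarith)]
    set B := bootMean c fun i => e i / ∑ j, e j
    rw [show B - B * avg e = -(B * (avg e - 1)) by ring, abs_neg, abs_mul, abs_mul,
      abs_of_pos (by linarith : 0 < avg e)]
    have h1 : |B| * |avg e - 1| ≤ |B| * κ := mul_le_mul_of_nonneg_left he' (abs_nonneg _)
    have h2 : 0 ≤ |B| * κ * (2 * avg e - 1) :=
      mul_nonneg (mul_nonneg (abs_nonneg _) hκ.le) (by linarith)
    linarith
  · have h2 := measureReal_avg_sub_one hn hκ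
    have h3 := integral_abs_expSum_le hn (fun i => c i - avg c)
    rw [integral_const_mul]
    have h4 : √(avg fun i => (c i - avg c) ^ 2) ≤ √(avg fun i => c i ^ 2) := by
      refine Real.sqrt_le_sqrt ?_
      rw [avg_sq_sub_avg hn]
      linarith [sq_nonneg (avg c)]
    have h5 := mul_le_mul_of_nonneg_left (h3.trans h4) (by positivity : 0 ≤ 2 * κ)
    linarith

/-- Moment generating function of the linear statistic, to third order. -/
lemma mgf_expSum {n : ℕ} (hn : 0 < n) (c : Fin n → ℝ) {C t : ℝ} (hc : ∀ i, |c i| ≤ C)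
    (ht : |t| * C / √(n : ℝ) ≤ 1 / 2) :
    Integrable (fun e => Real.exp (t * expSum c e)) (expLaw n) ∧
      ∃ ρ : ℝ, |ρ| ≤ 2 * (|t| * C) ^ 3 / √(n : ℝ) ∧
        ∫ e, Real.exp (t * expSum c e) ∂(expLaw n)
          = Real.exp (t ^ 2 * (avg fun i => c i ^ 2) / 2 + ρ) := by
  have hn' : (0 : ℝ) < n := by positivity
  have hs : 0 < √(n : ℝ) := Real.sqrt_pos.2 hn'
  set τ : Fin n → ℝ := fun i => t * c i / √(n : ℝ) with hτ
  have hτb : ∀ i, |τ i| ≤ |t| * C / √(n : ℝ) := fun i => by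
    rw [hτ]
    simp only [abs_div, abs_mul, abs_of_pos hs]
    gcongr
    exact hc i
  have hτ2 : ∀ i, |τ i| ≤ 1 / 2 := fun i => (hτb i).trans ht
  have hτ1 : ∀ i, τ i < 1 := fun i => by linarith [(abs_le.1 (hτ2 i)).2]
  have hexp : ∀ e : Fin n → ℝ, Real.exp (t * expSum c e)
      = ∏ i, (Real.exp (-τ i) * Real.exp (τ i * e i)) := fun e => by
    simp only [← Real.exp_add, ← Real.exp_sum]
    congr 1
    rw [expSum, Finset.sum_div, Finset.mul_sum]
    exact Finset.sum_congr rfl fun i _ => by rw [hτ]; ring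
  have hi : ∀ i : Fin n, Integrable (fun x => Real.exp (-τ i) * Real.exp (τ i * x))
      (expMeasure 1) := fun i => (mgf_expMeasure_one (hτ1 i)).1.const_mul _
  simp only [hexp]
  refine ⟨Integrable.fintype_prod (μ := fun _ : Fin n => expMeasure 1) hi,
    ∑ i, (-τ i - Real.log (1 - τ i) - τ i ^ 2 / 2), ?_, ?_⟩
  · have hb : ∀ i ∈ Finset.univ, |-τ i - Real.log (1 - τ i) - τ i ^ 2 / 2|
        ≤ 2 * (|t| * C / √(n : ℝ)) ^ 3 := fun i _ => by
      have h := Real.abs_log_sub_add_sum_range_le (x := τ i)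
        (by linarith [hτ2 i]) 2
      have e1 : (∑ k ∈ Finset.range 2, τ i ^ (k + 1) / ((k : ℝ) + 1)) + Real.log (1 - τ i)
          = -(-τ i - Real.log (1 - τ i) - τ i ^ 2 / 2) := by
        simp [Finset.sum_range_succ]; ring
      rw [e1, abs_neg] at h
      refine h.trans ?_
      have h3 : |τ i| ^ (2 + 1) ≤ (|t| * C / √(n : ℝ)) ^ 3 :=
        pow_le_pow_left₀ (abs_nonneg _) (hτb i) 3
      have h5 : 0 ≤ |τ i| ^ (2 + 1) := by positivity
      rw [div_le_iff₀ (by linarith [hτ2 i])]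
      have h4 : (1 : ℝ) / 2 ≤ 1 - |τ i| := by linarith [hτ2 i]
      have h6 := mul_le_mul_of_nonneg_left h4 (h5.trans h3)
      linarith
    refine (Finset.abs_sum_le_sum_abs _ _).trans ((Finset.sum_le_sum hb).trans_eq ?_)
    rw [Finset.sum_const, Finset.card_univ, Fintype.card_fin, nsmul_eq_mul]
    have hq : √(n : ℝ) ^ 2 = n := Real.sq_sqrt hn'.le
    rw [div_pow]
    nth_rw 1 [← hq]
    field_simp
  · rw [integral_fintype_prod_eq_prod (μ := fun _ : Fin n => expMeasure 1)
      fun i x => Real.exp (-τ i) * Real.exp (τ i * x)]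
    have h1 : ∀ i, ∫ x, Real.exp (-τ i) * Real.exp (τ i * x) ∂(expMeasure 1)
        = Real.exp (-τ i - Real.log (1 - τ i)) := fun i => by
      rw [integral_const_mul, (mgf_expMeasure_one (hτ1 i)).2, Real.exp_sub,
        Real.exp_log (by linarith [hτ1 i]), div_eq_mul_inv]
    simp only [h1, ← Real.exp_sum]
    congr 1
    have h2 : t ^ 2 * (avg fun i => c i ^ 2) / 2 = ∑ i, τ i ^ 2 / 2 := by
      simp only [hτ, div_pow, mul_pow, Real.sq_sqrt hn'.le, avg]
      rw [← Finset.sum_div, ← Finset.sum_div, ← Finset.mul_sum]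
      ring
    rw [h2, ← Finset.sum_add_distrib]
    exact Finset.sum_congr rfl fun i _ => by ring

/-- Uniform continuity of the exponential function on half-lines bounded above. -/
lemma exists_abs_exp_sub_le (B : ℝ) {τ : ℝ} (hτ : 0 < τ) :
    ∃ η : ℝ, 0 < η ∧ ∀ x y : ℝ, y ≤ B → |x - y| ≤ η → |Real.exp x - Real.exp y| ≤ τ := by
  have hc : ContinuousAt Real.exp 0 := Real.continuous_exp.continuousAt
  obtain ⟨η, hη, h⟩ := Metric.continuousAt_iff.1 hc (τ * Real.exp (-B)) (by positivity)
  refine ⟨η / 2, by positivity, fun x y hy hxy => ?_⟩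
  have h1 := h (x := x - y) (by rw [Real.dist_eq, sub_zero]; linarith)
  rw [Real.dist_eq, Real.exp_zero] at h1
  have h2 : Real.exp x - Real.exp y = Real.exp y * (Real.exp (x - y) - 1) := by
    rw [mul_sub, ← Real.exp_add]; ring_nf
  rw [h2, abs_mul, abs_of_pos (Real.exp_pos y)]
  calc Real.exp y * |Real.exp (x - y) - 1| ≤ Real.exp B * (τ * Real.exp (-B)) := by gcongr
    _ = τ := by rw [mul_left_comm, ← Real.exp_add]; simp

/-- The Bayesian bootstrap central limit theorem, for fixed data `a` with values in `[-1, 1]`. -/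
lemma exists_dBL_bootMean_le (v : ℝ≥0) {δ : ℝ} (hδ : 0 < δ) :
    ∃ τ : ℝ, 0 < τ ∧ ∀ᶠ n : ℕ in atTop, ∀ a : Fin n → ℝ, (∀ i, |a i| ≤ 1) →
      |avg (fun i => a i ^ 2) - avg a ^ 2 - v| ≤ τ →
      dBL ((bootstrapWeights n).map (bootMean a)) (gaussianReal 0 v) ≤ δ := by
  obtain ⟨τ₀, hτ₀, T₀, hmgf⟩ := exists_dBL_le_of_mgf v (δ := δ / 2) (by positivity)
  set T := max T₀ 1
  have hT : 1 ≤ T := le_max_right _ _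
  obtain ⟨η, hη, hexp⟩ := exists_abs_exp_sub_le (v * T ^ 2 / 2) hτ₀
  refine ⟨η / T ^ 2, by positivity, ?_⟩
  have hsq : Tendsto (fun n : ℕ => √(n : ℝ)) atTop atTop :=
    Real.tendsto_sqrt_atTop.comp tendsto_natCast_atTop_atTop
  have hκ : ∃ κ : ℝ, 0 < κ ∧ κ ≤ 1 / 2 ∧ 2 * κ ≤ δ / 8 :=
    ⟨min (1 / 2) (δ / 16), lt_min (by norm_num) (by positivity), min_le_left _ _, by
      linarith [min_le_right (1 / 2 : ℝ) (δ / 16)]⟩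
  obtain ⟨κ, hκ0, hκ1, hκ2⟩ := hκ
  have l1 : Tendsto (fun n : ℕ => T * 2 / √(n : ℝ)) atTop (𝓝 0) := tendsto_const_nhds.div_atTop hsq
  have l2 : Tendsto (fun n : ℕ => 2 * (T * 2) ^ 3 / √(n : ℝ)) atTop (𝓝 0) :=
    tendsto_const_nhds.div_atTop hsq
  have l3 : Tendsto (fun n : ℕ => 1 / ((n : ℝ) * κ ^ 2)) atTop (𝓝 0) :=
    tendsto_const_nhds.div_atTop
      (tendsto_natCast_atTop_atTop.atTop_mul_const (by positivity))
  filter_upwards [eventually_gt_atTop 0, l1.eventually_le_const (by norm_num : (0 : ℝ) < 1 / 2),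
    l2.eventually_le_const (by positivity : (0 : ℝ) < η / 2),
    l3.eventually_le_const (by positivity : (0 : ℝ) < δ / 8)] with n hn b1 b2 b3 a ha hav
  have hn' : (0 : ℝ) < n := by positivity
  have hs : 0 < √(n : ℝ) := Real.sqrt_pos.2 hn'
  have havg : |avg a| ≤ 1 := by
    rw [avg, abs_div, abs_of_pos hn', div_le_one hn']
    exact (Finset.abs_sum_le_sum_abs _ _).trans
      ((Finset.sum_le_sum fun i _ => ha i).trans_eq (by simp))
  have havg2 : avg (fun i => a i ^ 2) ≤ 1 := by
    rw [avg, div_le_one hn']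
    exact (Finset.sum_le_sum fun i _ => by rw [sq_le_one_iff_abs_le_one]; exact ha i).trans_eq
      (by simp)
  set c : Fin n → ℝ := fun i => a i - avg a with hcdef
  have hc : ∀ i, |c i| ≤ 2 := fun i => (abs_sub _ _).trans (by linarith [ha i])
  -- the linear statistic has almost Gaussian moment generating function
  have hlin : dBL ((expLaw n).map (expSum c)) (gaussianReal 0 v) ≤ δ / 2 := by
    refine hmgf _ (Measure.isProbabilityMeasure_map (measurable_expSum c).aemeasurable)
      fun t ht => ?_
    have htT : |t| ≤ T := ht.trans (le_max_left _ _)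
    obtain ⟨h1, ρ, h2, h3⟩ := mgf_expSum hn c (C := 2) (t := t) hc
      (le_trans (by gcongr) b1)
    rw [integrable_map_measure (by fun_prop) (measurable_expSum c).aemeasurable,
      integral_map (measurable_expSum c).aemeasurable (by fun_prop)]
    refine ⟨h1, ?_⟩
    rw [h3]
    have ht2 : t ^ 2 ≤ T ^ 2 := by rw [← sq_abs]; gcongr
    refine hexp _ _ (by gcongr) ?_
    have e1 : avg (fun i => c i ^ 2) = avg (fun i => a i ^ 2) - avg a ^ 2 := avg_sq_sub_avg hn a
    rw [show t ^ 2 * avg (fun i => c i ^ 2) / 2 + ρ - v * t ^ 2 / 2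
      = t ^ 2 / 2 * (avg (fun i => c i ^ 2) - v) + ρ by ring, e1]
    have h4 : |ρ| ≤ η / 2 := h2.trans (le_trans (by gcongr) b2)
    have h5 : |t ^ 2 / 2 * (avg (fun i => a i ^ 2) - avg a ^ 2 - v)| ≤ η / 2 := by
      rw [abs_mul, abs_of_nonneg (by positivity : (0 : ℝ) ≤ t ^ 2 / 2)]
      calc _ ≤ T ^ 2 / 2 * (η / T ^ 2) := by gcongr
        _ = η / 2 := by field_simp
    exact (abs_add_le _ _).trans (by linarith)
  rw [bootstrapWeights, Measure.map_map (measurable_bootMean a) (measurable_weights n)]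
  refine (dBL_map_le (expLaw n) ((measurable_bootMean a).comp (measurable_weights n))
    (measurable_expSum c) _).trans ?_
  have h6 := integral_min_one_bootMean_sub_le hn a hκ0 hκ1
  have h7 : 2 * κ * √(avg fun i => a i ^ 2) ≤ δ / 8 := by
    have : √(avg fun i => a i ^ 2) ≤ 1 := Real.sqrt_le_one.2 havg2
    nlinarith
  simp only [Function.comp_apply]
  linarith

/-! ### Asymptotic normality from exponential tilts -/

lemma abs_one_sub_exp_le {b x : ℝ} (hx : |x| ≤ b) : |1 - Real.exp x| ≤ Real.exp b * |x| := by
  have hb : 0 ≤ b := (abs_nonneg x).trans hx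
  have h1 := Real.add_one_le_exp x
  have h2 := Real.add_one_le_exp (-x)
  have h3 : Real.exp x ≤ Real.exp b := Real.exp_le_exp.2 ((le_abs_self x).trans hx)
  have h4 : (1 : ℝ) ≤ Real.exp b := Real.one_le_exp hb
  have h5 : Real.exp x * Real.exp (-x) = 1 := by rw [← Real.exp_add]; simp
  have h6 := Real.exp_pos x
  rcases le_total 0 x with h | h
  · rw [abs_of_nonneg h, abs_sub_comm, abs_of_nonneg (by linarith)]
    nlinarith
  · rw [abs_of_nonpos h, abs_of_nonneg (by linarith [Real.exp_le_one_iff.2 h])]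
    nlinarith

/-- If the exponential tilts `exp (t Z - t² V / 2 + ρ)` have mean one for all `t` in a large
interval, with `ρ` uniformly small, `V` bounded and `V` close to a constant `v` in mean, then `Z` is
approximately `N(0, v)` distributed.  Boundedness of `V` makes the tilts uniformly integrable:
the square of one tilt is comparable to the tilt with parameter `2 t`. -/
lemma exists_dBL_map_le_of_tilt (v : ℝ≥0) (C : ℝ) {δ : ℝ} (hδ : 0 < δ) :
    ∃ ε : ℝ, 0 < ε ∧ ∃ T : ℝ, ∀ {Θ : Type u} [MeasurableSpace Θ] (P : Measure Θ)
      [IsProbabilityMeasure P] (Z V : Θ → ℝ), Measurable Z → Measurable V →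
      (∀ θ, 0 ≤ V θ ∧ V θ ≤ C) → ∫ θ, |V θ - v| ∂P ≤ ε →
      (∀ t : ℝ, |t| ≤ T → ∃ ρ : Θ → ℝ, Measurable ρ ∧ (∀ θ, |ρ θ| ≤ ε) ∧
        ∫⁻ θ, ENNReal.ofReal (Real.exp (t * Z θ - t ^ 2 * V θ / 2 + ρ θ)) ∂P = 1) →
      dBL (P.map Z) (gaussianReal 0 v) ≤ δ := by
  obtain ⟨τ, hτ, T₀, hmgf⟩ := exists_dBL_le_of_mgf v hδ
  set T := max T₀ 1
  have hT : 1 ≤ T := le_max_right _ _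
  set C' := max C v with hC'
  have hvC : (v : ℝ) ≤ C' := le_max_right _ _
  have hC0 : 0 ≤ C' := v.2.trans hvC
  set B := Real.exp (2 * T ^ 2 * C' + 1) with hB
  set b := T ^ 2 * C' / 2 + 1 with hb
  have hb0 : 0 < b := by positivity
  obtain ⟨κ, hκ0, hκ⟩ : ∃ κ : ℝ, 0 < κ ∧ Real.exp b * (κ / 2 * B) ≤ τ / 2 :=
    ⟨τ / (Real.exp b * B), by positivity, by
      field_simp; exact div_self_le_one B⟩
  obtain ⟨ε, hε0, hε1, hε⟩ : ∃ ε : ℝ, 0 < ε ∧ ε ≤ 1 ∧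
      Real.exp b * (b * (T ^ 2 / 2 * ε + ε) / (2 * κ)) ≤ τ / 2 := by
    refine ⟨min 1 (τ * κ / (Real.exp b * (b * (T ^ 2 / 2 + 1)))), by positivity,
      min_le_left _ _, ?_⟩
    set ε := min 1 (τ * κ / (Real.exp b * (b * (T ^ 2 / 2 + 1)))) with hεdef
    have h1 : ε ≤ τ * κ / (Real.exp b * (b * (T ^ 2 / 2 + 1))) := min_le_right _ _
    rw [le_div_iff₀ (by positivity)] at h1
    rw [← mul_div_assoc, div_le_iff₀ (by positivity)]
    linarith
  refine ⟨ε, hε0, 2 * T, fun {Θ} _ P _ Z V hZ hV hVb hVv htilt => ?_⟩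
  refine hmgf _ (Measure.isProbabilityMeasure_map hZ.aemeasurable) fun t ht => ?_
  rw [integrable_map_measure (by fun_prop) hZ.aemeasurable,
    integral_map hZ.aemeasurable (by fun_prop)]
  have hVC : ∀ θ, V θ ≤ C' := fun θ => (hVb θ).2.trans (le_max_left _ _)
  -- exponential moments of `Z` are bounded
  have hmom : ∀ s : ℝ, |s| ≤ 2 * T → Integrable (fun θ => Real.exp (s * Z θ)) P ∧
      ∫ θ, Real.exp (s * Z θ) ∂P ≤ B := fun s hs => by
    obtain ⟨ρ, hρm, hρ, h1⟩ := htilt s hs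
    have hle : ∀ θ, Real.exp (s * Z θ) ≤
        B * Real.exp (s * Z θ - s ^ 2 * V θ / 2 + ρ θ) := fun θ => by
      rw [hB, ← Real.exp_add]
      refine Real.exp_le_exp.2 ?_
      have h2 : s ^ 2 ≤ 4 * T ^ 2 := by
        rw [← sq_abs, show 4 * T ^ 2 = (2 * T) ^ 2 by ring]; gcongr
      have h3 : s ^ 2 * V θ ≤ 4 * T ^ 2 * C' :=
        mul_le_mul h2 (hVC θ) (hVb θ).1 (by positivity)
      linarith [(abs_le.1 (hρ θ)).1]
    have hI : Integrable (fun θ => Real.exp (s * Z θ - s ^ 2 * V θ / 2 + ρ θ)) P := by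
      refine ⟨by fun_prop, ?_⟩
      rw [hasFiniteIntegral_iff_ofReal (ae_of_all _ fun θ => (Real.exp_pos _).le), h1]
      exact ENNReal.one_lt_top
    have hI1 : ∫ θ, Real.exp (s * Z θ - s ^ 2 * V θ / 2 + ρ θ) ∂P = 1 := by
      rw [integral_eq_lintegral_of_nonneg_ae (ae_of_all _ fun θ => (Real.exp_pos _).le)
        (by fun_prop), h1, ENNReal.toReal_one]
    have hI2 : Integrable (fun θ => Real.exp (s * Z θ)) P :=
      (hI.const_mul B).mono' (by fun_prop) (ae_of_all _ fun θ => by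
        rw [Real.norm_of_nonneg (Real.exp_pos _).le]; exact hle θ)
    refine ⟨hI2, (integral_mono hI2 (hI.const_mul B) hle).trans_eq ?_⟩
    rw [integral_const_mul, hI1, mul_one]
  have htT : |t| ≤ T := ht.trans (le_max_left _ _)
  have ht2 : t ^ 2 ≤ T ^ 2 := by rw [← sq_abs]; gcongr
  obtain ⟨m1, -⟩ := hmom t (by linarith)
  obtain ⟨m2, m3⟩ := hmom (2 * t) (by rw [abs_mul]; norm_num; exact htT)
  refine ⟨m1, ?_⟩
  obtain ⟨ρ, hρm, hρ, h1⟩ := htilt t (by linarith)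
  have hI : Integrable (fun θ => Real.exp (t * Z θ - t ^ 2 * V θ / 2 + ρ θ)) P := by
    refine ⟨by fun_prop, ?_⟩
    rw [hasFiniteIntegral_iff_ofReal (ae_of_all _ fun θ => (Real.exp_pos _).le), h1]
    exact ENNReal.one_lt_top
  have hI1 : ∫ θ, Real.exp (t * Z θ - t ^ 2 * V θ / 2 + ρ θ) ∂P = 1 := by
    rw [integral_eq_lintegral_of_nonneg_ae (ae_of_all _ fun θ => (Real.exp_pos _).le)
      (by fun_prop), h1, ENNReal.toReal_one]
  set x : Θ → ℝ := fun θ => -(t ^ 2 / 2 * (V θ - v)) + ρ θ with hx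
  have hxm : Measurable x := by fun_prop
  have hVv' : ∀ θ, |V θ - v| ≤ C' := fun θ =>
    abs_le.2 ⟨by linarith [(hVb θ).1], by linarith [hVC θ, v.2]⟩
  have hx1 : ∀ θ, |x θ| ≤ T ^ 2 / 2 * |V θ - v| + ε := fun θ => by
    refine (abs_add_le _ _).trans ?_
    rw [abs_neg, abs_mul, abs_of_nonneg (by positivity : 0 ≤ t ^ 2 / 2)]
    have := hρ θ
    gcongr
  have hx2 : ∀ θ, |x θ| ≤ b := fun θ => by
    refine (hx1 θ).trans ?_
    have := mul_le_mul_of_nonneg_left (hVv' θ) (by positivity : 0 ≤ T ^ 2 / 2)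
    linarith
  have hVi : Integrable (fun θ => |V θ - v|) P :=
    Integrable.of_bound (by fun_prop) C' (ae_of_all _ fun θ => by
      rw [Real.norm_of_nonneg (abs_nonneg _)]; exact hVv' θ)
  have hpt : ∀ θ, |Real.exp (t * Z θ)
        - Real.exp (v * t ^ 2 / 2) * Real.exp (t * Z θ - t ^ 2 * V θ / 2 + ρ θ)|
      ≤ Real.exp b * (κ / 2) * Real.exp (2 * t * Z θ)
        + Real.exp b * b / (2 * κ) * (T ^ 2 / 2 * |V θ - v| + ε) := fun θ => by
    have e1 : Real.exp (v * t ^ 2 / 2) * Real.exp (t * Z θ - t ^ 2 * V θ / 2 + ρ θ)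
        = Real.exp (t * Z θ) * Real.exp (x θ) := by
      rw [← Real.exp_add, ← Real.exp_add]; congr 1; rw [hx]; ring
    have e2 : Real.exp (2 * t * Z θ) = Real.exp (t * Z θ) ^ 2 := by
      rw [sq, ← Real.exp_add]; ring_nf
    rw [e1, e2, show Real.exp (t * Z θ) - Real.exp (t * Z θ) * Real.exp (x θ)
      = Real.exp (t * Z θ) * (1 - Real.exp (x θ)) by ring, abs_mul, abs_of_pos (Real.exp_pos _)]
    have h2 := abs_one_sub_exp_le (hx2 θ)
    set E := Real.exp (t * Z θ) with hE
    have hE0 : 0 < E := Real.exp_pos _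
    have h3 : E * |x θ| ≤ κ / 2 * E ^ 2 + |x θ| ^ 2 / (2 * κ) := by
      have : κ / 2 * E ^ 2 + |x θ| ^ 2 / (2 * κ) - E * |x θ| = (κ * E - |x θ|) ^ 2 / (2 * κ) := by
        field_simp; ring
      have h4 : 0 ≤ (κ * E - |x θ|) ^ 2 / (2 * κ) := by positivity
      linarith
    have h5 : |x θ| ^ 2 ≤ b * (T ^ 2 / 2 * |V θ - v| + ε) := by
      rw [sq]; exact mul_le_mul (hx2 θ) (hx1 θ) (abs_nonneg _) hb0.le
    calc E * |1 - Real.exp (x θ)| ≤ E * (Real.exp b * |x θ|) := by gcongr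
      _ = Real.exp b * (E * |x θ|) := by ring
      _ ≤ Real.exp b * (κ / 2 * E ^ 2 + (b * (T ^ 2 / 2 * |V θ - v| + ε)) / (2 * κ)) := by
          gcongr
          refine h3.trans ?_
          gcongr
      _ = _ := by ring
  have hWi : Integrable (fun θ => T ^ 2 / 2 * |V θ - v| + ε) P :=
    (hVi.const_mul _).add (integrable_const _)
  have hR : Integrable (fun θ => Real.exp b * (κ / 2) * Real.exp (2 * t * Z θ)
      + Real.exp b * b / (2 * κ) * (T ^ 2 / 2 * |V θ - v| + ε)) P :=
    (m2.const_mul _).add (hWi.const_mul _)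
  have e3 : ∫ θ, Real.exp (t * Z θ) ∂P - Real.exp (v * t ^ 2 / 2)
      = ∫ θ, (Real.exp (t * Z θ)
        - Real.exp (v * t ^ 2 / 2) * Real.exp (t * Z θ - t ^ 2 * V θ / 2 + ρ θ)) ∂P := by
    rw [integral_sub m1 (hI.const_mul _), integral_const_mul, hI1, mul_one]
  rw [e3]
  refine (norm_integral_le_of_norm_le (f := fun θ => Real.exp (t * Z θ)
    - Real.exp (v * t ^ 2 / 2) * Real.exp (t * Z θ - t ^ 2 * V θ / 2 + ρ θ)) hR
    (ae_of_all _ hpt)).trans ?_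
  rw [integral_add (m2.const_mul _) (hWi.const_mul _),
    integral_const_mul, integral_const_mul, integral_add (hVi.const_mul _) (integrable_const _),
    integral_const_mul, integral_const]
  simp only [probReal_univ, one_smul]
  calc _ ≤ Real.exp b * (κ / 2) * B + Real.exp b * b / (2 * κ) * (T ^ 2 / 2 * ε + ε) := by
        gcongr
    _ = Real.exp b * (κ / 2 * B) + Real.exp b * (b * (T ^ 2 / 2 * ε + ε) / (2 * κ)) := by ring
    _ ≤ τ := by linarith

/-! ### The logistic likelihood along the perturbed direction -/

section

/-- The logarithm of the probability of the outcome `y` when the log-odds equal `η`. -/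
def logLik (y : Bool) (η : ℝ) : ℝ := num y * η - Real.log (1 + Real.exp η)

lemma one_sub_sigmoid (η : ℝ) : 1 - Real.sigmoid η = (1 + Real.exp η)⁻¹ := by
  rw [← Real.sigmoid_neg, Real.sigmoid_def, neg_neg]

lemma exp_logLik (y : Bool) (η : ℝ) :
    Real.exp (logLik y η) = if y then Real.sigmoid η else 1 - Real.sigmoid η := by
  have h : 0 < 1 + Real.exp η := by positivity
  rw [logLik, Real.exp_sub, Real.exp_log h]
  cases y
  · simp [num, one_sub_sigmoid]
  · simp only [num, if_true, one_mul, Real.sigmoid_def]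
    rw [Real.exp_neg]
    field_simp
    ring

lemma hasDerivAt_logLik (y : Bool) (η : ℝ) :
    HasDerivAt (logLik y) (num y - Real.sigmoid η) η := by
  have h : 0 < 1 + Real.exp η := by positivity
  have h1 : HasDerivAt (fun x => Real.log (1 + Real.exp x)) (Real.exp η / (1 + Real.exp η)) η :=
    ((Real.hasDerivAt_exp η).const_add 1).log h.ne'
  have h2 : Real.exp η / (1 + Real.exp η) = Real.sigmoid η := by
    rw [Real.sigmoid_def, Real.exp_neg]; field_simp; ring
  exact (((hasDerivAt_id η).const_mul (num y)).sub h1).congr_deriv (by rw [h2, mul_one])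

/-- A function that vanishes at `0` and has derivative at most `c` on `[-r, r]` is at most `c r`
there. -/
lemma abs_le_of_hasDerivAt {f f' : ℝ → ℝ} {r c : ℝ} (h0 : f 0 = 0)
    (hf : ∀ x, |x| ≤ r → HasDerivAt f (f' x) x) (hc : ∀ x, |x| ≤ r → |f' x| ≤ c) {x : ℝ}
    (hx : |x| ≤ r) : |f x| ≤ c * |x| := by
  have hr : 0 ≤ r := (abs_nonneg x).trans hx
  have hs : ∀ y, y ∈ Set.Icc (-r) r ↔ |y| ≤ r := fun y => abs_le.symm
  have := (convex_Icc (-r) r).norm_image_sub_le_of_norm_hasDerivWithin_le (f := f) (f' := f')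
    (C := c) (fun y hy => (hf y ((hs y).1 hy)).hasDerivWithinAt) (fun y hy => hc y ((hs y).1 hy))
    ((hs 0).2 (by simpa using hr)) ((hs x).2 hx)
  simpa [h0] using this

lemma abs_sigmoid_variance_sub_le (x y : ℝ) :
    |Real.sigmoid x * (1 - Real.sigmoid x) - Real.sigmoid y * (1 - Real.sigmoid y)| ≤ |x - y| := by
  have hd : ∀ z, HasDerivAt (fun z => Real.sigmoid z * (1 - Real.sigmoid z))
      (Real.sigmoid z * (1 - Real.sigmoid z) * (1 - 2 * Real.sigmoid z)) z := fun z => by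
    have h := Real.hasDerivAt_sigmoid z
    exact (h.mul (h.const_sub 1)).congr_deriv (by ring)
  have := convex_univ.norm_image_sub_le_of_norm_hasDerivWithin_le (C := 1)
    (fun z _ => (hd z).hasDerivWithinAt) (fun z _ => ?_) (Set.mem_univ y) (Set.mem_univ x)
  · simpa using this
  · have h1 := Real.sigmoid_pos z
    have h2 := Real.sigmoid_lt_one z
    rw [Real.norm_eq_abs, abs_mul, abs_of_nonneg (by nlinarith)]
    have h3 : |1 - 2 * Real.sigmoid z| ≤ 1 := abs_le.2 ⟨by linarith, by linarith⟩
    have h4 : Real.sigmoid z * (1 - Real.sigmoid z) ≤ 1 := by nlinarith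
    calc _ ≤ 1 * 1 := mul_le_mul h4 h3 (abs_nonneg _) (by norm_num)
      _ = 1 := one_mul 1

/-- Second order expansion of the logistic log-likelihood. -/
lemma abs_logLik_sub_le (y : Bool) (η h : ℝ) :
    |logLik y (η - h) - logLik y η
      - (h * (Real.sigmoid η - num y) - h ^ 2 * (Real.sigmoid η * (1 - Real.sigmoid η)) / 2)|
      ≤ |h| ^ 3 := by
  set S := Real.sigmoid η with hS
  set D := S * (1 - S) with hD
  have hsub : ∀ x : ℝ, HasDerivAt (fun x => η - x) (-1) x := fun x => by
    simpa using (hasDerivAt_id x).const_sub η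
  have h1 : ∀ x, HasDerivAt (fun x => S - Real.sigmoid (η - x) - x * D)
      (Real.sigmoid (η - x) * (1 - Real.sigmoid (η - x)) - D) x := fun x => by
    have := (((Real.hasDerivAt_sigmoid (η - x)).comp x (hsub x)).const_sub S).sub
      ((hasDerivAt_id x).mul_const D)
    exact this.congr_deriv (by ring)
  have b1 : ∀ x, |x| ≤ |h| → |S - Real.sigmoid (η - x) - x * D| ≤ |h| * |h| := fun x hx => by
    refine (abs_le_of_hasDerivAt (r := |h|) (c := |h|) (by simp [hS]) (fun z _ => h1 z)
      (fun z hz => (abs_sigmoid_variance_sub_le _ _).trans (by simpa using hz)) hx).trans ?_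
    gcongr
  have h2 : ∀ x, HasDerivAt (fun x => logLik y (η - x) - logLik y η
      - (x * (S - num y) - x ^ 2 * D / 2)) (-(S - Real.sigmoid (η - x) - x * D)) x := fun x => by
    have a1 := ((hasDerivAt_logLik y (η - x)).comp x (hsub x)).sub_const (logLik y η)
    have a2 := ((hasDerivAt_id x).mul_const (S - num y)).sub
      ((((hasDerivAt_id x).pow 2).mul_const D).div_const 2)
    have a3 := a1.sub a2
    refine a3.congr_deriv ?_
    simp only [id_eq, Nat.cast_ofNat, Nat.add_one_sub_one, pow_one]
    ring
  have := abs_le_of_hasDerivAt (r := |h|) (c := |h| * |h|) (by simp) (fun z _ => h2 z)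
    (fun z hz => by rw [abs_neg]; exact b1 z hz) le_rfl
  calc _ ≤ |h| * |h| * |h| := this
    _ = _ := by ring

variable {p n : ℕ}

lemma likelihood_eq_exp (η : Bool → Cov p → ℝ) (o : Fin n → Obs p) :
    likelihood η o = Real.exp (∑ i, logLik (o i).1 (η (o i).2.1 (o i).2.2)) := by
  rw [Real.exp_sum]
  simp only [exp_logLik]
  rfl

lemma likelihood_pos (η : Bool → Cov p → ℝ) (o : Fin n → Obs p) : 0 < likelihood η o := by
  rw [likelihood_eq_exp]; positivity

lemma likelihood_le_one (η : Bool → Cov p → ℝ) (o : Fin n → Obs p) : likelihood η o ≤ 1 := by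
  refine Finset.prod_le_one (fun i _ => ?_) fun i _ => ?_
  · simp only [condMean]
    split_ifs
    · exact Real.sigmoid_nonneg _
    · linarith [Real.sigmoid_le_one (η (o i).2.1 (o i).2.2)]
  · simp only [condMean]
    split_ifs
    · exact Real.sigmoid_le_one _
    · linarith [Real.sigmoid_nonneg (η (o i).2.1 (o i).2.2)]

/-- The normalized score `√n ℙₙ[γ (m_η - y)]` in the direction `γ`. -/
def score (γ η : Bool → Cov p → ℝ) (o : Fin n → Obs p) : ℝ :=
  (∑ i, γ (o i).2.1 (o i).2.2 * (condMean η (o i).2.1 (o i).2.2 - num (o i).1)) / √(n : ℝ)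

/-- The empirical information `ℙₙ[γ² m_η (1 - m_η)]` in the direction `γ`. -/
def info (γ η : Bool → Cov p → ℝ) (o : Fin n → Obs p) : ℝ :=
  empMean o fun z => γ z.2.1 z.2.2 ^ 2 *
    (condMean η z.2.1 z.2.2 * (1 - condMean η z.2.1 z.2.2))

/-- Local asymptotic normality of the likelihood in the direction `γ`, uniformly over the base
point. -/
lemma likelihood_shift (hn : 0 < n) (w γ : Bool → Cov p → ℝ) (l t : ℝ) (o : Fin n → Obs p)
    {K : ℝ} (hγ : ∀ i, |γ (o i).2.1 (o i).2.2| ≤ K) :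
    ∃ ρ : ℝ, |ρ| ≤ (|t| * K) ^ 3 / √(n : ℝ) ∧
      likelihood (tilt w (l - t / √(n : ℝ)) γ) o = likelihood (tilt w l γ) o *
        Real.exp (t * score γ (tilt w l γ) o - t ^ 2 * info γ (tilt w l γ) o / 2 + ρ) := by
  have hn' : (0 : ℝ) < n := by positivity
  have hs : 0 < √(n : ℝ) := Real.sqrt_pos.2 hn'
  have hq : √(n : ℝ) ^ 2 = n := Real.sq_sqrt hn'.le
  set η := tilt w l γ with hη
  set g : Fin n → ℝ := fun i => γ (o i).2.1 (o i).2.2 with hg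
  set e : Fin n → ℝ := fun i => η (o i).2.1 (o i).2.2 with he
  set h : Fin n → ℝ := fun i => t * g i / √(n : ℝ) with hh
  set q : Fin n → ℝ := fun i => h i * (Real.sigmoid (e i) - num (o i).1)
    - h i ^ 2 * (Real.sigmoid (e i) * (1 - Real.sigmoid (e i))) / 2 with hqdef
  have hshift : ∀ i, tilt w (l - t / √(n : ℝ)) γ (o i).2.1 (o i).2.2 = e i - h i := fun i => by
    simp only [he, hη, hh, hg, tilt]; ring
  refine ⟨∑ i, (logLik (o i).1 (e i - h i) - logLik (o i).1 (e i) - q i), ?_, ?_⟩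
  · have hb : ∀ i ∈ Finset.univ, |logLik (o i).1 (e i - h i) - logLik (o i).1 (e i) - q i|
        ≤ (|t| * K / √(n : ℝ)) ^ 3 := fun i _ => by
      refine (abs_logLik_sub_le _ _ _).trans ?_
      have : |h i| ≤ |t| * K / √(n : ℝ) := by
        simp only [hh, abs_div, abs_mul, abs_of_pos hs]
        gcongr
        exact hγ i
      gcongr
    refine (Finset.abs_sum_le_sum_abs _ _).trans ((Finset.sum_le_sum hb).trans_eq ?_)
    rw [Finset.sum_const, Finset.card_univ, Fintype.card_fin, nsmul_eq_mul, div_pow]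
    nth_rw 1 [← hq]
    field_simp
  · rw [likelihood_eq_exp, likelihood_eq_exp, ← Real.exp_add]
    congr 1
    simp only [hshift]
    have hsc : t * score γ η o - t ^ 2 * info γ η o / 2 = ∑ i, q i := by
      rw [score, info, empMean, Finset.sum_div, Finset.sum_div, Finset.mul_sum, Finset.mul_sum,
        Finset.sum_div, ← Finset.sum_sub_distrib]
      refine Finset.sum_congr rfl fun i _ => ?_
      simp only [hqdef, hh, hg, he, condMean]
      have hq' : (n : ℝ)⁻¹ = (√(n : ℝ))⁻¹ ^ 2 := by rw [inv_pow, hq]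
      rw [div_eq_mul_inv _ (n : ℝ), hq', div_eq_mul_inv, div_eq_mul_inv]
      ring
    rw [hsc, ← Finset.sum_add_distrib, ← Finset.sum_add_distrib]
    exact Finset.sum_congr rfl fun i _ => by ring

end

/-! ### The posterior distribution -/

section

lemma measurable_apply_bool {α β : Type*} [MeasurableSpace α] [MeasurableSpace β]
    {f : α → Bool → β} (hf : ∀ b, Measurable fun a => f a b) {d : α → Bool} (hd : Measurable d) :
    Measurable fun a => f a (d a) := by
  have : (fun a => f a (d a)) = fun a => if d a = true then f a true else f a false := by
    ext a; cases d a <;> simp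
  rw [this]
  exact Measurable.ite (hd (measurableSet_singleton true)) (hf true) (hf false)

@[fun_prop]
lemma measurable_num : Measurable num := measurable_from_top

lemma measurable_likelihood {n : ℕ} {α : Type*} [MeasurableSpace α] {m : α → Fin n → ℝ}
    (hm : ∀ i, Measurable fun a => m a i) {y : α → Fin n → Bool}
    (hy : ∀ i, Measurable fun a => y a i) :
    Measurable fun a => ∏ i, if y a i then m a i else 1 - m a i :=
  Finset.measurable_prod _ fun i _ =>
    Measurable.ite (hy i (measurableSet_singleton true)) (hm i) ((hm i).const_sub 1)

variable {p n : ℕ} {Ξ : Type u} [MeasurableSpace Ξ]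

/-- The prior distribution of `(W, λ)`. -/
abbrev prior (ν : Measure Ξ) (σ : ℝ) : Measure (Ξ × ℝ) :=
  ν.prod (gaussianReal 0 (σ ^ 2).toNNReal)

/-- The marginal likelihood of the data. -/
def evidence (ν : Measure Ξ) (W : Ξ → Bool → Cov p → ℝ) (σ : ℝ) (γ : Bool → Cov p → ℝ)
    (o : Fin n → Obs p) : ℝ≥0∞ :=
  ∫⁻ θ, ENNReal.ofReal (likelihood (tilt (W θ.1) θ.2 γ) o) ∂(prior ν σ)

lemma measurable_tilt_apply {W : Ξ → Bool → Cov p → ℝ} (hW : ∀ d x, Measurable fun ξ => W ξ d x)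
    (γ : Bool → Cov p → ℝ) (d : Bool) (x : Cov p) (c : ℝ) :
    Measurable fun θ : Ξ × ℝ => tilt (W θ.1) (θ.2 - c) γ d x := by
  have := hW d x
  unfold tilt
  fun_prop

lemma measurable_condMean_apply {W : Ξ → Bool → Cov p → ℝ}
    (hW : ∀ d x, Measurable fun ξ => W ξ d x) (γ : Bool → Cov p → ℝ) (d : Bool) (x : Cov p)
    (c : ℝ) : Measurable fun θ : Ξ × ℝ => condMean (tilt (W θ.1) (θ.2 - c) γ) d x :=
  continuous_sigmoid.measurable.comp (measurable_tilt_apply hW γ d x c)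

lemma measurable_likelihood_tilt {W : Ξ → Bool → Cov p → ℝ}
    (hW : ∀ d x, Measurable fun ξ => W ξ d x) (γ : Bool → Cov p → ℝ) (o : Fin n → Obs p) (c : ℝ) :
    Measurable fun θ : Ξ × ℝ => likelihood (tilt (W θ.1) (θ.2 - c) γ) o :=
  measurable_likelihood (fun _ => measurable_condMean_apply hW γ _ _ c) fun _ => measurable_const

lemma measurable_likelihood_tilt_zero {W : Ξ → Bool → Cov p → ℝ}
    (hW : ∀ d x, Measurable fun ξ => W ξ d x) (γ : Bool → Cov p → ℝ) (o : Fin n → Obs p) :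
    Measurable fun θ : Ξ × ℝ => likelihood (tilt (W θ.1) θ.2 γ) o := by
  simpa using measurable_likelihood_tilt hW γ o 0

lemma evidence_ne_zero (ν : Measure Ξ) [IsProbabilityMeasure ν] {W : Ξ → Bool → Cov p → ℝ}
    (hW : ∀ d x, Measurable fun ξ => W ξ d x) (σ : ℝ) (γ : Bool → Cov p → ℝ) (o : Fin n → Obs p) :
    evidence ν W σ γ o ≠ 0 := by
  rw [evidence, ← pos_iff_ne_zero,
    lintegral_pos_iff_support (measurable_likelihood_tilt_zero hW γ o).ennreal_ofReal]
  have : (Function.support fun θ : Ξ × ℝ =>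
      ENNReal.ofReal (likelihood (tilt (W θ.1) θ.2 γ) o)) = Set.univ := by
    ext θ; simp [likelihood_pos]
  rw [this]
  simp

lemma evidence_ne_top (ν : Measure Ξ) [IsProbabilityMeasure ν] (W : Ξ → Bool → Cov p → ℝ)
    (σ : ℝ) (γ : Bool → Cov p → ℝ) (o : Fin n → Obs p) : evidence ν W σ γ o ≠ ∞ := by
  refine ne_top_of_le_ne_top ENNReal.one_ne_top ?_
  calc evidence ν W σ γ o ≤ ∫⁻ _, 1 ∂(prior ν σ) :=
        lintegral_mono fun θ => by simpa using likelihood_le_one _ _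
    _ = 1 := by simp

lemma posterior_eq (ν : Measure Ξ) (W : Ξ → Bool → Cov p → ℝ) (σ : ℝ) (γ : Bool → Cov p → ℝ)
    (o : Fin n → Obs p) :
    posterior ν W σ γ o = (evidence ν W σ γ o)⁻¹ • (prior ν σ).withDensity
      fun θ => ENNReal.ofReal (likelihood (tilt (W θ.1) θ.2 γ) o) := by
  rw [posterior, evidence, withDensity_apply _ MeasurableSet.univ, setLIntegral_univ]

lemma isProbabilityMeasure_posterior (ν : Measure Ξ) [IsProbabilityMeasure ν]
    {W : Ξ → Bool → Cov p → ℝ} (hW : ∀ d x, Measurable fun ξ => W ξ d x) (σ : ℝ)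
    (γ : Bool → Cov p → ℝ) (o : Fin n → Obs p) : IsProbabilityMeasure (posterior ν W σ γ o) := by
  constructor
  rw [posterior_eq, Measure.smul_apply, withDensity_apply _ MeasurableSet.univ, setLIntegral_univ,
    smul_eq_mul]
  exact ENNReal.inv_mul_cancel (evidence_ne_zero ν hW σ γ o) (evidence_ne_top ν W σ γ o)

/-- Bayes' rule for expectations. -/
lemma lintegral_posterior (ν : Measure Ξ) [IsProbabilityMeasure ν]
    {W : Ξ → Bool → Cov p → ℝ} (hW : ∀ d x, Measurable fun ξ => W ξ d x) (σ : ℝ)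
    (γ : Bool → Cov p → ℝ) (o : Fin n → Obs p) {f : Ξ × ℝ → ℝ≥0∞} (hf : Measurable f) :
    ∫⁻ θ, f θ ∂(posterior ν W σ γ o) = (evidence ν W σ γ o)⁻¹ *
      ∫⁻ θ, ENNReal.ofReal (likelihood (tilt (W θ.1) θ.2 γ) o) * f θ ∂(prior ν σ) := by
  rw [posterior_eq, lintegral_smul_measure, lintegral_withDensity_eq_lintegral_mul _
    (measurable_likelihood_tilt_zero hW γ o).ennreal_ofReal hf, smul_eq_mul]
  rfl

/-- The Cameron–Martin formula for a translation of a centred Gaussian variable. -/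
lemma lintegral_gaussianReal_shift {v : ℝ≥0} (hv : v ≠ 0) (s : ℝ) {f : ℝ → ℝ≥0∞}
    (hf : Measurable f) :
    ∫⁻ l, f (l - s) * ENNReal.ofReal (Real.exp (s * l / v - s ^ 2 / (2 * v))) ∂(gaussianReal 0 v)
      = ∫⁻ l, f l ∂(gaussianReal 0 v) := by
  have hv' : (v : ℝ) ≠ 0 := by exact_mod_cast hv
  rw [gaussianReal_of_var_ne_zero _ hv,
    lintegral_withDensity_eq_lintegral_mul _ (measurable_gaussianPDF _ _) (by fun_prop),
    lintegral_withDensity_eq_lintegral_mul _ (measurable_gaussianPDF _ _) hf,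
    ← lintegral_sub_right_eq_self (fun l => (gaussianPDF 0 v * f) l) s]
  refine lintegral_congr fun l => ?_
  simp only [Pi.mul_apply]
  rw [mul_comm (f (l - s)), ← mul_assoc]
  congr 1
  rw [gaussianPDF, gaussianPDF, ← ENNReal.ofReal_mul (gaussianPDFReal_nonneg _ _ _)]
  congr 1
  rw [gaussianPDFReal, gaussianPDFReal, mul_assoc, ← Real.exp_add]
  congr 2
  field_simp
  ring

lemma lintegral_prior_shift (ν : Measure Ξ) [IsProbabilityMeasure ν] {σ : ℝ} (hσ : 0 < σ) (s : ℝ)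
    {F : Ξ × ℝ → ℝ≥0∞} (hF : Measurable F) :
    ∫⁻ θ, F (θ.1, θ.2 - s) * ENNReal.ofReal (Real.exp (s * θ.2 / σ ^ 2 - s ^ 2 / (2 * σ ^ 2)))
      ∂(prior ν σ) = ∫⁻ θ, F θ ∂(prior ν σ) := by
  have hv : (σ ^ 2).toNNReal ≠ 0 := by simpa using hσ.ne'
  have hvc : ((σ ^ 2).toNNReal : ℝ) = σ ^ 2 := Real.coe_toNNReal _ (sq_nonneg σ)
  rw [prior, lintegral_prod _ (by fun_prop), lintegral_prod _ hF.aemeasurable]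
  refine lintegral_congr fun ξ => ?_
  have h := lintegral_gaussianReal_shift hv s (hF.comp (measurable_prodMk_left (x := ξ)))
  simp only [hvc, Function.comp_apply] at h
  exact h

/-- The exponential tilts of the posterior that correspond to the perturbation of `λ` by
`- t / √n`, in the direction of the estimated Riesz representor, have posterior mean one. -/
lemma lintegral_posterior_tilt (ν : Measure Ξ) [IsProbabilityMeasure ν]
    {W : Ξ → Bool → Cov p → ℝ} (hW : ∀ d x, Measurable fun ξ => W ξ d x) {σ : ℝ} (hσ : 0 < σ)
    (γ : Bool → Cov p → ℝ) (o : Fin n → Obs p) (s : ℝ) {q : Ξ × ℝ → ℝ}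
    (hq : ∀ θ, likelihood (tilt (W θ.1) (θ.2 - s) γ) o
      = likelihood (tilt (W θ.1) θ.2 γ) o * Real.exp (q θ)) (hqm : Measurable q) :
    ∫⁻ θ, ENNReal.ofReal (Real.exp (q θ + (s * θ.2 / σ ^ 2 - s ^ 2 / (2 * σ ^ 2))))
      ∂(posterior ν W σ γ o) = 1 := by
  rw [lintegral_posterior ν hW σ γ o (by fun_prop)]
  have h1 : ∀ θ : Ξ × ℝ, ENNReal.ofReal (likelihood (tilt (W θ.1) θ.2 γ) o)
      * ENNReal.ofReal (Real.exp (q θ + (s * θ.2 / σ ^ 2 - s ^ 2 / (2 * σ ^ 2))))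
      = ENNReal.ofReal (likelihood (tilt (W θ.1) (θ.2 - s) γ) o)
        * ENNReal.ofReal (Real.exp (s * θ.2 / σ ^ 2 - s ^ 2 / (2 * σ ^ 2))) := fun θ => by
    rw [hq θ, Real.exp_add, ENNReal.ofReal_mul (Real.exp_pos _).le,
      ENNReal.ofReal_mul (likelihood_pos _ _).le, mul_assoc]
  simp only [h1]
  have h2 := lintegral_prior_shift ν hσ s (measurable_likelihood_tilt_zero hW γ o).ennreal_ofReal
  rw [h2, ← evidence]
  exact ENNReal.inv_mul_cancel (evidence_ne_zero ν hW σ γ o) (evidence_ne_top ν W σ γ o)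

lemma measurable_score {W : Ξ → Bool → Cov p → ℝ} (hW : ∀ d x, Measurable fun ξ => W ξ d x)
    (γ : Bool → Cov p → ℝ) (o : Fin n → Obs p) :
    Measurable fun θ : Ξ × ℝ => score γ (tilt (W θ.1) θ.2 γ) o := by
  have h : ∀ d x, Measurable fun θ : Ξ × ℝ => condMean (tilt (W θ.1) θ.2 γ) d x := fun d x => by
    simpa using measurable_condMean_apply hW γ d x 0
  unfold score
  exact (Finset.measurable_fun_sum _ fun i _ => ((h _ _).sub_const _).const_mul _).div_const _

lemma measurable_info {W : Ξ → Bool → Cov p → ℝ} (hW : ∀ d x, Measurable fun ξ => W ξ d x)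
    (γ : Bool → Cov p → ℝ) (o : Fin n → Obs p) :
    Measurable fun θ : Ξ × ℝ => info γ (tilt (W θ.1) θ.2 γ) o := by
  have h : ∀ d x, Measurable fun θ : Ξ × ℝ => condMean (tilt (W θ.1) θ.2 γ) d x := fun d x => by
    simpa using measurable_condMean_apply hW γ d x 0
  unfold info empMean
  exact (Finset.measurable_fun_sum _ fun i _ =>
    ((h _ _).mul ((h _ _).const_sub _)).const_mul _).div_const _

lemma condMean_mem_Icc (η : Bool → Cov p → ℝ) (d : Bool) (x : Cov p) :
    condMean η d x ∈ Set.Icc (0 : ℝ) 1 := ⟨Real.sigmoid_nonneg _, Real.sigmoid_le_one _⟩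

lemma info_nonneg (γ η : Bool → Cov p → ℝ) (o : Fin n → Obs p) : 0 ≤ info γ η o := by
  refine div_nonneg (Finset.sum_nonneg fun i _ => ?_) (Nat.cast_nonneg n)
  have h := condMean_mem_Icc η (o i).2.1 (o i).2.2
  exact mul_nonneg (sq_nonneg _) (mul_nonneg h.1 (by linarith [h.2]))

lemma empMean_le {o : Fin n → Obs p} {h : Obs p → ℝ} {c : ℝ} (hc : 0 ≤ c)
    (hh : ∀ i, h (o i) ≤ c) : empMean o h ≤ c := by
  rcases Nat.eq_zero_or_pos n with rfl | hn
  · simpa [empMean] using hc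
  · have hn' : (0 : ℝ) < n := by positivity
    rw [empMean, div_le_iff₀ hn']
    exact (Finset.sum_le_sum fun i _ => hh i).trans_eq (by simp [mul_comm])

lemma info_le {γ : Bool → Cov p → ℝ} (η : Bool → Cov p → ℝ) {o : Fin n → Obs p} {K : ℝ}
    (hγ : ∀ i, |γ (o i).2.1 (o i).2.2| ≤ K) : info γ η o ≤ K ^ 2 := by
  refine empMean_le (sq_nonneg K) fun i => ?_
  have h := condMean_mem_Icc η (o i).2.1 (o i).2.2
  have h1 : γ (o i).2.1 (o i).2.2 ^ 2 ≤ K ^ 2 := by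
    rw [← sq_abs]; exact pow_le_pow_left₀ (abs_nonneg _) (hγ i) 2
  have h2 : condMean η (o i).2.1 (o i).2.2 * (1 - condMean η (o i).2.1 (o i).2.2) ≤ 1 := by
    nlinarith [h.1, h.2]
  calc _ ≤ K ^ 2 * 1 := mul_le_mul h1 h2 (mul_nonneg h.1 (by linarith [h.2])) (sq_nonneg K)
    _ = _ := mul_one _

/-- Asymptotic normality of the score under the posterior: a bound that is uniform over the prior,
the direction `γ` and the data, given that the empirical information is nearly constant under the
posterior. -/
lemma exists_dBL_score_le (v : ℝ≥0) (K : ℝ) {δ : ℝ} (hδ : 0 < δ) :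
    ∃ ε : ℝ, 0 < ε ∧ ∀ᶠ n : ℕ in atTop, ∀ {p : ℕ} {Ξ : Type u} [MeasurableSpace Ξ] (ν : Measure Ξ)
      [IsProbabilityMeasure ν] (W : Ξ → Bool → Cov p → ℝ) (σ : ℝ) (γ : Bool → Cov p → ℝ)
      (o : Fin n → Obs p), (∀ d x, Measurable fun ξ => W ξ d x) → 0 < σ →
      1 / (n * σ ^ 2) ≤ ε → (∀ i, |γ (o i).2.1 (o i).2.2| ≤ K) →
      ∫ θ, |info γ (tilt (W θ.1) θ.2 γ) o - v| ∂(posterior ν W σ γ o) ≤ ε →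
      dBL ((posterior ν W σ γ o).map fun θ =>
        score γ (tilt (W θ.1) θ.2 γ) o + θ.2 / (√(n : ℝ) * σ ^ 2)) (gaussianReal 0 v) ≤ δ := by
  obtain ⟨ε, hε, T, h⟩ := exists_dBL_map_le_of_tilt.{u} v (K ^ 2 + 1) hδ
  refine ⟨min (ε / 2) 1, by positivity, ?_⟩
  have hlim : Tendsto (fun n : ℕ => (|T| * |K|) ^ 3 / √(n : ℝ)) atTop (𝓝 0) :=
    tendsto_const_nhds.div_atTop (Real.tendsto_sqrt_atTop.comp tendsto_natCast_atTop_atTop)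
  filter_upwards [eventually_gt_atTop 0, hlim.eventually_le_const hε]
    with n hn hn2 p Ξ _ ν _ W σ γ o hW hσ h1 hγ hV
  have hn' : (0 : ℝ) < n := by positivity
  have hs : 0 < √(n : ℝ) := Real.sqrt_pos.2 hn'
  have hq : √(n : ℝ) ^ 2 = n := Real.sq_sqrt hn'.le
  have := isProbabilityMeasure_posterior ν hW σ γ o
  have hc0 : 0 ≤ 1 / (n * σ ^ 2) := by positivity
  have hsm := measurable_score hW γ o
  have him := measurable_info hW γ o
  have hib : ∀ θ : Ξ × ℝ, |info γ (tilt (W θ.1) θ.2 γ) o - v| ≤ K ^ 2 + v := fun θ =>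
    abs_le.2 ⟨by nlinarith [info_nonneg γ (tilt (W θ.1) θ.2 γ) o],
      by linarith [info_le (tilt (W θ.1) θ.2 γ) hγ, v.2]⟩
  refine h (posterior ν W σ γ o) _ (fun θ => info γ (tilt (W θ.1) θ.2 γ) o + 1 / (n * σ ^ 2))
    (by fun_prop) (by fun_prop) (fun θ => ⟨?_, ?_⟩) ?_ fun t ht => ?_
  · have := info_nonneg γ (tilt (W θ.1) θ.2 γ) o
    linarith
  · have := info_le (tilt (W θ.1) θ.2 γ) hγ
    linarith [min_le_right (ε / 2) (1 : ℝ)]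
  · have hi : Integrable (fun θ : Ξ × ℝ => |info γ (tilt (W θ.1) θ.2 γ) o - v|)
        (posterior ν W σ γ o) :=
      Integrable.of_bound (him.sub_const _).abs.aestronglyMeasurable (K ^ 2 + v) (ae_of_all _ fun θ => by
        rw [Real.norm_of_nonneg (abs_nonneg _)]; exact hib θ)
    have : ∫ θ, |info γ (tilt (W θ.1) θ.2 γ) o + 1 / (n * σ ^ 2) - v| ∂(posterior ν W σ γ o)
        ≤ ∫ θ, (|info γ (tilt (W θ.1) θ.2 γ) o - v| + 1 / (n * σ ^ 2)) ∂(posterior ν W σ γ o) := by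
      refine integral_mono_of_nonneg (ae_of_all _ fun θ => abs_nonneg _)
        (hi.add (integrable_const _)) (ae_of_all _ fun θ => ?_)
      have := abs_add_le (info γ (tilt (W θ.1) θ.2 γ) o - v) (1 / (n * σ ^ 2))
      rw [abs_of_nonneg hc0, sub_add_eq_add_sub] at this
      exact this
    refine this.trans ?_
    rw [integral_add hi (integrable_const _), integral_const]
    simp only [probReal_univ, one_smul]
    linarith [min_le_left (ε / 2) (1 : ℝ)]
  · choose ρ hρ1 hρ2 using fun θ : Ξ × ℝ => likelihood_shift hn (W θ.1) γ θ.2 t o hγ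
    have hρ3 : ∀ θ : Ξ × ℝ, ρ θ = Real.log (likelihood (tilt (W θ.1) (θ.2 - t / √(n : ℝ)) γ) o)
        - Real.log (likelihood (tilt (W θ.1) θ.2 γ) o)
        - (t * score γ (tilt (W θ.1) θ.2 γ) o - t ^ 2 * info γ (tilt (W θ.1) θ.2 γ) o / 2) :=
      fun θ => by
        rw [hρ2 θ, Real.log_mul (likelihood_pos _ _).ne' (Real.exp_pos _).ne', Real.log_exp]
        ring
    have hρm : Measurable ρ := by
      have : ρ = _ := funext hρ3
      rw [this]
      have a1 := measurable_likelihood_tilt hW γ o (t / √(n : ℝ))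
      have a2 := measurable_likelihood_tilt_zero hW γ o
      fun_prop
    refine ⟨ρ, hρm, fun θ => (hρ1 θ).trans (le_trans ?_ hn2), ?_⟩
    · have h3 : |t| * K ≤ |T| * |K| :=
        (mul_le_mul_of_nonneg_left (le_abs_self K) (abs_nonneg t)).trans
          (mul_le_mul_of_nonneg_right (ht.trans (le_abs_self T)) (abs_nonneg K))
      have hK : 0 ≤ K := (abs_nonneg _).trans (hγ ⟨0, hn⟩)
      gcongr
    · have := lintegral_posterior_tilt ν hW hσ γ o (t / √(n : ℝ)) hρ2 (by fun_prop)
      rw [← this]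
      refine lintegral_congr fun θ => ?_
      congr 2
      have e1 : (t / √(n : ℝ)) ^ 2 / (2 * σ ^ 2) = t ^ 2 * (1 / (n * σ ^ 2)) / 2 := by
        rw [div_pow, hq]; field_simp
      rw [e1]
      field_simp
      ring

end

/-! ### A leave-one-out bound for posterior means -/

section LeaveOneOut

variable {Θ Z : Type*} [MeasurableSpace Θ] [MeasurableSpace Z]

/-- The Bernoulli density `m(z)^y (1 - m(z))^{1-y}`. -/
def bernoulliDensity (m : Z → ℝ) (o : Bool × Z) : ℝ≥0∞ :=
  ENNReal.ofReal (if o.1 then m o.2 else 1 - m o.2)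

/-- `Y` is Bernoulli with mean `m₀(Z)` given `Z`, for `(Y, Z)` with law `P`. -/
def HasBernoulliConditional (P : Measure (Bool × Z)) (m₀ : Z → ℝ) : Prop :=
  ∀ G : Bool × Z → ℝ≥0∞, Measurable G → ∫⁻ o, G o ∂P =
    ∫⁻ o, (ENNReal.ofReal (m₀ o.2) * G (true, o.2)
      + ENNReal.ofReal (1 - m₀ o.2) * G (false, o.2)) ∂P

lemma measurable_bernoulliDensity {α : Type*} [MeasurableSpace α] {f : α → Z → ℝ} {g : α → Bool × Z}
    (hf : Measurable fun q : α × Z => f q.1 q.2) (hg : Measurable g) :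
    Measurable fun a => bernoulliDensity (f a) (g a) := by
  have h1 : Measurable fun a => f a (g a).2 := hf.comp (measurable_id.prodMk hg.snd)
  exact (Measurable.ite (hg.fst (measurableSet_singleton true)) h1 (h1.const_sub 1)).ennreal_ofReal

lemma ofReal_mul_measure_univ_le {ρ : Measure Θ} {a : ℝ} {f : Θ → ℝ} {φ : Θ → ℝ≥0∞}
    (hf : Measurable f) (h : ∀ θ, ENNReal.ofReal |f θ - a| ≤ φ θ) :
    ENNReal.ofReal a * ρ Set.univ ≤ ∫⁻ θ, ENNReal.ofReal (f θ) ∂ρ + ∫⁻ θ, φ θ ∂ρ := by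
  rw [← lintegral_const, ← lintegral_add_left hf.ennreal_ofReal]
  refine lintegral_mono fun θ => ?_
  calc ENNReal.ofReal a ≤ ENNReal.ofReal (f θ + |f θ - a|) :=
        ENNReal.ofReal_le_ofReal (by linarith [le_abs_self (-(f θ - a)), abs_neg (f θ - a)])
    _ ≤ ENNReal.ofReal (f θ) + ENNReal.ofReal |f θ - a| := ENNReal.ofReal_add_le
    _ ≤ _ := by gcongr; exact h θ

/-- The elementary inequality behind the leave-one-out bound: reweighting a measure by the density
of one further observation does not increase a mean by more than a constant factor on average over
that observation, if the mean controls the distance between the densities and the true one. -/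
lemma bernoulli_reweight_le {ρ : Measure Θ} {f : Θ → ℝ} (hf : Measurable f)
    (hf01 : ∀ θ, f θ ∈ Set.Icc (0 : ℝ) 1) {φ : Θ → ℝ≥0∞} (hφ : Measurable φ) (hφ2 : ∀ θ, φ θ ≤ 2)
    {a : ℝ} (h : ∀ θ, ENNReal.ofReal |f θ - a| ≤ φ θ) :
    ρ Set.univ * (ENNReal.ofReal a *
        ((∫⁻ θ, φ θ * ENNReal.ofReal (f θ) ∂ρ) / ∫⁻ θ, ENNReal.ofReal (f θ) ∂ρ)
      + ENNReal.ofReal (1 - a) *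
        ((∫⁻ θ, φ θ * ENNReal.ofReal (1 - f θ) ∂ρ) / ∫⁻ θ, ENNReal.ofReal (1 - f θ) ∂ρ))
      ≤ 5 * ∫⁻ θ, φ θ ∂ρ := by
  have key : ∀ (b : ℝ) (g : Θ → ℝ), Measurable g → (∀ θ, ENNReal.ofReal |g θ - b| ≤ φ θ) →
      ρ Set.univ * (ENNReal.ofReal b *
        ((∫⁻ θ, φ θ * ENNReal.ofReal (g θ) ∂ρ) / ∫⁻ θ, ENNReal.ofReal (g θ) ∂ρ))
      ≤ ∫⁻ θ, φ θ * ENNReal.ofReal (g θ) ∂ρ + 2 * ∫⁻ θ, φ θ ∂ρ := fun b g hg hgb => by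
    set N := ∫⁻ θ, φ θ * ENNReal.ofReal (g θ) ∂ρ
    set q := ∫⁻ θ, ENNReal.ofReal (g θ) ∂ρ
    have hN : N ≤ 2 * q := by
      rw [← lintegral_const_mul _ hg.ennreal_ofReal]
      exact lintegral_mono fun θ => by gcongr; exact hφ2 θ
    calc ρ Set.univ * (ENNReal.ofReal b * (N / q))
        = ENNReal.ofReal b * ρ Set.univ * (N / q) := by ring
      _ ≤ (q + ∫⁻ θ, φ θ ∂ρ) * (N / q) := by
          gcongr; exact ofReal_mul_measure_univ_le hg hgb
      _ = q * (N / q) + (∫⁻ θ, φ θ ∂ρ) * (N / q) := add_mul _ _ _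
      _ ≤ N + (∫⁻ θ, φ θ ∂ρ) * 2 :=
          add_le_add ENNReal.mul_div_le (by gcongr; exact ENNReal.div_le_of_le_mul hN)
      _ = _ := by rw [mul_comm (∫⁻ θ, φ θ ∂ρ)]
  have h1 := key a f hf h
  have h2 := key (1 - a) (fun θ => 1 - f θ) (hf.const_sub 1) fun θ => by
    rw [show 1 - f θ - (1 - a) = -(f θ - a) by ring, abs_neg]; exact h θ
  have h3 : ∫⁻ θ, φ θ * ENNReal.ofReal (f θ) ∂ρ + ∫⁻ θ, φ θ * ENNReal.ofReal (1 - f θ) ∂ρ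
      = ∫⁻ θ, φ θ ∂ρ := by
    have hφf : Measurable fun θ => φ θ * ENNReal.ofReal (f θ) := hφ.mul hf.ennreal_ofReal
    rw [← lintegral_add_left hφf]
    refine lintegral_congr fun θ => ?_
    rw [← mul_add, ← ENNReal.ofReal_add (hf01 θ).1 (by linarith [(hf01 θ).2])]
    simp
  rw [mul_add]
  refine (add_le_add h1 h2).trans_eq ?_
  rw [add_add_add_comm, h3]
  ring

/-- The leave-one-out bound for one further observation, averaged over its law. -/
lemma lintegral_reweight_le {P : Measure (Bool × Z)} [IsProbabilityMeasure P] {m₀ : Z → ℝ}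
    (hP : HasBernoulliConditional P m₀) {ρ : Measure Θ} [IsFiniteMeasure ρ] {m : Θ → Z → ℝ}
    (hm : Measurable fun q : Θ × Z => m q.1 q.2) (hm01 : ∀ θ z, m θ z ∈ Set.Icc (0 : ℝ) 1)
    {φ : Θ → Z → ℝ≥0∞} (hφ : Measurable fun q : Θ × Z => φ q.1 q.2) (hφ2 : ∀ θ z, φ θ z ≤ 2)
    (h : ∀ θ z, ENNReal.ofReal |m θ z - m₀ z| ≤ φ θ z) {ε : ℝ≥0∞}
    (hε : ∀ᵐ θ ∂ρ, ∫⁻ o, φ θ o.2 ∂P ≤ ε) :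
    ∫⁻ o, (∫⁻ θ, φ θ o.2 * bernoulliDensity (m θ) o ∂ρ)
      / (∫⁻ θ, bernoulliDensity (m θ) o ∂ρ) ∂P ≤ 5 * ε := by
  rcases eq_or_ne ρ 0 with rfl | hρ
  · simp
  have hR0 : ρ Set.univ ≠ 0 := by simpa using hρ
  have hRt : ρ Set.univ ≠ ∞ := measure_ne_top _ _
  have hd : Measurable fun q : (Bool × Z) × Θ => bernoulliDensity (m q.2) q.1 :=
    measurable_bernoulliDensity (f := fun (q : (Bool × Z) × Θ) z => m q.2 z)
      (hm.comp (measurable_fst.snd.prodMk measurable_snd)) measurable_fst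
  have hφm : Measurable fun q : (Bool × Z) × Θ => φ q.2 q.1.2 :=
    hφ.comp (measurable_snd.prodMk measurable_fst.snd)
  have hG : Measurable fun o : Bool × Z => (∫⁻ θ, φ θ o.2 * bernoulliDensity (m θ) o ∂ρ)
      / (∫⁻ θ, bernoulliDensity (m θ) o ∂ρ) :=
    (hφm.mul hd).lintegral_prod_right'.div hd.lintegral_prod_right'
  rw [hP _ hG]
  have hb : ∀ o : Bool × Z, ENNReal.ofReal (m₀ o.2) *
        ((∫⁻ θ, φ θ o.2 * bernoulliDensity (m θ) (true, o.2) ∂ρ)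
          / (∫⁻ θ, bernoulliDensity (m θ) (true, o.2) ∂ρ))
      + ENNReal.ofReal (1 - m₀ o.2) *
        ((∫⁻ θ, φ θ o.2 * bernoulliDensity (m θ) (false, o.2) ∂ρ)
          / (∫⁻ θ, bernoulliDensity (m θ) (false, o.2) ∂ρ))
      ≤ (ρ Set.univ)⁻¹ * (5 * ∫⁻ θ, φ θ o.2 ∂ρ) := fun o => by
    have h1 := bernoulli_reweight_le (ρ := ρ) (f := fun θ => m θ o.2)
      (hm.comp measurable_prodMk_right) (fun θ => hm01 θ o.2) (φ := fun θ => φ θ o.2)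
      (hφ.comp measurable_prodMk_right) (fun θ => hφ2 θ o.2) (a := m₀ o.2) (fun θ => h θ o.2)
    have h2 := mul_le_mul_right h1 (ρ Set.univ)⁻¹
    rw [← mul_assoc, ENNReal.inv_mul_cancel hR0 hRt, one_mul] at h2
    simpa [bernoulliDensity] using h2
  refine (lintegral_mono hb).trans ?_
  rw [lintegral_const_mul _ ((hφm.lintegral_prod_right').const_mul _),
    lintegral_const_mul _ hφm.lintegral_prod_right',
    lintegral_lintegral_swap hφm.aemeasurable]
  have h3 : ∫⁻ θ, ∫⁻ o, φ θ o.2 ∂P ∂ρ ≤ ε * ρ Set.univ := by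
    rw [← lintegral_const]
    exact lintegral_mono_ae hε
  calc (ρ Set.univ)⁻¹ * (5 * ∫⁻ θ, ∫⁻ o, φ θ o.2 ∂P ∂ρ)
      ≤ (ρ Set.univ)⁻¹ * (5 * (ε * ρ Set.univ)) := by gcongr
    _ = 5 * ε * ((ρ Set.univ)⁻¹ * ρ Set.univ) := by ring
    _ = 5 * ε := by rw [ENNReal.inv_mul_cancel hR0 hRt, mul_one]

/-- The leave-one-out bound for a coordinate of an i.i.d. sample: for priors on regression
functions that are close to `m₀` in mean, the posterior distance to `m₀` *at a data point* is small
in mean.  The posterior depends on this data point only through a single likelihood factor, so no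
entropy condition is needed. -/
lemma lintegral_leave_one_out_le {P : Measure (Bool × Z)} [IsProbabilityMeasure P] {m₀ : Z → ℝ}
    (hP : HasBernoulliConditional P m₀) {ρ : Measure Θ} [IsFiniteMeasure ρ] {m : Θ → Z → ℝ}
    (hm : Measurable fun q : Θ × Z => m q.1 q.2) (hm01 : ∀ θ z, m θ z ∈ Set.Icc (0 : ℝ) 1)
    {φ : Θ → Z → ℝ≥0∞} (hφ : Measurable fun q : Θ × Z => φ q.1 q.2) (hφ2 : ∀ θ z, φ θ z ≤ 2)
    (h : ∀ θ z, ENNReal.ofReal |m θ z - m₀ z| ≤ φ θ z) {ε : ℝ≥0∞}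
    (hε : ∀ᵐ θ ∂ρ, ∫⁻ o, φ θ o.2 ∂P ≤ ε) {n : ℕ} (i : Fin n) :
    ∫⁻ o : Fin n → Bool × Z, (∫⁻ θ, φ θ (o i).2 * ∏ j, bernoulliDensity (m θ) (o j) ∂ρ)
      / (∫⁻ θ, ∏ j, bernoulliDensity (m θ) (o j) ∂ρ) ∂(Measure.pi fun _ => P) ≤ 5 * ε := by
  cases n with
  | zero => exact i.elim0
  | succ n =>
    have hd : ∀ {k : ℕ} (j : Fin k), Measurable fun q : (Fin k → Bool × Z) × Θ =>
        bernoulliDensity (m q.2) (q.1 j) := fun {k} j =>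
      measurable_bernoulliDensity (f := fun (q : (Fin k → Bool × Z) × Θ) z => m q.2 z)
        (hm.comp (measurable_fst.snd.prodMk measurable_snd))
        ((measurable_pi_apply j).comp measurable_fst)
    have hL : ∀ k, Measurable fun q : (Fin k → Bool × Z) × Θ =>
        ∏ j, bernoulliDensity (m q.2) (q.1 j) := fun k => Finset.measurable_prod _ fun j _ => hd j
    have hφm : Measurable fun q : (Fin (n + 1) → Bool × Z) × Θ => φ q.2 (q.1 i).2 :=
      hφ.comp (measurable_snd.prodMk ((measurable_pi_apply i).comp measurable_fst).snd)
    have hF : Measurable fun o : Fin (n + 1) → Bool × Z =>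
        (∫⁻ θ, φ θ (o i).2 * ∏ j, bernoulliDensity (m θ) (o j) ∂ρ)
          / (∫⁻ θ, ∏ j, bernoulliDensity (m θ) (o j) ∂ρ) :=
      (hφm.mul (hL _)).lintegral_prod_right'.div (hL _).lintegral_prod_right'
    have hmp := (measurePreserving_piFinSuccAbove (fun _ : Fin (n + 1) => P) i).symm
    have hF' := hF.comp hmp.measurable
    simp only [Function.comp_def] at hF'
    rw [← hmp.lintegral_comp hF, lintegral_prod_symm _ hF'.aemeasurable]
    have hone : ∀ o' : Fin n → Bool × Z, ∫⁻ x, (∫⁻ θ, φ θ x.2 *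
          (bernoulliDensity (m θ) x * ∏ j, bernoulliDensity (m θ) (o' j)) ∂ρ)
        / (∫⁻ θ, bernoulliDensity (m θ) x * ∏ j, bernoulliDensity (m θ) (o' j) ∂ρ) ∂P
        ≤ 5 * ε := fun o' => by
      have hL' : Measurable fun θ => ∏ j, bernoulliDensity (m θ) (o' j) :=
        (hL n).comp (measurable_prodMk_left (x := o'))
      have hd1 : ∀ θ z, bernoulliDensity (m θ) z ≤ 1 := fun θ z => by
        rw [bernoulliDensity, ENNReal.ofReal_le_one]
        split_ifs
        · exact (hm01 _ _).2
        · linarith [(hm01 θ z.2).1]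
      have hfin : IsFiniteMeasure
          (ρ.withDensity fun θ => ∏ j, bernoulliDensity (m θ) (o' j)) := by
        refine isFiniteMeasure_withDensity (ne_top_of_le_ne_top (measure_ne_top ρ Set.univ) ?_)
        rw [← lintegral_one]
        exact lintegral_mono fun θ => Finset.prod_le_one' fun j _ => hd1 _ _
      have h1 := lintegral_reweight_le hP
        (ρ := ρ.withDensity fun θ => ∏ j, bernoulliDensity (m θ) (o' j)) hm hm01 hφ hφ2 h
        ((withDensity_absolutelyContinuous _ _).ae_le hε)
      refine le_trans (lintegral_mono fun x => ?_) h1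
      have hdx : Measurable fun θ => bernoulliDensity (m θ) x :=
        measurable_bernoulliDensity hm measurable_const
      have hφx : Measurable fun θ => φ θ x.2 := hφ.comp measurable_prodMk_right
      have hφd : Measurable fun θ => φ θ x.2 * bernoulliDensity (m θ) x := hφx.mul hdx
      rw [lintegral_withDensity_eq_lintegral_mul _ hL' hφd,
        lintegral_withDensity_eq_lintegral_mul _ hL' hdx]
      refine (congrArg₂ (· / ·) (lintegral_congr fun θ => ?_) (lintegral_congr fun θ => ?_)).le
      · simp only [Pi.mul_apply]; ring
      · simp only [Pi.mul_apply]; ring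
    calc _ ≤ ∫⁻ _, 5 * ε ∂(Measure.pi fun _ : Fin n => P) := by
          refine lintegral_mono fun o' => le_trans (lintegral_mono fun x => ?_) (hone o')
          simp [MeasurableEquiv.piFinSuccAbove_symm_apply, Fin.insertNthEquiv,
            Fin.prod_univ_succAbove _ i]
      _ = 5 * ε := by simp

end LeaveOneOut

/-! ### The population -/

section

lemma num_mem_Icc (b : Bool) : num b ∈ Set.Icc (0 : ℝ) 1 := by cases b <;> simp [num]

lemma num_sq (b : Bool) : num b ^ 2 = num b := by cases b <;> simp [num]

lemma abs_num_le (b : Bool) : |num b| ≤ 1 := by cases b <;> simp [num]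

/-- A conditional expectation given `g` integrates correctly against functions of `g`. -/
lemma integral_mul_comp_eq {α β : Type*} [MeasurableSpace α] [MeasurableSpace β] {P : Measure α}
    [IsFiniteMeasure P] {g : α → β} (hg : Measurable g) {f f₀ : α → ℝ} (hf : Integrable f P)
    (hf₀ : f₀ =ᵐ[P] P[f | MeasurableSpace.comap g inferInstance]) {h : β → ℝ} (hh : Measurable h)
    (hi : Integrable (fun a => f a * h (g a)) P) :
    ∫ a, f a * h (g a) ∂P = ∫ a, f₀ a * h (g a) ∂P := by
  have hsm : StronglyMeasurable[MeasurableSpace.comap g inferInstance] fun a => h (g a) :=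
    (hh.comp (comap_measurable g)).stronglyMeasurable
  have h1 := condExp_mul_of_stronglyMeasurable_right (μ := P) hsm hi hf
  rw [← integral_condExp hg.comap_le]
  refine integral_congr_ae ?_
  filter_upwards [h1, hf₀] with a h1 h2
  rw [h2]
  exact h1

variable {p : ℕ}

lemma measurable_observe : Measurable (observe (p := p)) := by
  refine Measurable.prodMk ?_ measurable_snd
  exact Measurable.ite (measurable_snd.fst (measurableSet_singleton true)) measurable_fst.snd
    measurable_fst.fst

lemma measurable_obsCov : Measurable fun o : Obs p => o.2.2 := measurable_snd.snd

instance (Q : Measure (Unit0 p)) [IsProbabilityMeasure Q] : IsProbabilityMeasure (obsLaw Q) :=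
  Measure.isProbabilityMeasure_map measurable_observe.aemeasurable

instance (Q : Measure (Unit0 p)) [IsProbabilityMeasure Q] : IsProbabilityMeasure (covLaw Q) :=
  Measure.isProbabilityMeasure_map measurable_covariate.aemeasurable

lemma map_obsLaw_covariate (Q : Measure (Unit0 p)) :
    (obsLaw Q).map (fun o : Obs p => o.2.2) = covLaw Q := by
  rw [obsLaw, Measure.map_map measurable_obsCov measurable_observe]
  rfl

lemma ae_obsLaw_of_ae_covLaw {Q : Measure (Unit0 p)} {s : Cov p → Prop}
    (h : ∀ᵐ x ∂(covLaw Q), s x) : ∀ᵐ o ∂(obsLaw Q), s o.2.2 := by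
  rw [← map_obsLaw_covariate] at h
  exact ae_of_ae_map measurable_obsCov.aemeasurable h

lemma ae_mem_support (Q : Measure (Unit0 p)) : ∀ᵐ x ∂(covLaw Q), x ∈ (covLaw Q).support :=
  Measure.support_mem_ae

lemma integral_covLaw (Q : Measure (Unit0 p)) {f : Cov p → ℝ} (hf : Measurable f) :
    ∫ x, f x ∂(covLaw Q) = ∫ o, f o.2.2 ∂(obsLaw Q) := by
  rw [← map_obsLaw_covariate, integral_map measurable_obsCov.aemeasurable
    hf.aestronglyMeasurable]

/-- A measurable version of a conditional expectation given `g` of a function with values in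
`[0, 1]` takes values in `[0, 1]`. -/
lemma ae_mem_Icc_of_condExp {α β : Type*} [MeasurableSpace α] [MeasurableSpace β] {P : Measure α}
    [IsProbabilityMeasure P] {g : α → β} (hg : Measurable g) {f f₀ : α → ℝ} (hfm : Measurable f)
    (hf : ∀ a, f a ∈ Set.Icc (0 : ℝ) 1)
    (hf₀ : f₀ =ᵐ[P] P[f | MeasurableSpace.comap g inferInstance]) :
    ∀ᵐ a ∂P, f₀ a ∈ Set.Icc (0 : ℝ) 1 := by
  have hi : Integrable f P := Integrable.of_bound hfm.aestronglyMeasurable 1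
    (ae_of_all _ fun a => by rw [Real.norm_eq_abs, abs_le]; exact ⟨by linarith [(hf a).1], (hf a).2⟩)
  have h0 : 0 ≤ᵐ[P] P[f | MeasurableSpace.comap g inferInstance] :=
    condExp_nonneg (ae_of_all _ fun a => (hf a).1)
  have h1 : P[f | MeasurableSpace.comap g inferInstance]
      ≤ᵐ[P] P[fun _ => (1 : ℝ) | MeasurableSpace.comap g inferInstance] :=
    condExp_mono hi (integrable_const _) (ae_of_all _ fun a => (hf a).2)
  rw [condExp_const hg.comap_le] at h1
  filter_upwards [h0, h1, hf₀] with a h0 h1 h2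
  rw [h2]
  exact ⟨h0, h1⟩

lemma lintegral_mul_comp_eq {α β : Type*} [MeasurableSpace α] [MeasurableSpace β] {P : Measure α}
    [IsProbabilityMeasure P] {g : α → β} (hg : Measurable g) {f f₀ : α → ℝ} (hfm : Measurable f)
    (hf₀m : Measurable f₀) (hf : ∀ a, f a ∈ Set.Icc (0 : ℝ) 1)
    (hf₀ : f₀ =ᵐ[P] P[f | MeasurableSpace.comap g inferInstance]) {h : β → ℝ≥0∞}
    (hh : Measurable h) :
    ∫⁻ a, ENNReal.ofReal (f a) * h (g a) ∂P = ∫⁻ a, ENNReal.ofReal (f₀ a) * h (g a) ∂P := by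
  have hi : Integrable f P := Integrable.of_bound hfm.aestronglyMeasurable 1
    (ae_of_all _ fun a => by rw [Real.norm_eq_abs, abs_le]; exact ⟨by linarith [(hf a).1], (hf a).2⟩)
  have h01 := ae_mem_Icc_of_condExp hg hfm hf hf₀
  have hi₀ : Integrable f₀ P := integrable_condExp.congr hf₀.symm
  have key : ((P.withDensity fun a => ENNReal.ofReal (f a)).map g)
      = (P.withDensity fun a => ENNReal.ofReal (f₀ a)).map g := by
    ext s hs
    rw [Measure.map_apply hg hs, Measure.map_apply hg hs, withDensity_apply _ (hg hs),
      withDensity_apply _ (hg hs),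
      ← ofReal_integral_eq_lintegral_ofReal hi.integrableOn (ae_of_all _ fun a => (hf a).1),
      ← ofReal_integral_eq_lintegral_ofReal hi₀.integrableOn
        (ae_restrict_of_ae (h01.mono fun a ha => ha.1))]
    congr 1
    rw [← setIntegral_condExp hg.comap_le hi ⟨s, hs, rfl⟩]
    exact setIntegral_congr_ae (hg hs) (hf₀.mono fun a ha _ => ha.symm)
  have e : ∀ f : α → ℝ, Measurable f → ∫⁻ a, ENNReal.ofReal (f a) * h (g a) ∂P
      = ∫⁻ b, h b ∂((P.withDensity fun a => ENNReal.ofReal (f a)).map g) := fun f hf => by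
    rw [lintegral_map hh hg]
    exact (lintegral_withDensity_eq_lintegral_mul _ hf.ennreal_ofReal (hh.comp hg)).symm
  rw [e f hfm, e f₀ hf₀m, key]

lemma measurable_uncurry_bool {m : Bool → Cov p → ℝ} (hm : ∀ d, Measurable (m d)) :
    Measurable fun z : Bool × Cov p => m z.1 z.2 :=
  measurable_from_prod_countable_right hm

lemma measurable_riesz {π : Cov p → ℝ} (hπ : Measurable π) (d : Bool) : Measurable (riesz π d) :=
  (measurable_const.div hπ).sub (measurable_const.div (hπ.const_sub 1))

/-- The outcome is a Bernoulli variable given treatment and covariate. -/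
lemma hasBernoulliConditional {Q : Measure (Unit0 p)} [IsProbabilityMeasure Q]
    {m₀ : Bool → Cov p → ℝ} (hm₀ : IsConditionalMean Q m₀) :
    HasBernoulliConditional (obsLaw Q) fun z => m₀ z.1 z.2 := by
  intro G hG
  have hn : Measurable fun o : Obs p => num o.1 := (Measurable.of_discrete (f := num)).comp measurable_fst
  have hmm : Measurable fun o : Obs p => m₀ o.2.1 o.2.2 :=
    (measurable_uncurry_bool hm₀.1).comp measurable_snd
  have hi : Integrable (fun o : Obs p => num o.1) (obsLaw Q) :=
    Integrable.of_bound hn.aestronglyMeasurable 1 (ae_of_all _ fun a => abs_num_le _)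
  have h1 : (fun o : Obs p => 1 - m₀ o.2.1 o.2.2) =ᵐ[obsLaw Q]
      (obsLaw Q)[fun o : Obs p => 1 - num o.1 |
        MeasurableSpace.comap (fun o : Obs p => o.2) inferInstance] := by
    have := condExp_sub (integrable_const (1 : ℝ)) hi
      (MeasurableSpace.comap (fun o : Obs p => o.2) inferInstance)
    rw [condExp_const measurable_snd.comap_le] at this
    filter_upwards [this, hm₀.2] with o h1 h2
    rw [h2]
    exact h1.symm
  have hGt : Measurable fun z : Bool × Cov p => G (true, z) := hG.comp (measurable_const.prodMk measurable_id)
  have hGf : Measurable fun z : Bool × Cov p => G (false, z) := hG.comp (measurable_const.prodMk measurable_id)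
  have e1 := lintegral_mul_comp_eq measurable_snd hn hmm (fun o => num_mem_Icc _) hm₀.2 hGt
  have e2 := lintegral_mul_comp_eq measurable_snd (hn.const_sub 1) (hmm.const_sub 1)
    (fun o => ⟨by linarith [(num_mem_Icc o.1).2], by linarith [(num_mem_Icc o.1).1]⟩) h1 hGf
  refine Eq.trans ?_ (lintegral_add_left
    (hmm.ennreal_ofReal.mul (hGt.comp measurable_snd)) _).symm
  refine Eq.trans ?_ (congrArg₂ (· + ·) e1 e2)
  refine Eq.trans ?_ (lintegral_add_left
    (hn.ennreal_ofReal.mul (hGt.comp measurable_snd)) _)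
  refine lintegral_congr fun o => ?_
  obtain ⟨y, z⟩ := o
  cases y <;> simp [num]

/-- The probability `P₀(D = d | X = x)`. -/
def armProb (π₀ : Cov p → ℝ) (d : Bool) (x : Cov p) : ℝ := if d then π₀ x else 1 - π₀ x

/-- The indicator of `D = d`. -/
def armInd (d d' : Bool) : ℝ := if d then num d' else 1 - num d'

lemma armInd_eq (d d' : Bool) : armInd d d' = if d' = d then 1 else 0 := by
  cases d <;> cases d' <;> simp [armInd, num]

lemma measurable_armProb {π₀ : Cov p → ℝ} (hπ : Measurable π₀) (d : Bool) :
    Measurable (armProb π₀ d) := by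
  cases d
  · exact hπ.const_sub 1
  · exact hπ

lemma armProb_condExp {Q : Measure (Unit0 p)} [IsProbabilityMeasure Q] {π₀ : Cov p → ℝ}
    (hπ₀ : IsPropensityScore Q π₀) (d : Bool) :
    (fun o : Obs p => armProb π₀ d o.2.2) =ᵐ[obsLaw Q]
      (obsLaw Q)[fun o : Obs p => armInd d o.2.1 |
        MeasurableSpace.comap (fun o : Obs p => o.2.2) inferInstance] := by
  have hn : Measurable fun o : Obs p => num o.2.1 := (Measurable.of_discrete (f := num)).comp measurable_snd.fst
  have hi : Integrable (fun o : Obs p => num o.2.1) (obsLaw Q) :=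
    Integrable.of_bound hn.aestronglyMeasurable 1 (ae_of_all _ fun a => abs_num_le _)
  cases d
  · have := condExp_sub (integrable_const (1 : ℝ)) hi
      (MeasurableSpace.comap (fun o : Obs p => o.2.2) inferInstance)
    rw [condExp_const measurable_obsCov.comap_le] at this
    filter_upwards [this, hπ₀.2] with o h1 h2
    simp only [armProb, Bool.false_eq_true, if_false, armInd]
    rw [h2]
    exact h1.symm
  · exact hπ₀.2

lemma measurable_armInd (d : Bool) : Measurable fun o : Obs p => armInd d o.2.1 :=
  (Measurable.of_discrete (f := armInd d)).comp measurable_snd.fst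

lemma abs_armInd_le (d d' : Bool) : |armInd d d'| ≤ 1 := by
  rw [armInd_eq]; split_ifs <;> simp

/-- Under overlap, what holds for the covariates of the units with treatment `d` holds for all. -/
lemma ae_covLaw_of_arm {Q : Measure (Unit0 p)} [IsProbabilityMeasure Q] {π₀ : Cov p → ℝ}
    (hπ₀ : IsPropensityScore Q π₀) (d : Bool) {c : ℝ} (hc : 0 < c)
    (hov : ∀ x ∈ (covLaw Q).support, c < armProb π₀ d x) {s : Set (Cov p)} (hs : MeasurableSet s)
    (h : ∀ᵐ o ∂(obsLaw Q), o.2.1 = d → o.2.2 ∈ s) : ∀ᵐ x ∂(covLaw Q), x ∈ s := by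
  have hind : Measurable (sᶜ.indicator fun _ : Cov p => (1 : ℝ)) := measurable_const.indicator hs.compl
  have hb : ∀ x, |sᶜ.indicator (fun _ : Cov p => (1 : ℝ)) x| ≤ 1 := fun x => by
    by_cases hx : x ∈ sᶜ <;> simp [hx]
  have h1 := integral_mul_comp_eq measurable_obsCov
    (Integrable.of_bound (measurable_armInd d).aestronglyMeasurable 1
      (ae_of_all _ fun o => abs_armInd_le _ _))
    (armProb_condExp hπ₀ d) hind
    (Integrable.of_bound ((measurable_armInd d).mul (hind.comp measurable_obsCov)).aestronglyMeasurable
      1 (ae_of_all _ fun o => by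
        simp only [Real.norm_eq_abs, abs_mul]
        exact mul_le_one₀ (abs_armInd_le _ _) (abs_nonneg _) (hb _)))
  have h2 : ∫ o : Obs p, armInd d o.2.1 * sᶜ.indicator (fun _ => (1 : ℝ)) o.2.2 ∂(obsLaw Q) = 0 := by
    refine integral_eq_zero_of_ae ?_
    filter_upwards [h] with o ho
    rw [armInd_eq]
    by_cases h : o.2.1 = d
    · simp [ho h]
    · simp [h]
  have h4 := integral_covLaw Q ((measurable_armProb hπ₀.1 d).mul hind)
  simp only [Pi.mul_apply] at h4
  rw [h2, ← h4] at h1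
  have hi01 : ∀ᵐ x ∂(covLaw Q), armProb π₀ d x ∈ Set.Icc (0 : ℝ) 1 := by
    rw [← map_obsLaw_covariate, ae_map_iff measurable_obsCov.aemeasurable
      (measurable_armProb hπ₀.1 d measurableSet_Icc)]
    refine ae_mem_Icc_of_condExp measurable_obsCov (measurable_armInd d) (fun o => ?_)
      (armProb_condExp hπ₀ d)
    rw [armInd_eq]; split_ifs <;> simp
  have h3 : 0 ≤ᵐ[covLaw Q] fun x => armProb π₀ d x * sᶜ.indicator (fun _ => (1 : ℝ)) x := by
    filter_upwards [hi01] with x hx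
    exact mul_nonneg hx.1 (Set.indicator_nonneg (fun _ _ => zero_le_one) _)
  rw [eq_comm, integral_eq_zero_iff_of_nonneg_ae h3] at h1
  · filter_upwards [h1, ae_mem_support Q] with x hx hsup
    by_contra hxs
    simp only [Set.mem_compl_iff, hxs, not_false_eq_true, Set.indicator_of_mem, mul_one,
      Pi.zero_apply] at hx
    linarith [hov x hsup]
  · refine Integrable.of_bound ((measurable_armProb hπ₀.1 d).mul hind).aestronglyMeasurable 1 ?_
    filter_upwards [hi01] with x hx
    rw [Real.norm_eq_abs, abs_mul, abs_of_nonneg hx.1]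
    exact mul_le_one₀ hx.2 (abs_nonneg _) (hb _)

lemma lt_armProb {π₀ : Cov p → ℝ} {c : ℝ} {x : Cov p} (h : c < π₀ x ∧ π₀ x < 1 - c) (d : Bool) :
    c < armProb π₀ d x := by
  cases d
  · simp only [armProb, Bool.false_eq_true, if_false]; linarith [h.2]
  · exact h.1

/-- The regression function takes values in `[0, 1]`, at almost every covariate. -/
lemma ae_condMean_mem_Icc {Q : Measure (Unit0 p)} [IsProbabilityMeasure Q] {π₀ : Cov p → ℝ}
    (hπ₀ : IsPropensityScore Q π₀) {m₀ : Bool → Cov p → ℝ} (hm₀ : IsConditionalMean Q m₀)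
    {c : ℝ} (hc : 0 < c) (hov : ∀ x ∈ (covLaw Q).support, c < π₀ x ∧ π₀ x < 1 - c) :
    ∀ᵐ x ∂(covLaw Q), ∀ d, m₀ d x ∈ Set.Icc (0 : ℝ) 1 := by
  rw [ae_all_iff]
  intro d
  refine ae_covLaw_of_arm hπ₀ d hc (fun x hx => lt_armProb (hov x hx) d)
    (hm₀.1 d measurableSet_Icc) ?_
  have := ae_mem_Icc_of_condExp (P := obsLaw Q) measurable_snd
    ((Measurable.of_discrete (f := num)).comp measurable_fst) (fun o => num_mem_Icc _) hm₀.2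
  filter_upwards [this] with o ho hd
  rw [← hd]
  exact ho

lemma abs_riesz_le {π : Cov p → ℝ} {c : ℝ} {x : Cov p} (hc : 0 < c)
    (h : c < π x ∧ π x < 1 - c) (d : Bool) : |riesz π d x| ≤ 1 / c := by
  have h1 : 0 < π x := by linarith
  have h2 : 0 < 1 - π x := by linarith
  cases d
  · simp only [riesz, num, Bool.false_eq_true, if_false, zero_div, sub_zero, zero_sub, abs_neg]
    rw [abs_of_pos (by positivity)]
    exact one_div_le_one_div_of_le hc (by linarith)
  · simp only [riesz, num, if_true, sub_self, zero_div, sub_zero]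
    rw [abs_of_pos (by positivity)]
    exact one_div_le_one_div_of_le hc h.1.le

/-- The conditional probability of treatment `d`, on the space of units. -/
lemma armProb_condExp_unit {Q : Measure (Unit0 p)} [IsProbabilityMeasure Q] {π₀ : Cov p → ℝ}
    (hπ₀ : IsPropensityScore Q π₀) (d : Bool) :
    (fun z => armProb π₀ d (covariate z)) =ᵐ[Q]
      Q[fun z : Unit0 p => armInd d z.2.1 |
        MeasurableSpace.comap (covariate (p := p)) inferInstance] := by
  have hqm := measurable_armProb hπ₀.1 d
  have hVm := measurable_armInd (p := p) d
  have hVi : Integrable (fun o : Obs p => armInd d o.2.1) (obsLaw Q) :=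
    Integrable.of_bound hVm.aestronglyMeasurable 1 (ae_of_all _ fun z => abs_armInd_le _ _)
  have hqi : Integrable (fun o : Obs p => armProb π₀ d o.2.2) (obsLaw Q) :=
    integrable_condExp.congr (armProb_condExp hπ₀ d).symm
  refine ae_eq_condExp_of_forall_setIntegral_eq measurable_covariate.comap_le
    (hVi.comp_measurable measurable_observe) (fun s _ _ =>
      (hqi.comp_measurable measurable_observe).integrableOn) ?_
    ((hqm.comp (comap_measurable _)).stronglyMeasurable.aestronglyMeasurable)
  rintro s ⟨t, ht, rfl⟩ -
  have h1 : ∫ o in (fun o : Obs p => o.2.2) ⁻¹' t, armProb π₀ d o.2.2 ∂(obsLaw Q)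
      = ∫ o in (fun o : Obs p => o.2.2) ⁻¹' t, armInd d o.2.1 ∂(obsLaw Q) := by
    rw [← setIntegral_condExp measurable_obsCov.comap_le hVi ⟨t, ht, rfl⟩]
    exact setIntegral_congr_ae (measurable_obsCov ht)
      ((armProb_condExp hπ₀ d).mono fun a ha _ => ha)
  rw [obsLaw, setIntegral_map (measurable_obsCov ht)
      (f := fun o : Obs p => armProb π₀ d o.2.2)
      (hqm.comp measurable_obsCov).aestronglyMeasurable measurable_observe.aemeasurable,
    setIntegral_map (measurable_obsCov ht) hVm.aestronglyMeasurable
      measurable_observe.aemeasurable] at h1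
  exact h1

/-- Given the covariate, the outcome of the units with treatment `d` has the law of the potential
outcome `Y(d)`; hence the mean of `Y(d)` is identified. -/
lemma integral_potential_outcome {Q : Measure (Unit0 p)} [IsProbabilityMeasure Q] {π₀ : Cov p → ℝ}
    (hπ₀ : IsPropensityScore Q π₀) {m₀ : Bool → Cov p → ℝ} (hm₀ : IsConditionalMean Q m₀)
    (hunconf : Unconfounded Q) {c : ℝ} (hc : 0 < c)
    (hov : ∀ x ∈ (covLaw Q).support, c < π₀ x ∧ π₀ x < 1 - c) (d : Bool) :
    ∫ z, num (if d then z.1.2 else z.1.1) ∂Q = ∫ x, m₀ d x ∂(covLaw Q) := by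
  set q : Cov p → ℝ := armProb π₀ d with hq
  have hqm : Measurable q := measurable_armProb hπ₀.1 d
  have hsup : ∀ᵐ o ∂(obsLaw Q), c < q o.2.2 :=
    ae_obsLaw_of_ae_covLaw ((ae_mem_support Q).mono fun x hx => lt_armProb (hov x hx) d)
  have hsupQ : ∀ᵐ z ∂Q, c < q (covariate z) :=
    ae_of_ae_map measurable_observe.aemeasurable hsup
  have hinv : ∀ {x}, c < q x → |(q x)⁻¹| ≤ c⁻¹ := fun {x} hx => by
    rw [abs_of_pos (inv_pos.2 (hc.trans hx))]
    exact inv_anti₀ hc hx.le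
  let U : Unit0 p → ℝ := fun z => num (if d then z.1.2 else z.1.1)
  let V : Unit0 p → ℝ := fun z => armInd d z.2.1
  have hUm : Measurable U := (Measurable.of_discrete
    (f := fun y : Bool × Bool => num (if d then y.2 else y.1))).comp measurable_fst
  have hVm : Measurable V := (Measurable.of_discrete (f := armInd d)).comp measurable_snd.fst
  have hUb : ∀ z, |U z| ≤ 1 := fun z => abs_num_le _
  have hVb : ∀ z, |V z| ≤ 1 := fun z => abs_armInd_le _ _
  have hUVb : ∀ z, |U z * V z| ≤ 1 := fun z => by
    rw [abs_mul]; exact mul_le_one₀ (hUb z) (abs_nonneg _) (hVb z)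
  have hUi : Integrable U Q := Integrable.of_bound hUm.aestronglyMeasurable 1 (ae_of_all _ hUb)
  have hUVi : Integrable (fun z => U z * V z) Q :=
    Integrable.of_bound (hUm.mul hVm).aestronglyMeasurable 1 (ae_of_all _ hUVb)
  have hprod : Q[fun z => U z * V z | MeasurableSpace.comap (covariate (p := p)) inferInstance]
      =ᵐ[Q] fun z => (Q[U | MeasurableSpace.comap (covariate (p := p)) inferInstance]) z
        * (Q[V | MeasurableSpace.comap (covariate (p := p)) inferInstance]) z := by
    have h := (condIndepFun_iff_condExp_inter_preimage_eq_mul measurable_fst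
      measurable_snd.fst).1 hunconf {y | (if d then y.2 else y.1) = true} {d}
      (MeasurableSet.of_discrete) (MeasurableSet.of_discrete)
    have e1 : ((fun z : Unit0 p => z.1) ⁻¹' {y | (if d then y.2 else y.1) = true}).indicator
        (fun _ => (1 : ℝ)) = U := by
      ext z
      by_cases hz : (if d then z.1.2 else z.1.1) = true <;> simp [U, num, Set.indicator]
    have e2 : ((fun z : Unit0 p => z.2.1) ⁻¹' {d}).indicator (fun _ => (1 : ℝ)) = V := by
      ext z
      simp [V, armInd_eq, Set.indicator]
    have e3 : ((fun z : Unit0 p => z.1) ⁻¹' {y | (if d then y.2 else y.1) = true} ∩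
        (fun z : Unit0 p => z.2.1) ⁻¹' {d}).indicator (fun _ => (1 : ℝ))
        = fun z => U z * V z := by
      rw [← e1, ← e2]
      exact Set.inter_indicator_one
    rwa [e1, e2, e3] at h
  have hV := armProb_condExp_unit hπ₀ d
  have h1 : ∫ z, U z ∂Q = ∫ z, (U z * V z) * (q (covariate z))⁻¹ ∂Q := by
    rw [integral_mul_comp_eq measurable_covariate hUVi EventuallyEq.rfl (h := fun x => (q x)⁻¹)
      hqm.inv, ← integral_condExp (f := U) measurable_covariate.comap_le]
    · refine integral_congr_ae ?_
      filter_upwards [hprod, hV, hsupQ] with z h1 h2 h3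
      rw [h1, ← h2, mul_assoc, mul_inv_cancel₀ (hc.trans h3).ne', mul_one]
    · refine Integrable.of_bound
        ((hUm.mul hVm).mul (hqm.comp measurable_covariate).inv).aestronglyMeasurable (1 * c⁻¹) ?_
      filter_upwards [hsupQ] with z hz
      rw [Real.norm_eq_abs, abs_mul]
      exact mul_le_mul (hUVb z) (hinv hz) (abs_nonneg _) zero_le_one
  let h : Bool × Cov p → ℝ := fun z => armInd d z.1 * (q z.2)⁻¹
  have hhm : Measurable h := ((Measurable.of_discrete (f := armInd d)).comp measurable_fst).mul
    (hqm.comp measurable_snd).inv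
  have hn : Measurable fun o : Obs p => num o.1 :=
    (Measurable.of_discrete (f := num)).comp measurable_fst
  have h2 : ∫ z, (U z * V z) * (q (covariate z))⁻¹ ∂Q
      = ∫ o, num o.1 * h o.2 ∂(obsLaw Q) := by
    rw [obsLaw, integral_map measurable_observe.aemeasurable
      (f := fun o : Obs p => num o.1 * h o.2) (hn.mul (hhm.comp measurable_snd)).aestronglyMeasurable]
    refine integral_congr_ae (ae_of_all _ fun z => ?_)
    obtain ⟨⟨y0, y1⟩, d', x⟩ := z
    simp only [U, V, h, observe, covariate, armInd_eq, mul_assoc]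
    by_cases hd : d' = d
    · rw [hd]
    · simp [hd]
  have hm01 := ae_condMean_mem_Icc hπ₀ hm₀ hc hov
  have hmi : Integrable (fun o : Obs p => armInd d o.2.1 * (m₀ d o.2.2 * (q o.2.2)⁻¹))
      (obsLaw Q) := by
    refine Integrable.of_bound ((measurable_armInd d).mul (((hm₀.1 d).comp measurable_obsCov).mul
      (hqm.comp measurable_obsCov).inv)).aestronglyMeasurable (1 * (1 * c⁻¹)) ?_
    filter_upwards [ae_obsLaw_of_ae_covLaw hm01, hsup] with o h1 h2
    rw [Real.norm_eq_abs, abs_mul, abs_mul]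
    refine mul_le_mul (abs_armInd_le _ _) (mul_le_mul ?_ (hinv h2) (abs_nonneg _) zero_le_one)
      (by positivity) zero_le_one
    rw [abs_of_nonneg (h1 d).1]
    exact (h1 d).2
  calc ∫ z, U z ∂Q = ∫ o, num o.1 * h o.2 ∂(obsLaw Q) := h1.trans h2
    _ = ∫ o, m₀ o.2.1 o.2.2 * h o.2 ∂(obsLaw Q) := by
        refine integral_mul_comp_eq measurable_snd
          (Integrable.of_bound hn.aestronglyMeasurable 1 (ae_of_all _ fun a => abs_num_le _))
          hm₀.2 hhm ?_
        refine Integrable.of_bound (hn.mul (hhm.comp measurable_snd)).aestronglyMeasurable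
          (1 * (1 * c⁻¹)) ?_
        filter_upwards [hsup] with o h2
        rw [Real.norm_eq_abs, abs_mul, abs_mul]
        exact mul_le_mul (abs_num_le _) (mul_le_mul (abs_armInd_le _ _) (hinv h2) (abs_nonneg _)
          zero_le_one) (by positivity) zero_le_one
    _ = ∫ o, armInd d o.2.1 * (m₀ d o.2.2 * (q o.2.2)⁻¹) ∂(obsLaw Q) := by
        refine integral_congr_ae (ae_of_all _ fun o => ?_)
        simp only [h, armInd_eq]
        by_cases hd : o.2.1 = d
        · simp only [hd]; ring
        · simp [hd]
    _ = ∫ o, q o.2.2 * (m₀ d o.2.2 * (q o.2.2)⁻¹) ∂(obsLaw Q) :=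
        integral_mul_comp_eq measurable_obsCov
          (Integrable.of_bound (measurable_armInd d).aestronglyMeasurable 1
            (ae_of_all _ fun o => abs_armInd_le _ _))
          (armProb_condExp hπ₀ d) ((hm₀.1 d).mul hqm.inv) hmi
    _ = ∫ o, m₀ d o.2.2 ∂(obsLaw Q) := by
        refine integral_congr_ae ?_
        filter_upwards [hsup] with o ho
        have := (hc.trans ho).ne'
        field_simp
    _ = _ := (integral_covLaw Q (hm₀.1 d)).symm

lemma ate_eq {Q : Measure (Unit0 p)} [IsProbabilityMeasure Q] {π₀ : Cov p → ℝ}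
    (hπ₀ : IsPropensityScore Q π₀) {m₀ : Bool → Cov p → ℝ} (hm₀ : IsConditionalMean Q m₀)
    (hunconf : Unconfounded Q) {c : ℝ} (hc : 0 < c)
    (hov : ∀ x ∈ (covLaw Q).support, c < π₀ x ∧ π₀ x < 1 - c) :
    ate Q = ∫ x, bar m₀ x ∂(covLaw Q) := by
  have hi : ∀ f : Bool × Bool → Bool, Integrable (fun z : Unit0 p => num (f z.1)) Q := fun f =>
    Integrable.of_bound ((Measurable.of_discrete (f := fun y => num (f y))).comp
      measurable_fst).aestronglyMeasurable 1 (ae_of_all _ fun a => abs_num_le _)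
  have hm : ∀ d, Integrable (m₀ d) (covLaw Q) := fun d =>
    Integrable.of_bound (hm₀.1 d).aestronglyMeasurable 1
      ((ae_condMean_mem_Icc hπ₀ hm₀ hc hov).mono fun x hx => by
        rw [Real.norm_eq_abs, abs_of_nonneg (hx d).1]; exact (hx d).2)
  simp only [ate, bar]
  rw [integral_sub (hi fun y => y.2) (hi fun y => y.1), integral_sub (hm _) (hm _),
    ← integral_potential_outcome hπ₀ hm₀ hunconf hc hov true,
    ← integral_potential_outcome hπ₀ hm₀ hunconf hc hov false]
  simp

/-- Residuals have mean zero given treatment and covariate. -/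
lemma integral_mul_residual {Q : Measure (Unit0 p)} [IsProbabilityMeasure Q]
    {m₀ : Bool → Cov p → ℝ} (hm₀ : IsConditionalMean Q m₀) {h : Bool × Cov p → ℝ}
    (hh : Measurable h) (hi : Integrable (fun o => h o.2) (obsLaw Q)) :
    ∫ o, h o.2 * (num o.1 - m₀ o.2.1 o.2.2) ∂(obsLaw Q) = 0 := by
  have hn : Measurable fun o : Obs p => num o.1 :=
    (Measurable.of_discrete (f := num)).comp measurable_fst
  have hm01 := ae_mem_Icc_of_condExp (P := obsLaw Q) measurable_snd hn
    (fun o => num_mem_Icc _) hm₀.2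
  have hmm : Measurable fun o : Obs p => m₀ o.2.1 o.2.2 :=
    (measurable_uncurry_bool hm₀.1).comp measurable_snd
  have hi1 : Integrable (fun o : Obs p => num o.1 * h o.2) (obsLaw Q) :=
    hi.bdd_mul hn.aestronglyMeasurable (c := 1) (ae_of_all _ fun o => abs_num_le _)
  have hi2 : Integrable (fun o : Obs p => m₀ o.2.1 o.2.2 * h o.2) (obsLaw Q) :=
    hi.bdd_mul hmm.aestronglyMeasurable (c := 1) (hm01.mono fun o ho => by
      rw [Real.norm_eq_abs, abs_of_nonneg ho.1]; exact ho.2)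
  have h1 := integral_mul_comp_eq measurable_snd
    (Integrable.of_bound hn.aestronglyMeasurable 1 (ae_of_all _ fun a => abs_num_le _))
    hm₀.2 hh hi1
  rw [show (fun o : Obs p => h o.2 * (num o.1 - m₀ o.2.1 o.2.2))
    = fun o => num o.1 * h o.2 - m₀ o.2.1 o.2.2 * h o.2 by ext o; ring,
    integral_sub hi1 hi2, h1, sub_self]

/-- The conditional variance of the outcome, as a function of the observation. -/
def outcomeVar (m₀ : Bool → Cov p → ℝ) (o : Obs p) : ℝ :=
  m₀ o.2.1 o.2.2 * (1 - m₀ o.2.1 o.2.2)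

lemma integral_mul_residual_sq {Q : Measure (Unit0 p)} [IsProbabilityMeasure Q]
    {m₀ : Bool → Cov p → ℝ} (hm₀ : IsConditionalMean Q m₀) {h : Bool × Cov p → ℝ}
    (hh : Measurable h) (hi : Integrable (fun o => h o.2) (obsLaw Q)) :
    ∫ o, h o.2 * (num o.1 - m₀ o.2.1 o.2.2) ^ 2 ∂(obsLaw Q)
      = ∫ o, h o.2 * outcomeVar m₀ o ∂(obsLaw Q) := by
  have hn : Measurable fun o : Obs p => num o.1 :=
    (Measurable.of_discrete (f := num)).comp measurable_fst
  have hm01 := ae_mem_Icc_of_condExp (P := obsLaw Q) measurable_snd hn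
    (fun o => num_mem_Icc _) hm₀.2
  have hmm := measurable_uncurry_bool hm₀.1
  have hmm' : Measurable fun o : Obs p => m₀ o.2.1 o.2.2 := hmm.comp measurable_snd
  have hi1 : Integrable (fun o : Obs p => h o.2 * (1 - 2 * m₀ o.2.1 o.2.2)) (obsLaw Q) :=
    hi.mul_bdd (c := 1) ((hmm'.const_mul 2).const_sub 1).aestronglyMeasurable
      (hm01.mono fun o ho => by
        rw [Real.norm_eq_abs, abs_le]; constructor <;> linarith [ho.1, ho.2])
  have hz := integral_mul_residual hm₀ (h := fun z => h z * (1 - 2 * m₀ z.1 z.2))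
    (hh.mul ((hmm.const_mul 2).const_sub 1)) hi1
  have hi2 : Integrable (fun o : Obs p =>
      h o.2 * (1 - 2 * m₀ o.2.1 o.2.2) * (num o.1 - m₀ o.2.1 o.2.2)) (obsLaw Q) :=
    hi1.mul_bdd (c := 1) (hn.sub hmm').aestronglyMeasurable (hm01.mono fun o ho => by
      rw [Real.norm_eq_abs, abs_le]
      constructor <;> linarith [ho.1, ho.2, (num_mem_Icc o.1).1, (num_mem_Icc o.1).2])
  have hi3 : Integrable (fun o : Obs p => h o.2 * outcomeVar m₀ o) (obsLaw Q) :=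
    hi.mul_bdd (c := 1) (hmm'.mul (hmm'.const_sub 1)).aestronglyMeasurable
      (hm01.mono fun o ho => by
        rw [Real.norm_eq_abs, outcomeVar, abs_le]; constructor <;> nlinarith [ho.1, ho.2])
  rw [← add_zero (∫ o, h o.2 * outcomeVar m₀ o ∂(obsLaw Q)), ← hz, ← integral_add hi3 hi2]
  refine integral_congr_ae (ae_of_all _ fun o => ?_)
  have := num_sq o.1
  simp only [outcomeVar]
  linear_combination (h o.2) * this

/-- The efficiency bound splits into the parts due to the outcome and to the covariate. -/
lemma effBound_eq {Q : Measure (Unit0 p)} [IsProbabilityMeasure Q] {π₀ : Cov p → ℝ}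
    (hπ₀ : IsPropensityScore Q π₀) {m₀ : Bool → Cov p → ℝ} (hm₀ : IsConditionalMean Q m₀)
    (hunconf : Unconfounded Q) {c : ℝ} (hc : 0 < c)
    (hov : ∀ x ∈ (covLaw Q).support, c < π₀ x ∧ π₀ x < 1 - c) :
    effBound Q π₀ m₀ = (∫ o, riesz π₀ o.2.1 o.2.2 ^ 2 * outcomeVar m₀ o ∂(obsLaw Q)).toNNReal
      + (∫ o, bar m₀ o.2.2 ^ 2 ∂(obsLaw Q) - (∫ o, bar m₀ o.2.2 ∂(obsLaw Q)) ^ 2).toNNReal := by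
  have hate := ate_eq hπ₀ hm₀ hunconf hc hov
  have hbm : Measurable (bar m₀) := (hm₀.1 true).sub (hm₀.1 false)
  rw [integral_covLaw Q hbm] at hate
  have hm01 := ae_obsLaw_of_ae_covLaw (ae_condMean_mem_Icc hπ₀ hm₀ hc hov)
  have hbb : ∀ᵐ o ∂(obsLaw Q), |bar m₀ o.2.2| ≤ 1 := hm01.mono fun o ho => by
    rw [bar, abs_le]
    constructor <;> linarith [(ho true).1, (ho true).2, (ho false).1, (ho false).2]
  have hbi : Integrable (fun o : Obs p => bar m₀ o.2.2) (obsLaw Q) :=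
    Integrable.of_bound (hbm.comp measurable_obsCov).aestronglyMeasurable 1 hbb
  have hbi2 : Integrable (fun o : Obs p => bar m₀ o.2.2 ^ 2) (obsLaw Q) :=
    Integrable.of_bound ((hbm.comp measurable_obsCov).pow_const 2).aestronglyMeasurable 1
      (hbb.mono fun o ho => by rw [Real.norm_eq_abs, abs_pow]; exact pow_le_one₀ (abs_nonneg _) ho)
  set χ := ate Q
  have hrm : Measurable fun z : Bool × Cov p => riesz π₀ z.1 z.2 :=
    measurable_uncurry_bool (measurable_riesz hπ₀.1)
  have hrb : ∀ᵐ o ∂(obsLaw Q), |riesz π₀ o.2.1 o.2.2| ≤ 1 / c :=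
    (ae_obsLaw_of_ae_covLaw ((ae_mem_support Q).mono fun x hx d => abs_riesz_le hc (hov x hx) d)).mono
      fun o ho => ho o.2.1
  have hri2 : Integrable (fun o : Obs p => riesz π₀ o.2.1 o.2.2 ^ 2) (obsLaw Q) :=
    Integrable.of_bound ((hrm.comp measurable_snd).pow_const 2).aestronglyMeasurable ((1 / c) ^ 2)
      (hrb.mono fun o ho => by
        rw [Real.norm_eq_abs, abs_pow]; exact pow_le_pow_left₀ (abs_nonneg _) ho 2)
  have hxi : Integrable (fun o : Obs p => 2 * (bar m₀ o.2.2 - χ) * riesz π₀ o.2.1 o.2.2)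
      (obsLaw Q) :=
    ((hbi.sub (integrable_const χ)).const_mul 2).mul_bdd (c := 1 / c)
      (hrm.comp measurable_snd).aestronglyMeasurable hrb
  have hres : ∀ᵐ o ∂(obsLaw Q), |num o.1 - m₀ o.2.1 o.2.2| ≤ 1 := hm01.mono fun o ho => by
    rw [abs_le]
    constructor <;> linarith [(ho o.2.1).1, (ho o.2.1).2, (num_mem_Icc o.1).1, (num_mem_Icc o.1).2]
  have hresm : Measurable fun o : Obs p => num o.1 - m₀ o.2.1 o.2.2 :=
    ((Measurable.of_discrete (f := num)).comp measurable_fst).sub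
      ((measurable_uncurry_bool hm₀.1).comp measurable_snd)
  have i1 : Integrable (fun o : Obs p => (bar m₀ o.2.2 - χ) ^ 2) (obsLaw Q) := by
    have := (hbi2.sub (hbi.const_mul (2 * χ))).add (integrable_const (χ ^ 2))
    refine this.congr (ae_of_all _ fun o => ?_)
    simp only [Pi.add_apply, Pi.sub_apply]
    ring
  have i2 : Integrable (fun o : Obs p =>
      riesz π₀ o.2.1 o.2.2 ^ 2 * (num o.1 - m₀ o.2.1 o.2.2) ^ 2) (obsLaw Q) :=
    hri2.mul_bdd (c := 1) (hresm.pow_const 2).aestronglyMeasurable (hres.mono fun o ho => by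
      rw [Real.norm_eq_abs, abs_pow]; exact pow_le_one₀ (abs_nonneg _) ho)
  have i3 := hxi.mul_bdd (c := 1) hresm.aestronglyMeasurable hres
  have e1 : ∫ o, (eif Q π₀ m₀ o) ^ 2 ∂(obsLaw Q)
      = ∫ o, (bar m₀ o.2.2 - χ) ^ 2 ∂(obsLaw Q)
        + ∫ o, riesz π₀ o.2.1 o.2.2 ^ 2 * outcomeVar m₀ o ∂(obsLaw Q) := by
    rw [← integral_mul_residual_sq hm₀ (hrm.pow_const 2) hri2,
      ← add_zero (_ + _), ← integral_mul_residual hm₀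
        (h := fun z => 2 * (bar m₀ z.2 - χ) * riesz π₀ z.1 z.2)
        ((((hbm.comp measurable_snd).sub_const χ).const_mul 2).mul hrm) hxi,
      ← integral_add i1 i2, ← integral_add (f := fun o : Obs p => (bar m₀ o.2.2 - χ) ^ 2
        + riesz π₀ o.2.1 o.2.2 ^ 2 * (num o.1 - m₀ o.2.1 o.2.2) ^ 2) (i1.add i2) i3]
    refine integral_congr_ae (ae_of_all _ fun o => ?_)
    simp only [eif]
    ring
  have e2 : ∫ o, (bar m₀ o.2.2 - χ) ^ 2 ∂(obsLaw Q)
      = ∫ o, bar m₀ o.2.2 ^ 2 ∂(obsLaw Q) - χ ^ 2 := by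
    have h1 : ∫ o, (bar m₀ o.2.2 - χ) ^ 2 ∂(obsLaw Q)
        = ∫ o, (bar m₀ o.2.2 ^ 2 - 2 * χ * bar m₀ o.2.2 + χ ^ 2) ∂(obsLaw Q) :=
      integral_congr_ae (ae_of_all _ fun o => by ring)
    rw [h1, integral_add (f := fun o : Obs p => bar m₀ o.2.2 ^ 2 - 2 * χ * bar m₀ o.2.2)
        (hbi2.sub (hbi.const_mul _)) (integrable_const _),
      integral_sub hbi2 (hbi.const_mul _), integral_const_mul, ← hate]
    simp
    ring
  rw [effBound, e1, add_comm, ← hate, ← e2, Real.toNNReal_add]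
  · refine integral_nonneg_of_ae (hm01.mono fun o ho => ?_)
    exact mul_nonneg (sq_nonneg _) (mul_nonneg (ho _).1 (by linarith [(ho o.2.1).2]))
  · exact integral_nonneg fun o => sq_nonneg _

end

/-! ### Decomposition of the parameter, for given data -/

section Deterministic

variable {p n : ℕ}

/-- The part of the parameter that comes from the product of the errors of the estimated Riesz
representor and of the regression function. -/
def nuisance (γ γ₀ η : Bool → Cov p → ℝ) (o : Fin n → Obs p) : ℝ :=
  √(n : ℝ) * empMean o fun z =>
    (γ z.2.1 z.2.2 - γ₀ z.2.1 z.2.2) * (num z.1 - condMean η z.2.1 z.2.2)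

/-- The distance between a regression function and `m₀` at the covariate `x`, summed over the two
treatments. -/
def regDist (η m₀ : Bool → Cov p → ℝ) (x : Cov p) : ℝ :=
  |condMean η true x - m₀ true x| + |condMean η false x - m₀ false x|

lemma regDist_nonneg (η m₀ : Bool → Cov p → ℝ) (x : Cov p) : 0 ≤ regDist η m₀ x := by
  unfold regDist; positivity

lemma abs_condMean_sub_le_regDist (η m₀ : Bool → Cov p → ℝ) (d : Bool) (x : Cov p) :
    |condMean η d x - m₀ d x| ≤ regDist η m₀ x := by
  unfold regDist
  cases d
  · linarith [abs_nonneg (condMean η true x - m₀ true x)]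
  · linarith [abs_nonneg (condMean η false x - m₀ false x)]

lemma regDist_le_two {η m₀ : Bool → Cov p → ℝ} {x : Cov p}
    (h : ∀ d, m₀ d x ∈ Set.Icc (0 : ℝ) 1) : regDist η m₀ x ≤ 2 := by
  have key : ∀ d, |condMean η d x - m₀ d x| ≤ 1 := fun d => by
    have h1 := condMean_mem_Icc η d x
    rw [abs_le]
    constructor <;> linarith [h1.1, h1.2, (h d).1, (h d).2]
  unfold regDist
  linarith [key true, key false]

lemma sq_bar_sub_le {η m₀ : Bool → Cov p → ℝ} {x : Cov p}
    (h : ∀ d, m₀ d x ∈ Set.Icc (0 : ℝ) 1) :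
    (bar (condMean η) x - bar m₀ x) ^ 2 ≤ 2 * regDist η m₀ x := by
  have h1 : |bar (condMean η) x - bar m₀ x| ≤ regDist η m₀ x := by
    rw [show bar (condMean η) x - bar m₀ x = (condMean η true x - m₀ true x)
      - (condMean η false x - m₀ false x) by simp only [bar]; ring]
    exact abs_sub _ _
  have h2 := regDist_le_two (η := η) h
  have h3 := regDist_nonneg η m₀ x
  rw [← sq_abs]
  nlinarith [abs_nonneg (bar (condMean η) x - bar m₀ x)]

lemma empMean_add (o : Fin n → Obs p) (f g : Obs p → ℝ) :
    empMean o (fun z => f z + g z) = empMean o f + empMean o g := by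
  simp only [empMean, Finset.sum_add_distrib, add_div]

lemma empMean_sub (o : Fin n → Obs p) (f g : Obs p → ℝ) :
    empMean o (fun z => f z - g z) = empMean o f - empMean o g := by
  simp only [empMean, Finset.sum_sub_distrib, sub_div]

lemma empMean_const (hn : 0 < n) (o : Fin n → Obs p) (c : ℝ) : empMean o (fun _ => c) = c := by
  have : (n : ℝ) ≠ 0 := by positivity
  simp [empMean, this]

lemma empMean_const_mul (o : Fin n → Obs p) (c : ℝ) (f : Obs p → ℝ) :
    empMean o (fun z => c * f z) = c * empMean o f := by
  simp only [empMean, ← Finset.mul_sum, mul_div_assoc]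

lemma empMean_mono {o : Fin n → Obs p} {f g : Obs p → ℝ} (h : ∀ i, f (o i) ≤ g (o i)) :
    empMean o f ≤ empMean o g := by
  unfold empMean
  gcongr with i
  exact h i

lemma abs_empMean_le (o : Fin n → Obs p) (f : Obs p → ℝ) :
    |empMean o f| ≤ empMean o fun z => |f z| := by
  unfold empMean
  rw [abs_div, Nat.abs_cast]
  gcongr
  exact Finset.abs_sum_le_sum_abs _ _

lemma empMean_nonneg {o : Fin n → Obs p} {f : Obs p → ℝ} (h : ∀ i, 0 ≤ f (o i)) :
    0 ≤ empMean o f := div_nonneg (Finset.sum_nonneg fun i _ => h i) (Nat.cast_nonneg _)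

lemma score_eq (γ η : Bool → Cov p → ℝ) (o : Fin n → Obs p) :
    score γ η o = -(√(n : ℝ) * empMean o fun z =>
      γ z.2.1 z.2.2 * (num z.1 - condMean η z.2.1 z.2.2)) := by
  rcases Nat.eq_zero_or_pos n with rfl | hn
  · simp [score]
  have h : (0 : ℝ) < √(n : ℝ) := by positivity
  have hs : √(n : ℝ) * √(n : ℝ) = n := Real.mul_self_sqrt (Nat.cast_nonneg _)
  simp only [score, empMean]
  rw [show (∑ i, γ (o i).2.1 (o i).2.2 * (condMean η (o i).2.1 (o i).2.2 - num (o i).1))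
    = -∑ i, γ (o i).2.1 (o i).2.2 * (num (o i).1 - condMean η (o i).2.1 (o i).2.2) by
      rw [← Finset.sum_neg_distrib]; exact Finset.sum_congr rfl fun i _ => by ring]
  rw [neg_div]
  congr 1
  rw [mul_div_assoc', div_eq_div_iff h.ne' (by positivity : (n : ℝ) ≠ 0), mul_right_comm, hs, mul_comm]

/-- The debiased and centred parameter is the sum of the score, the Bayesian bootstrap of the
contrast `m̄₀`, and remainders. -/
lemma sqrt_mul_ateFunctional_sub (hn : 0 < n) (Q : Measure (Unit0 p)) (γ : Bool → Cov p → ℝ)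
    (π₀ : Cov p → ℝ) (m₀ η : Bool → Cov p → ℝ) (χ : ℝ) (o : Fin n → Obs p) (M : Fin n → ℝ) :
    √(n : ℝ) * (ateFunctional M η o - χ - bias π₀ m₀ η o)
      = score γ η o + bootMean (fun i => bar m₀ (o i).2.2) M
        + (bootMean (fun i => bar (condMean η) (o i).2.2 - bar m₀ (o i).2.2) M
          + nuisance γ (riesz π₀) η o - √(n : ℝ) * (χ - ate Q - empMean o (eif Q π₀ m₀))) := by
  have e1 : empMean o (eif Q π₀ m₀) = empMean o (fun z => bar m₀ z.2.2)
      + empMean o (fun z => riesz π₀ z.2.1 z.2.2 * num z.1)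
      - empMean o (fun z => riesz π₀ z.2.1 z.2.2 * m₀ z.2.1 z.2.2) - ate Q := by
    rw [← empMean_add, ← empMean_sub, ← empMean_const hn o (ate Q), ← empMean_sub]
    congr 1
    ext z
    simp only [eif]
    ring
  have e2 : ∀ η : Bool → Cov p → ℝ, ∀ γ : Bool → Cov p → ℝ,
      empMean o (fun z => γ z.2.1 z.2.2 * (num z.1 - condMean η z.2.1 z.2.2))
      = empMean o (fun z => γ z.2.1 z.2.2 * num z.1)
        - empMean o (fun z => γ z.2.1 z.2.2 * condMean η z.2.1 z.2.2) := fun η γ => by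
    rw [← empMean_sub]; congr 1; ext z; ring
  have e3 : nuisance γ (riesz π₀) η o = √(n : ℝ) *
      (empMean o (fun z => γ z.2.1 z.2.2 * (num z.1 - condMean η z.2.1 z.2.2))
        - empMean o fun z => riesz π₀ z.2.1 z.2.2 * (num z.1 - condMean η z.2.1 z.2.2)) := by
    rw [nuisance, ← empMean_sub]; congr 2; ext z; ring
  have e4 : ∀ c : Cov p → ℝ, avg (fun i => c (o i).2.2) = empMean o (fun z => c z.2.2) :=
    fun c => rfl
  have e5 : avg (fun i => bar (condMean η) (o i).2.2 - bar m₀ (o i).2.2)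
      = empMean o (fun z => bar (condMean η) z.2.2) - empMean o (fun z => bar m₀ z.2.2) := by
    rw [← empMean_sub]; rfl
  rw [score_eq, e3, e2 η γ, e2 η (riesz π₀)]
  simp only [bootMean, bias, ateFunctional, empMean_sub, e1, e4, e5, mul_sub,
    Finset.sum_sub_distrib]
  ring

lemma min_one_abs_add_le (a b : ℝ) : min 1 |a + b| ≤ min 1 |a| + min 1 |b| := by
  rcases le_total 1 |a| with ha | ha
  · rw [min_eq_left ha]
    exact (min_le_left _ _).trans (by linarith [le_min zero_le_one (abs_nonneg b)])
  · rcases le_total 1 |b| with hb | hb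
    · rw [min_eq_left hb]
      exact (min_le_left _ _).trans (by linarith [le_min zero_le_one (abs_nonneg a)])
    · rw [min_eq_right ha, min_eq_right hb]
      exact (min_le_right _ _).trans (abs_add_le a b)

lemma min_one_abs_le (a : ℝ) : |min 1 (|a|)| ≤ 1 := by
  rw [abs_of_nonneg (le_min zero_le_one (abs_nonneg a))]
  exact min_le_left _ _

lemma integrable_min_one {Θ : Type*} [MeasurableSpace Θ] (ρ : Measure Θ) [IsFiniteMeasure ρ]
    {f : Θ → ℝ} (hf : Measurable f) : Integrable (fun θ => min 1 |f θ|) ρ :=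
  Integrable.of_bound (measurable_const.min hf.abs).aestronglyMeasurable 1
    (ae_of_all _ fun _ => min_one_abs_le _)

lemma integral_min_one_le_add {Θ : Type*} [MeasurableSpace Θ] (ρ : Measure Θ)
    [IsProbabilityMeasure ρ] {f : Θ → ℝ} {A : Set Θ} (hA : MeasurableSet A) {u : ℝ}
    (hu : 0 ≤ u) (h : ∀ θ ∈ A, |f θ| ≤ u) : ∫ θ, min 1 |f θ| ∂ρ ≤ (1 - ρ.real A) + u := by
  have := integral_min_one_le ρ (f := f) (integrable_const u) (fun _ => hu) hA.compl
    fun θ hθ => h θ (not_not.1 hθ)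
  rw [← probReal_compl_eq_one_sub hA]
  simpa using this

lemma measurable_bootMean_comp {Θ : Type*} [MeasurableSpace Θ] {c : Θ → Fin n → ℝ}
    (hc : ∀ i, Measurable fun θ => c θ i) :
    Measurable fun q : Θ × (Fin n → ℝ) => bootMean (c q.1) q.2 := by
  unfold bootMean avg
  refine measurable_const.mul ((Finset.measurable_sum _ fun i _ => ?_).sub
    ((Finset.measurable_sum _ fun i _ => (hc i).comp measurable_fst).div_const _))
  exact ((measurable_pi_apply i).comp measurable_snd).mul ((hc i).comp measurable_fst)

/-- The Bayesian bootstrap of a random vector with small mean square is small. -/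
lemma integral_min_one_bootMean_prod_le (hn : 0 < n) {Θ : Type*} [MeasurableSpace Θ]
    (ρ : Measure Θ) [IsProbabilityMeasure ρ] {c : Θ → Fin n → ℝ}
    (hc : ∀ i, Measurable fun θ => c θ i) {B : ℝ} (hB : ∀ θ i, |c θ i| ≤ B) :
    ∫ q, min 1 |bootMean (c q.1) q.2| ∂(ρ.prod (bootstrapWeights n))
      ≤ 4 / n + 2 * √(∫ θ, avg (fun i => c θ i ^ 2) ∂ρ) := by
  have hm := measurable_bootMean_comp hc
  have hsq : ∀ θ, 0 ≤ avg fun i => c θ i ^ 2 := fun θ =>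
    div_nonneg (Finset.sum_nonneg fun i _ => sq_nonneg _) (Nat.cast_nonneg _)
  have ham : Measurable fun θ => avg fun i => c θ i ^ 2 :=
    (Finset.measurable_sum _ fun i _ => (hc i).pow_const 2).div_const _
  have hab : ∀ θ, avg (fun i => c θ i ^ 2) ≤ B ^ 2 := fun θ => by
    have h0 : (0 : ℝ) < n := by positivity
    rw [avg, div_le_iff₀ h0]
    calc ∑ i, c θ i ^ 2 ≤ ∑ _i : Fin n, B ^ 2 := Finset.sum_le_sum fun i _ => by
          rw [← sq_abs]; exact pow_le_pow_left₀ (abs_nonneg _) (hB θ i) 2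
      _ = B ^ 2 * n := by simp [mul_comm]
  have hL2 : MemLp (fun θ => √(avg fun i => c θ i ^ 2)) 2 ρ :=
    MemLp.of_bound (Real.continuous_sqrt.measurable.comp ham).aestronglyMeasurable (√(B ^ 2))
      (ae_of_all _ fun θ => by
        rw [Real.norm_eq_abs, abs_of_nonneg (Real.sqrt_nonneg _)]
        exact Real.sqrt_le_sqrt (hab θ))
  have hi := hL2.integrable one_le_two
  have h1 := integral_abs_le_sqrt ρ hL2
  simp only [Real.sq_sqrt (hsq _), abs_of_nonneg (Real.sqrt_nonneg _)] at h1
  rw [integral_prod _ (integrable_min_one _ hm)]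
  calc ∫ θ, ∫ M, min 1 |bootMean (c θ) M| ∂(bootstrapWeights n) ∂ρ
      ≤ ∫ θ, (4 / n + 2 * √(avg fun i => c θ i ^ 2)) ∂ρ := by
        refine integral_mono (integrable_min_one _ hm).integral_prod_left
          ((integrable_const _).add (hi.const_mul 2)) fun θ => integral_min_one_bootMean_le hn _
    _ = 4 / n + 2 * ∫ θ, √(avg fun i => c θ i ^ 2) ∂ρ := by
        rw [integral_add (integrable_const _) (hi.const_mul 2), integral_const_mul]; simp
    _ ≤ _ := by linarith

variable {Ξ : Type*} [MeasurableSpace Ξ]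

/-- For given data, the distance of the posterior law of the parameter to the normal law is at most
the distances of the laws of the score and of the Bayesian bootstrap of `m̄₀` to their limits, up to
the remainders. -/
lemma dBL_marginalPosterior_le (hn : 0 < n) (Q : Measure (Unit0 p)) (π₀ : Cov p → ℝ)
    (m₀ : Bool → Cov p → ℝ) (ν : Measure Ξ) [IsProbabilityMeasure ν] {W : Ξ → Bool → Cov p → ℝ}
    (hW : ∀ d x, Measurable fun ξ => W ξ d x) {σ : ℝ} (hσ : 0 < σ) (γ : Bool → Cov p → ℝ)
    (χ : ℝ) (o : Fin n → Obs p) (hm₀ : ∀ i d, m₀ d (o i).2.2 ∈ Set.Icc (0 : ℝ) 1) (v₁ v₂ : ℝ≥0)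
    {A B : Set (Ξ × ℝ)} (hA : MeasurableSet A) (hB : MeasurableSet B) {u κ : ℝ}
    (hAu : ∀ θ ∈ A, |θ.2| ≤ u * σ ^ 2 * √(n : ℝ)) (hu : 0 ≤ u) (hκ : 0 ≤ κ)
    (hBκ : ∀ θ ∈ B, |nuisance γ (riesz π₀) (tilt (W θ.1) θ.2 γ) o| ≤ κ) :
    dBL (marginalPosterior ν W σ γ π₀ m₀ χ o) (gaussianReal 0 (v₁ + v₂))
      ≤ 2 * ((4 / n + 2 * √(2 * ∫ θ, empMean o (fun z => regDist (tilt (W θ.1) θ.2 γ) m₀ z.2.2)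
            ∂(posterior ν W σ γ o)))
          + ((1 - (posterior ν W σ γ o).real A) + u) + ((1 - (posterior ν W σ γ o).real B) + κ)
          + |√(n : ℝ) * (χ - ate Q - empMean o (eif Q π₀ m₀))|)
        + (dBL ((posterior ν W σ γ o).map fun θ =>
              score γ (tilt (W θ.1) θ.2 γ) o + θ.2 / (√(n : ℝ) * σ ^ 2)) (gaussianReal 0 v₁)
          + dBL ((bootstrapWeights n).map (bootMean fun i => bar m₀ (o i).2.2))
              (gaussianReal 0 v₂)) := by
  have := isProbabilityMeasure_posterior ν hW σ γ o
  set ρ := posterior ν W σ γ o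
  set e := √(n : ℝ) * (χ - ate Q - empMean o (eif Q π₀ m₀))
  have hn0 : (0 : ℝ) < √(n : ℝ) := by positivity
  have hcm : ∀ d x, Measurable fun θ : Ξ × ℝ => condMean (tilt (W θ.1) θ.2 γ) d x := fun d x => by
    simpa using measurable_condMean_apply hW γ d x 0
  have hbm : ∀ i, Measurable fun θ : Ξ × ℝ =>
      bar (condMean (tilt (W θ.1) θ.2 γ)) (o i).2.2 - bar m₀ (o i).2.2 := fun i =>
    ((hcm _ _).sub (hcm _ _)).sub_const _
  have hbb : ∀ (θ : Ξ × ℝ) i,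
      |bar (condMean (tilt (W θ.1) θ.2 γ)) (o i).2.2 - bar m₀ (o i).2.2| ≤ 2 := fun θ i => by
    have h1 := condMean_mem_Icc (tilt (W θ.1) θ.2 γ) true (o i).2.2
    have h2 := condMean_mem_Icc (tilt (W θ.1) θ.2 γ) false (o i).2.2
    have h3 := hm₀ i true
    have h4 := hm₀ i false
    rw [abs_le]
    simp only [bar]
    constructor <;> linarith [h1.1, h1.2, h2.1, h2.2, h3.1, h3.2, h4.1, h4.2]
  let Sθ : Ξ × ℝ → ℝ := fun θ => score γ (tilt (W θ.1) θ.2 γ) o + θ.2 / (√(n : ℝ) * σ ^ 2)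
  let c : Ξ × ℝ → Fin n → ℝ := fun θ i =>
    bar (condMean (tilt (W θ.1) θ.2 γ)) (o i).2.2 - bar m₀ (o i).2.2
  let N : Ξ × ℝ → ℝ := fun θ => nuisance γ (riesz π₀) (tilt (W θ.1) θ.2 γ) o
  let Λ : Ξ × ℝ → ℝ := fun θ => -(θ.2 / (√(n : ℝ) * σ ^ 2))
  let T : (Ξ × ℝ) × (Fin n → ℝ) → ℝ := fun q =>
    √(n : ℝ) * (ateFunctional q.2 (tilt (W q.1.1) q.1.2 γ) o - χ
      - bias π₀ m₀ (tilt (W q.1.1) q.1.2 γ) o)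
  let U : (Ξ × ℝ) × (Fin n → ℝ) → ℝ := fun q => Sθ q.1 + bootMean (fun i => bar m₀ (o i).2.2) q.2
  have hΛm : Measurable Λ := (measurable_snd.div_const _).neg
  have hNm : Measurable N := by
    refine measurable_const.mul ((Finset.measurable_sum _ fun i _ => ?_).div_const _)
    exact ((hcm _ _).const_sub _).const_mul _
  have hSm : Measurable Sθ := (measurable_score hW γ o).add (measurable_snd.div_const _)
  have hUm : Measurable U := (hSm.comp measurable_fst).add
    ((measurable_bootMean _).comp measurable_snd)
  have hcbm := measurable_bootMean_comp (c := c) hbm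
  have hTU : ∀ q, T q = U q + (bootMean (c q.1) q.2 + (Λ q.1 + (N q.1 + -e))) := fun q => by
    simp only [T, U, Sθ, c, Λ, N, e]
    rw [sqrt_mul_ateFunctional_sub hn Q γ]
    ring
  have hTm : Measurable T := by
    rw [funext hTU]
    exact hUm.add (hcbm.add ((hΛm.comp measurable_fst).add
      ((hNm.comp measurable_fst).add_const _)))
  have hmap : (ρ.prod (bootstrapWeights n)).map U = (ρ.map Sθ).conv
      ((bootstrapWeights n).map (bootMean fun i => bar m₀ (o i).2.2)) := by
    rw [Measure.conv, Measure.map_prod_map _ _ hSm (measurable_bootMean _),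
      Measure.map_map measurable_add (hSm.prodMap (measurable_bootMean _))]
    rfl
  have p1 : IsProbabilityMeasure (ρ.map Sθ) := Measure.isProbabilityMeasure_map hSm.aemeasurable
  have p2 : IsProbabilityMeasure ((bootstrapWeights n).map (bootMean fun i => bar m₀ (o i).2.2)) :=
    Measure.isProbabilityMeasure_map (measurable_bootMean _).aemeasurable
  have h1 := dBL_map_le (ρ.prod (bootstrapWeights n)) hTm hUm (gaussianReal 0 (v₁ + v₂))
  have h2 := dBL_conv_le (ρ.map Sθ) (gaussianReal 0 v₁)
    ((bootstrapWeights n).map (bootMean fun i => bar m₀ (o i).2.2)) (gaussianReal 0 v₂)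
  rw [gaussianReal_conv_gaussianReal, add_zero] at h2
  rw [hmap] at h1
  have i1 := integrable_min_one (ρ.prod (bootstrapWeights n)) hcbm
  have i2 := integrable_min_one (ρ.prod (bootstrapWeights n)) (hΛm.comp measurable_fst)
  have i3 := integrable_min_one (ρ.prod (bootstrapWeights n)) (hNm.comp measurable_fst)
  have h3 : ∫ q, min 1 |T q - U q| ∂(ρ.prod (bootstrapWeights n))
      ≤ ∫ q, (min 1 |bootMean (c q.1) q.2| + (min 1 |Λ q.1| + (min 1 |N q.1| + |e|)))
        ∂(ρ.prod (bootstrapWeights n)) := by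
    refine integral_mono (integrable_min_one _ (hTm.sub hUm))
      (i1.add (i2.add (i3.add (integrable_const _)))) fun q => ?_
    simp only [hTU, add_sub_cancel_left]
    have a1 := min_one_abs_add_le (bootMean (c q.1) q.2) (Λ q.1 + (N q.1 + -e))
    have a2 := min_one_abs_add_le (Λ q.1) (N q.1 + -e)
    have a3 := min_one_abs_add_le (N q.1) (-e)
    have a4 : min 1 |-e| ≤ |e| := (min_le_right _ _).trans_eq (abs_neg e)
    linarith
  have h4 : ∫ q, (min 1 |bootMean (c q.1) q.2| + (min 1 |Λ q.1| + (min 1 |N q.1| + |e|)))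
        ∂(ρ.prod (bootstrapWeights n))
      = ∫ q, min 1 |bootMean (c q.1) q.2| ∂(ρ.prod (bootstrapWeights n))
        + (∫ θ, min 1 |Λ θ| ∂ρ + (∫ θ, min 1 |N θ| ∂ρ + |e|)) := by
    have j1 := integral_add i1 (i2.add (i3.add (integrable_const |e|)))
    have j2 := integral_add i2 (i3.add (integrable_const |e|))
    have j3 := integral_add i3 (integrable_const (μ := ρ.prod (bootstrapWeights n)) |e|)
    have j4 := integral_fun_fst (μ := ρ) (ν := bootstrapWeights n) fun θ => min 1 |Λ θ|
    have j5 := integral_fun_fst (μ := ρ) (ν := bootstrapWeights n) fun θ => min 1 |N θ|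
    simp only [Pi.add_apply, probReal_univ, integral_const, smul_eq_mul, one_mul,
      Function.comp_apply] at j1 j2 j3 j4 j5
    rw [j1, j2, j3, j4, j5]
  have h5 := integral_min_one_bootMean_prod_le hn ρ (c := c) hbm hbb
  have h6 : ∫ θ, avg (fun i => c θ i ^ 2) ∂ρ
      ≤ 2 * ∫ θ, empMean o (fun z => regDist (tilt (W θ.1) θ.2 γ) m₀ z.2.2) ∂ρ := by
    rw [← integral_const_mul]
    have hcsq : ∀ θ i, c θ i ^ 2 ≤ 2 * regDist (tilt (W θ.1) θ.2 γ) m₀ (o i).2.2 := fun θ i =>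
      sq_bar_sub_le (hm₀ i)
    have hrm : Measurable fun θ : Ξ × ℝ =>
        empMean o (fun z => regDist (tilt (W θ.1) θ.2 γ) m₀ z.2.2) :=
      (Finset.measurable_sum _ fun i _ => ((hcm _ _).sub_const _).abs.add
        ((hcm _ _).sub_const _).abs).div_const _
    refine integral_mono_of_nonneg (ae_of_all _ fun θ => ?_) ?_ (ae_of_all _ fun θ => ?_)
    · exact div_nonneg (Finset.sum_nonneg fun i _ => sq_nonneg _) (Nat.cast_nonneg _)
    · refine (Integrable.of_bound hrm.aestronglyMeasurable 2 (ae_of_all _ fun θ => ?_)).const_mul 2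
      rw [Real.norm_eq_abs, abs_of_nonneg (empMean_nonneg fun i => regDist_nonneg _ _ _)]
      exact empMean_le zero_le_two fun i => regDist_le_two (hm₀ i)
    · simp only
      rw [← empMean_const_mul]
      exact empMean_mono (f := fun z =>
        (bar (condMean (tilt (W θ.1) θ.2 γ)) z.2.2 - bar m₀ z.2.2) ^ 2) (hcsq θ)
  have h7 : ∫ θ, min 1 |Λ θ| ∂ρ ≤ (1 - ρ.real A) + u := by
    refine integral_min_one_le_add ρ hA hu fun θ hθ => ?_
    have := hAu θ hθ
    simp only [Λ]
    rw [abs_neg, abs_div, abs_of_pos (by positivity : (0 : ℝ) < √(n : ℝ) * σ ^ 2),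
      div_le_iff₀ (by positivity)]
    linarith
  have h8 : ∫ θ, min 1 |N θ| ∂ρ ≤ (1 - ρ.real B) + κ := integral_min_one_le_add ρ hB hκ hBκ
  have h9 := Real.sqrt_le_sqrt h6
  have h10 : dBL (marginalPosterior ν W σ γ π₀ m₀ χ o) (gaussianReal 0 (v₁ + v₂))
    ≤ 2 * ∫ q, min 1 |T q - U q| ∂(ρ.prod (bootstrapWeights n))
      + dBL ((ρ.map Sθ).conv ((bootstrapWeights n).map (bootMean fun i => bar m₀ (o i).2.2)))
        (gaussianReal 0 (v₁ + v₂)) := h1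
  have h11 : dBL ((ρ.map Sθ).conv ((bootstrapWeights n).map (bootMean fun i => bar m₀ (o i).2.2)))
        (gaussianReal 0 (v₁ + v₂)) ≤ dBL (ρ.map Sθ) (gaussianReal 0 v₁) +
        dBL ((bootstrapWeights n).map (bootMean fun i => bar m₀ (o i).2.2)) (gaussianReal 0 v₂) := h2
  linarith

/-- The information is close to the variance of the score if the regression function and the Riesz
representor are close to the truth at the data. -/
lemma abs_info_sub_le {γ γ₀ η m₀ : Bool → Cov p → ℝ} {o : Fin n → Obs p} {K C : ℝ}
    (hK : ∀ i, |γ (o i).2.1 (o i).2.2| ≤ K) (hC : ∀ i, |γ₀ (o i).2.1 (o i).2.2| ≤ C)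
    (hm₀ : ∀ i d, m₀ d (o i).2.2 ∈ Set.Icc (0 : ℝ) 1) (v : ℝ) :
    |info γ η o - v| ≤ K ^ 2 * empMean o (fun z => regDist η m₀ z.2.2)
      + (K + C) * empMean o (fun z => |γ z.2.1 z.2.2 - γ₀ z.2.1 z.2.2|)
      + |empMean o (fun z => γ₀ z.2.1 z.2.2 ^ 2 * outcomeVar m₀ z) - v| := by
  have e : info γ η o - v
      = empMean o (fun z => γ z.2.1 z.2.2 ^ 2 *
          (condMean η z.2.1 z.2.2 * (1 - condMean η z.2.1 z.2.2) - outcomeVar m₀ z))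
        + empMean o (fun z => (γ z.2.1 z.2.2 ^ 2 - γ₀ z.2.1 z.2.2 ^ 2) * outcomeVar m₀ z)
        + (empMean o (fun z => γ₀ z.2.1 z.2.2 ^ 2 * outcomeVar m₀ z) - v) := by
    rw [← add_sub_assoc, ← empMean_add, ← empMean_add]
    simp only [info]
    congr 2
    ext z
    ring
  rw [e]
  refine (abs_add_le _ _).trans (add_le_add ((abs_add_le _ _).trans (add_le_add ?_ ?_)) le_rfl)
  · rw [← empMean_const_mul]
    refine (abs_empMean_le _ _).trans (empMean_mono fun i => ?_)
    have h1 := condMean_mem_Icc η (o i).2.1 (o i).2.2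
    have h2 := hm₀ i (o i).2.1
    rw [abs_mul, abs_pow]
    refine mul_le_mul (pow_le_pow_left₀ (abs_nonneg _) (hK i) 2) ?_ (abs_nonneg _) (sq_nonneg _)
    refine le_trans ?_ (abs_condMean_sub_le_regDist η m₀ (o i).2.1 (o i).2.2)
    rw [outcomeVar, show condMean η (o i).2.1 (o i).2.2 * (1 - condMean η (o i).2.1 (o i).2.2)
      - m₀ (o i).2.1 (o i).2.2 * (1 - m₀ (o i).2.1 (o i).2.2)
      = (condMean η (o i).2.1 (o i).2.2 - m₀ (o i).2.1 (o i).2.2)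
        * (1 - condMean η (o i).2.1 (o i).2.2 - m₀ (o i).2.1 (o i).2.2) by ring, abs_mul]
    refine mul_le_of_le_one_right (abs_nonneg _) ?_
    rw [abs_le]
    constructor <;> linarith [h1.1, h1.2, h2.1, h2.2]
  · rw [← empMean_const_mul]
    refine (abs_empMean_le _ _).trans (empMean_mono fun i => ?_)
    have h2 := hm₀ i (o i).2.1
    have h3 : |outcomeVar m₀ (o i)| ≤ 1 := by
      rw [outcomeVar, abs_le]; constructor <;> nlinarith [h2.1, h2.2]
    have h4 : |γ (o i).2.1 (o i).2.2 + γ₀ (o i).2.1 (o i).2.2| ≤ K + C :=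
      (abs_add_le _ _).trans (add_le_add (hK i) (hC i))
    rw [abs_mul, sq_sub_sq, abs_mul]
    calc _ ≤ (K + C) * |γ (o i).2.1 (o i).2.2 - γ₀ (o i).2.1 (o i).2.2| * 1 := by
          refine mul_le_mul (mul_le_mul_of_nonneg_right h4 (abs_nonneg _)) h3 (abs_nonneg _) ?_
          exact mul_nonneg ((abs_nonneg _).trans h4) (abs_nonneg _)
      _ = _ := mul_one _

end Deterministic

/-! ### The posterior distance to the true regression function at the data -/

section PosteriorDistance

variable {p n : ℕ} {Ξ 𝓢 : Type*} [MeasurableSpace Ξ] [MeasurableSpace 𝓢]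

/-- Truncation of a regression function to `[0, 1]`. -/
def clip (m₀ : Bool → Cov p → ℝ) : Bool → Cov p → ℝ := fun d x => max 0 (min 1 (m₀ d x))

lemma clip_mem_Icc (m₀ : Bool → Cov p → ℝ) (d : Bool) (x : Cov p) :
    clip m₀ d x ∈ Set.Icc (0 : ℝ) 1 :=
  ⟨le_max_left _ _, max_le zero_le_one (min_le_left _ _)⟩

lemma clip_eq {m₀ : Bool → Cov p → ℝ} {d : Bool} {x : Cov p} (h : m₀ d x ∈ Set.Icc (0 : ℝ) 1) :
    clip m₀ d x = m₀ d x := by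
  rw [clip, min_eq_right h.2, max_eq_right h.1]

lemma measurable_clip {m₀ : Bool → Cov p → ℝ} (h : ∀ d, Measurable (m₀ d)) (d : Bool) :
    Measurable (clip m₀ d) := measurable_const.max (measurable_const.min (h d))

lemma regDist_clip {η m₀ : Bool → Cov p → ℝ} {x : Cov p}
    (h : ∀ d, m₀ d x ∈ Set.Icc (0 : ℝ) 1) : regDist η (clip m₀) x = regDist η m₀ x := by
  rw [regDist, regDist, clip_eq (h true), clip_eq (h false)]

lemma hasBernoulliConditional_clip {Q : Measure (Unit0 p)} [IsProbabilityMeasure Q]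
    {m₀ : Bool → Cov p → ℝ} (hm₀ : IsConditionalMean Q m₀)
    (h01 : ∀ᵐ x ∂(covLaw Q), ∀ d, m₀ d x ∈ Set.Icc (0 : ℝ) 1) :
    HasBernoulliConditional (obsLaw Q) fun z => clip m₀ z.1 z.2 := by
  intro G hG
  rw [hasBernoulliConditional hm₀ G hG]
  refine lintegral_congr_ae ?_
  filter_upwards [ae_obsLaw_of_ae_covLaw h01] with o ho
  simp only [clip_eq (ho _)]

lemma ofReal_likelihood (η : Bool → Cov p → ℝ) (o : Fin n → Obs p) :
    ENNReal.ofReal (likelihood η o)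
      = ∏ j, bernoulliDensity (fun z => condMean η z.1 z.2) (o j) := by
  rw [likelihood, ENNReal.ofReal_prod_of_nonneg]
  · rfl
  · intro i _
    have := condMean_mem_Icc η (o i).2.1 (o i).2.2
    split_ifs
    · exact this.1
    · linarith [this.2]

/-- The mean distance to `m₀` at the data, under the measure `ρ` reweighted by the likelihood. -/
def reweightedDist (ρ : Measure (Ξ × ℝ)) (W : Ξ → Bool → Cov p → ℝ) (γ m₀ : Bool → Cov p → ℝ)
    (o : Fin n → Obs p) : ℝ≥0∞ :=
  (∫⁻ θ, ENNReal.ofReal (empMean o fun z => regDist (tilt (W θ.1) θ.2 γ) m₀ z.2.2)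
      * ENNReal.ofReal (likelihood (tilt (W θ.1) θ.2 γ) o) ∂ρ)
    / ∫⁻ θ, ENNReal.ofReal (likelihood (tilt (W θ.1) θ.2 γ) o) ∂ρ

lemma ofReal_regDist (η m₀ : Bool → Cov p → ℝ) (x : Cov p) : ENNReal.ofReal (regDist η m₀ x)
    = ENNReal.ofReal |condMean η true x - m₀ true x|
      + ENNReal.ofReal |condMean η false x - m₀ false x| :=
  ENNReal.ofReal_add (abs_nonneg _) (abs_nonneg _)

lemma measurable_condMean_joint {α : Type*} [MeasurableSpace α] {W : Ξ → Bool → Cov p → ℝ}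
    (hW : ∀ d, Measurable fun q : Ξ × Cov p => W q.1 d q.2) {γ : α → Bool → Cov p → ℝ}
    (hγ : ∀ d, Measurable fun q : α × Cov p => γ q.1 d q.2) (d : Bool) :
    Measurable fun q : (α × (Ξ × ℝ)) × Cov p =>
      condMean (tilt (W q.1.2.1) q.1.2.2 (γ q.1.1)) d q.2 := by
  refine continuous_sigmoid.measurable.comp (Measurable.add ?_ (Measurable.mul ?_ ?_))
  · exact (hW d).comp (measurable_fst.snd.fst.prodMk measurable_snd)
  · exact measurable_fst.snd.snd
  · exact (hγ d).comp (measurable_fst.fst.prodMk measurable_snd)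

lemma measurable_regDist_joint {α : Type*} [MeasurableSpace α] {W : Ξ → Bool → Cov p → ℝ}
    (hW : ∀ d, Measurable fun q : Ξ × Cov p => W q.1 d q.2) {γ : α → Bool → Cov p → ℝ}
    (hγ : ∀ d, Measurable fun q : α × Cov p => γ q.1 d q.2) {m₀ : Bool → Cov p → ℝ}
    (hm₀ : ∀ d, Measurable (m₀ d)) :
    Measurable fun q : (α × (Ξ × ℝ)) × Cov p =>
      regDist (tilt (W q.1.2.1) q.1.2.2 (γ q.1.1)) m₀ q.2 :=
  ((measurable_condMean_joint hW hγ true).sub ((hm₀ true).comp measurable_snd)).abs.add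
    ((measurable_condMean_joint hW hγ false).sub ((hm₀ false).comp measurable_snd)).abs

lemma measurable_condMean_apply_cov {W : Ξ → Bool → Cov p → ℝ}
    (hW : ∀ d, Measurable fun q : Ξ × Cov p => W q.1 d q.2) {γ : Bool → Cov p → ℝ}
    (hγ : ∀ d, Measurable (γ d)) (d : Bool) : Measurable fun q : (Ξ × ℝ) × Cov p =>
      condMean (tilt (W q.1.1) q.1.2 γ) d q.2 :=
  continuous_sigmoid.measurable.comp
    (((hW d).comp (measurable_fst.fst.prodMk measurable_snd)).add
      (measurable_fst.snd.mul ((hγ d).comp measurable_snd)))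

lemma measurable_condMean_uncurry {W : Ξ → Bool → Cov p → ℝ}
    (hW : ∀ d, Measurable fun q : Ξ × Cov p => W q.1 d q.2) {γ : Bool → Cov p → ℝ}
    (hγ : ∀ d, Measurable (γ d)) : Measurable fun q : (Ξ × ℝ) × (Bool × Cov p) =>
      condMean (tilt (W q.1.1) q.1.2 γ) q.2.1 q.2.2 :=
  measurable_apply_bool (f := fun (q : (Ξ × ℝ) × (Bool × Cov p)) d =>
      condMean (tilt (W q.1.1) q.1.2 γ) d q.2.2)
    (fun d => (measurable_condMean_apply_cov hW hγ d).comp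
      (measurable_fst.prodMk measurable_snd.snd)) measurable_snd.fst

lemma measurable_regDist {W : Ξ → Bool → Cov p → ℝ}
    (hW : ∀ d, Measurable fun q : Ξ × Cov p => W q.1 d q.2) {γ : Bool → Cov p → ℝ}
    (hγ : ∀ d, Measurable (γ d)) {m₀ : Bool → Cov p → ℝ} (hm₀ : ∀ d, Measurable (m₀ d)) :
    Measurable fun q : (Ξ × ℝ) × Cov p => regDist (tilt (W q.1.1) q.1.2 γ) m₀ q.2 :=
  ((measurable_condMean_apply_cov hW hγ true).sub ((hm₀ true).comp measurable_snd)).abs.add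
    ((measurable_condMean_apply_cov hW hγ false).sub ((hm₀ false).comp measurable_snd)).abs

lemma measurable_prod_bernoulliDensity {W : Ξ → Bool → Cov p → ℝ}
    (hW : ∀ d, Measurable fun q : Ξ × Cov p => W q.1 d q.2) {γ : Bool → Cov p → ℝ}
    (hγ : ∀ d, Measurable (γ d)) : Measurable fun q : (Fin n → Obs p) × (Ξ × ℝ) =>
      ∏ j, bernoulliDensity (fun z => condMean (tilt (W q.2.1) q.2.2 γ) z.1 z.2) (q.1 j) := by
  have h : Measurable fun q : ((Fin n → Obs p) × (Ξ × ℝ)) × (Bool × Cov p) =>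
      condMean (tilt (W q.1.2.1) q.1.2.2 γ) q.2.1 q.2.2 :=
    (measurable_condMean_uncurry hW hγ).comp (measurable_fst.snd.prodMk measurable_snd)
  exact Finset.measurable_prod _ fun j _ => measurable_bernoulliDensity h
    ((measurable_pi_apply j).comp measurable_fst)

/-- The contribution of the `i`th data point to `reweightedDist`. -/
def reweightedDistAt (ρ : Measure (Ξ × ℝ)) (W : Ξ → Bool → Cov p → ℝ) (γ m₀ : Bool → Cov p → ℝ)
    (i : Fin n) (o : Fin n → Obs p) : ℝ≥0∞ :=
  (∫⁻ θ, ENNReal.ofReal (regDist (tilt (W θ.1) θ.2 γ) m₀ (o i).2.2) *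
      ∏ j, bernoulliDensity (fun z => condMean (tilt (W θ.1) θ.2 γ) z.1 z.2) (o j) ∂ρ)
    / ∫⁻ θ, ∏ j, bernoulliDensity (fun z => condMean (tilt (W θ.1) θ.2 γ) z.1 z.2) (o j) ∂ρ

lemma reweightedDist_eq_sum {W : Ξ → Bool → Cov p → ℝ}
    (hW : ∀ d, Measurable fun q : Ξ × Cov p => W q.1 d q.2) {γ : Bool → Cov p → ℝ}
    (hγ : ∀ d, Measurable (γ d)) {m₀ : Bool → Cov p → ℝ} (hm₀ : ∀ d, Measurable (m₀ d))
    (ρ : Measure (Ξ × ℝ)) (hn : 0 < n) (o : Fin n → Obs p) :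
    reweightedDist ρ W γ m₀ o = (n : ℝ≥0∞)⁻¹ * ∑ i, reweightedDistAt ρ W γ m₀ i o := by
  have hLo : Measurable fun θ : Ξ × ℝ =>
      ∏ j, bernoulliDensity (fun z => condMean (tilt (W θ.1) θ.2 γ) z.1 z.2) (o j) :=
    (measurable_prod_bernoulliDensity hW hγ).comp (measurable_prodMk_left (x := o))
  have hro : ∀ i, Measurable fun θ : Ξ × ℝ => ENNReal.ofReal
      (regDist (tilt (W θ.1) θ.2 γ) m₀ (o i).2.2) := fun i =>
    ((measurable_regDist hW hγ hm₀).comp measurable_prodMk_right).ennreal_ofReal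
  have hn0 : (0 : ℝ) < n := by positivity
  simp only [reweightedDist, reweightedDistAt, ofReal_likelihood, div_eq_mul_inv]
  rw [← Finset.sum_mul, ← mul_assoc]
  congr 1
  have hrL : ∀ i, Measurable fun θ : Ξ × ℝ =>
      ENNReal.ofReal (regDist (tilt (W θ.1) θ.2 γ) m₀ (o i).2.2) *
        ∏ j, bernoulliDensity (fun z => condMean (tilt (W θ.1) θ.2 γ) z.1 z.2) (o j) := fun i =>
    (hro i).mul hLo
  rw [← lintegral_finsetSum _ fun i _ => hrL i, ← lintegral_const_mul _
    (Finset.measurable_sum _ fun i _ => hrL i)]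
  refine lintegral_congr fun θ => ?_
  rw [← Finset.sum_mul, ← mul_assoc]
  congr 1
  rw [empMean, ENNReal.ofReal_div_of_pos hn0,
    ENNReal.ofReal_sum_of_nonneg fun i _ => regDist_nonneg _ _ _, ENNReal.ofReal_natCast,
    div_eq_mul_inv, mul_comm]

lemma measurable_reweightedDistAt {W : Ξ → Bool → Cov p → ℝ}
    (hW : ∀ d, Measurable fun q : Ξ × Cov p => W q.1 d q.2) {γ : Bool → Cov p → ℝ}
    (hγ : ∀ d, Measurable (γ d)) {m₀ : Bool → Cov p → ℝ} (hm₀ : ∀ d, Measurable (m₀ d))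
    (ρ : Measure (Ξ × ℝ)) [IsFiniteMeasure ρ] (i : Fin n) :
    Measurable (reweightedDistAt ρ W γ m₀ i) := by
  have h1 : Measurable fun q : (Fin n → Obs p) × (Ξ × ℝ) =>
      ENNReal.ofReal (regDist (tilt (W q.2.1) q.2.2 γ) m₀ (q.1 i).2.2) :=
    ((measurable_regDist hW hγ hm₀).comp (measurable_snd.prodMk
      (measurable_obsCov.comp ((measurable_pi_apply i).comp measurable_fst)))).ennreal_ofReal
  have hL := measurable_prod_bernoulliDensity (n := n) hW hγ
  exact (h1.mul hL).lintegral_prod_right'.div hL.lintegral_prod_right'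

/-- The leave-one-out bound for the average distance to the truth at the data points. -/
lemma lintegral_reweightedDist_le {P : Measure (Obs p)} [IsProbabilityMeasure P]
    {m₀ : Bool → Cov p → ℝ} (hP : HasBernoulliConditional P fun z => m₀ z.1 z.2)
    (hm₀ : ∀ d, Measurable (m₀ d)) (hm01 : ∀ d x, m₀ d x ∈ Set.Icc (0 : ℝ) 1)
    {W : Ξ → Bool → Cov p → ℝ} (hW : ∀ d, Measurable fun q : Ξ × Cov p => W q.1 d q.2)
    {γ : Bool → Cov p → ℝ} (hγ : ∀ d, Measurable (γ d)) {ρ : Measure (Ξ × ℝ)} [IsFiniteMeasure ρ]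
    {ε : ℝ≥0∞} (hε : ∀ᵐ θ ∂ρ,
      ∫⁻ o, ENNReal.ofReal (regDist (tilt (W θ.1) θ.2 γ) m₀ o.2.2) ∂P ≤ ε) :
    ∫⁻ o : Fin n → Obs p, reweightedDist ρ W γ m₀ o ∂(Measure.pi fun _ => P) ≤ 5 * ε := by
  rcases Nat.eq_zero_or_pos n with rfl | hn
  · simp [reweightedDist, empMean]
  have hφ : Measurable fun q : (Ξ × ℝ) × (Bool × Cov p) =>
      ENNReal.ofReal (regDist (tilt (W q.1.1) q.1.2 γ) m₀ q.2.2) :=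
    ((measurable_regDist hW hγ hm₀).comp
      (measurable_fst.prodMk measurable_snd.snd)).ennreal_ofReal
  have key : ∀ i : Fin n, ∫⁻ o, reweightedDistAt ρ W γ m₀ i o ∂(Measure.pi fun _ => P) ≤ 5 * ε :=
    fun i => lintegral_leave_one_out_le hP (ρ := ρ)
      (m := fun θ z => condMean (tilt (W θ.1) θ.2 γ) z.1 z.2) (measurable_condMean_uncurry hW hγ)
      (fun θ z => condMean_mem_Icc _ _ _)
      (φ := fun θ z => ENNReal.ofReal (regDist (tilt (W θ.1) θ.2 γ) m₀ z.2)) hφ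
      (fun θ z => by
        rw [← ENNReal.ofReal_ofNat 2]
        exact ENNReal.ofReal_le_ofReal (regDist_le_two fun d => hm01 d _))
      (fun θ z => ENNReal.ofReal_le_ofReal (abs_condMean_sub_le_regDist _ _ _ _)) hε i
  have hterm := fun i : Fin n => measurable_reweightedDistAt hW hγ hm₀ ρ i
  simp_rw [reweightedDist_eq_sum hW hγ hm₀ ρ hn]
  rw [lintegral_const_mul _ (Finset.measurable_sum _ fun i _ => hterm i),
    lintegral_finsetSum _ fun i _ => hterm i]
  calc _ ≤ (n : ℝ≥0∞)⁻¹ * ∑ _i : Fin n, 5 * ε := by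
        gcongr with i
        exact key i
    _ = 5 * ε := by
        rw [Finset.sum_const, Finset.card_univ, Fintype.card_fin, nsmul_eq_mul, ← mul_assoc,
          ENNReal.inv_mul_cancel (by exact_mod_cast hn.ne') (by simp), one_mul]

lemma measurable_likelihood_joint {α : Type*} [MeasurableSpace α] {W : Ξ → Bool → Cov p → ℝ}
    (hW : ∀ d, Measurable fun q : Ξ × Cov p => W q.1 d q.2) {γ : α → Bool → Cov p → ℝ}
    (hγ : ∀ d, Measurable fun q : α × Cov p => γ q.1 d q.2) :
    Measurable fun q : (α × (Fin n → Obs p)) × (Ξ × ℝ) =>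
      likelihood (tilt (W q.2.1) q.2.2 (γ q.1.1)) q.1.2 := by
  have ho : ∀ i, Measurable fun q : (α × (Fin n → Obs p)) × (Ξ × ℝ) => q.1.2 i := fun i =>
    (measurable_pi_apply i).comp measurable_fst.snd
  refine measurable_likelihood (m := fun (q : (α × (Fin n → Obs p)) × (Ξ × ℝ)) i =>
    condMean (tilt (W q.2.1) q.2.2 (γ q.1.1)) (q.1.2 i).2.1 (q.1.2 i).2.2) (fun i => ?_)
    (fun i => (ho i).fst)
  refine measurable_apply_bool (f := fun (q : (α × (Fin n → Obs p)) × (Ξ × ℝ)) d =>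
    condMean (tilt (W q.2.1) q.2.2 (γ q.1.1)) d (q.1.2 i).2.2) (fun d => ?_) (ho i).snd.fst
  exact (measurable_condMean_joint hW hγ d).comp
    ((measurable_fst.fst.prodMk measurable_snd).prodMk (measurable_obsCov.comp (ho i)))

/-- Joint measurability in the auxiliary sample and the data. -/
lemma measurable_reweightedDist {W : Ξ → Bool → Cov p → ℝ}
    (hW : ∀ d, Measurable fun q : Ξ × Cov p => W q.1 d q.2) {γ : 𝓢 → Bool → Cov p → ℝ}
    (hγ : ∀ d, Measurable fun q : 𝓢 × Cov p => γ q.1 d q.2) {m₀ : Bool → Cov p → ℝ}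
    (hm₀ : ∀ d, Measurable (m₀ d)) (ρ : Measure (Ξ × ℝ)) [IsFiniteMeasure ρ]
    {A : Set (𝓢 × (Ξ × ℝ))} (hA : MeasurableSet A) :
    Measurable fun q : 𝓢 × (Fin n → Obs p) =>
      reweightedDist (ρ.restrict {θ | (q.1, θ) ∈ A}) W (γ q.1) m₀ q.2 := by
  have hAs : ∀ s, MeasurableSet {θ | (s, θ) ∈ A} := fun s => measurable_prodMk_left hA
  have hL := measurable_likelihood_joint (n := n) hW hγ
  have hr : Measurable fun q : (𝓢 × (Fin n → Obs p)) × (Ξ × ℝ) =>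
      empMean q.1.2 fun z => regDist (tilt (W q.2.1) q.2.2 (γ q.1.1)) m₀ z.2.2 :=
    (Finset.measurable_sum _ fun i _ => (measurable_regDist_joint hW hγ hm₀).comp
      ((measurable_fst.fst.prodMk measurable_snd).prodMk (measurable_obsCov.comp
        ((measurable_pi_apply i).comp measurable_fst.snd)))).div_const _
  have hset : MeasurableSet {q : (𝓢 × (Fin n → Obs p)) × (Ξ × ℝ) | (q.1.1, q.2) ∈ A} :=
    (measurable_fst.fst.prodMk measurable_snd) hA
  have h1 := ((hr.ennreal_ofReal.mul hL.ennreal_ofReal).indicator hset).lintegral_prod_right'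
    (ν := ρ)
  have h2 := (hL.ennreal_ofReal.indicator hset).lintegral_prod_right' (ν := ρ)
  convert h1.div h2 using 1
  ext q
  simp only [reweightedDist]
  rw [← lintegral_indicator (hAs _), ← lintegral_indicator (hAs _)]
  rfl

/-- The posterior mean of the distance to the truth is bounded by the one restricted to a set `A`,
up to the posterior mass outside `A`. -/
lemma lintegral_posterior_regDist_le (ν : Measure Ξ) [IsProbabilityMeasure ν]
    {W : Ξ → Bool → Cov p → ℝ} (hW : ∀ d x, Measurable fun ξ => W ξ d x) (σ : ℝ)
    (γ : Bool → Cov p → ℝ) {m₀ : Bool → Cov p → ℝ} (hm01 : ∀ d x, m₀ d x ∈ Set.Icc (0 : ℝ) 1)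
    (o : Fin n → Obs p) {A : Set (Ξ × ℝ)} (hA : MeasurableSet A) :
    ∫⁻ θ, ENNReal.ofReal (empMean o fun z => regDist (tilt (W θ.1) θ.2 γ) m₀ z.2.2)
        ∂(posterior ν W σ γ o)
      ≤ 2 * posterior ν W σ γ o Aᶜ + reweightedDist ((prior ν σ).restrict A) W γ m₀ o := by
  have hcm : ∀ d x, Measurable fun θ : Ξ × ℝ => condMean (tilt (W θ.1) θ.2 γ) d x := fun d x => by
    simpa using measurable_condMean_apply hW γ d x 0
  have hrm : Measurable fun θ : Ξ × ℝ =>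
      ENNReal.ofReal (empMean o (fun z => regDist (tilt (W θ.1) θ.2 γ) m₀ z.2.2)) :=
    ((Finset.measurable_sum _ fun i _ => ((hcm _ _).sub_const _).abs.add
      ((hcm _ _).sub_const _).abs).div_const _).ennreal_ofReal
  have hLm := (measurable_likelihood_tilt_zero hW γ o).ennreal_ofReal
  rw [← lintegral_add_compl _ hA, add_comm]
  gcongr
  · rw [← setLIntegral_const]
    refine setLIntegral_mono measurable_const fun θ _ => ?_
    rw [← ENNReal.ofReal_ofNat 2]
    exact ENNReal.ofReal_le_ofReal (empMean_le zero_le_two fun i => regDist_le_two fun d => hm01 _ _)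
  · rw [← lintegral_indicator hA, lintegral_posterior ν hW σ γ o (hrm.indicator hA),
      reweightedDist, div_eq_mul_inv, mul_comm]
    refine mul_le_mul' (le_of_eq ?_) (ENNReal.inv_le_inv.2 ?_)
    · rw [← lintegral_indicator hA]
      refine lintegral_congr fun θ => ?_
      by_cases hθ : θ ∈ A <;> simp [hθ, mul_comm]
    · exact lintegral_mono' Measure.restrict_le_self le_rfl

end PosteriorDistance

/-! ### Errors of the estimated Riesz representor -/

section Riesz

variable {p n : ℕ}

lemma abs_riesz_sub_le {π π₀ : Cov p → ℝ} {x : Cov p} (hπ : 0 < π x ∧ π x < 1) {c : ℝ} (hc : 0 < c)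
    (h₀ : c < π₀ x ∧ π₀ x < 1 - c) {K : ℝ} {d : Bool} (hK : |riesz π d x| ≤ K) :
    |riesz π d x - riesz π₀ d x| ≤ K / c * |π x - π₀ x| := by
  have key : ∀ a b : ℝ, 0 < a → c < b → |1 / a| ≤ K → |1 / a - 1 / b| ≤ K / c * |a - b| :=
    fun a b ha hb hK => by
      have hb0 : 0 < b := hc.trans hb
      rw [div_sub_div _ _ ha.ne' hb0.ne', one_mul, mul_one, abs_div, abs_sub_comm b a,
        div_eq_mul_inv, mul_comm]
      gcongr
      rw [abs_mul, mul_inv, abs_of_pos ha, abs_of_pos hb0, div_eq_mul_inv]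
      rw [abs_of_pos (by positivity), one_div] at hK
      exact mul_le_mul hK (inv_anti₀ hc hb.le) (by positivity) ((inv_pos.2 ha).le.trans hK)
  cases d
  · have h1 := key (1 - π x) (1 - π₀ x) (by linarith [hπ.2]) (by linarith [h₀.2])
      (by simpa [riesz, num] using hK)
    rw [show 1 - π x - (1 - π₀ x) = -(π x - π₀ x) by ring, abs_neg, ← abs_neg] at h1
    refine le_trans (le_of_eq ?_) h1
    congr 1
    simp only [riesz, num, Bool.false_eq_true, if_false]
    ring
  · have h1 := key (π x) (π₀ x) hπ.1 h₀.1 (by simpa [riesz, num] using hK)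
    refine le_trans (le_of_eq ?_) h1
    simp [riesz, num]

/-- The squared `L²(P)` distance of two functions of treatment and covariate. -/
def sqDist (P : Measure (Obs p)) (γ γ₀ : Bool → Cov p → ℝ) : ℝ≥0∞ :=
  ∫⁻ o, ENNReal.ofReal ((γ o.2.1 o.2.2 - γ₀ o.2.1 o.2.2) ^ 2) ∂P

lemma lintegral_ofReal_sq_eq {α : Type*} [MeasurableSpace α] (P : Measure α) (f : α → ℝ) :
    ∫⁻ x, ENNReal.ofReal (f x ^ 2) ∂P = eLpNorm f 2 P ^ 2 := by
  have := eLpNorm_nnreal_pow_eq_lintegral (μ := P) (f := f) (p := 2) two_ne_zero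
  simp only [NNReal.coe_ofNat, ENNReal.coe_ofNat] at this
  rw [← ENNReal.rpow_ofNat, this]
  refine lintegral_congr fun x => ?_
  rw [ENNReal.rpow_ofNat, ← enorm_pow, Real.enorm_of_nonneg (sq_nonneg _)]

lemma ofReal_max_zero (r : ℝ) : ENNReal.ofReal (max r 0) = ENNReal.ofReal r := by
  rcases le_total r 0 with h | h
  · rw [max_eq_right h, ENNReal.ofReal_of_nonpos h, ENNReal.ofReal_zero]
  · rw [max_eq_left h]

lemma lintegral_covLaw (Q : Measure (Unit0 p)) {f : Cov p → ℝ≥0∞} (hf : Measurable f) :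
    ∫⁻ x, f x ∂(covLaw Q) = ∫⁻ o, f o.2.2 ∂(obsLaw Q) := by
  rw [← map_obsLaw_covariate, lintegral_map hf measurable_obsCov]

lemma sqDist_riesz_le {Q : Measure (Unit0 p)} [IsProbabilityMeasure Q] {π π₀ : Cov p → ℝ}
    (hπm : Measurable π) (hπ₀m : Measurable π₀) (hπ : ∀ x, 0 < π x ∧ π x < 1) {c : ℝ} (hc : 0 < c)
    (hov : ∀ x ∈ (covLaw Q).support, c < π₀ x ∧ π₀ x < 1 - c) {K : ℝ}
    (hK : ∀ d, ∀ x ∈ (covLaw Q).support, |riesz π d x| ≤ K) {r : ℝ}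
    (hr : eLpNorm (fun x => π x - π₀ x) 2 (covLaw Q) ≤ ENNReal.ofReal r) :
    sqDist (obsLaw Q) (riesz π) (riesz π₀) ≤ ENNReal.ofReal ((K / c) ^ 2 * max r 0 ^ 2) := by
  calc sqDist (obsLaw Q) (riesz π) (riesz π₀)
      ≤ ∫⁻ o, ENNReal.ofReal ((K / c) ^ 2) * ENNReal.ofReal ((π o.2.2 - π₀ o.2.2) ^ 2)
          ∂(obsLaw Q) := by
        refine lintegral_mono_ae ?_
        filter_upwards [ae_obsLaw_of_ae_covLaw (ae_mem_support Q)] with o ho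
        rw [← ENNReal.ofReal_mul (sq_nonneg _), ← mul_pow, ← sq_abs, ← sq_abs (_ * _), abs_mul]
        refine ENNReal.ofReal_le_ofReal (pow_le_pow_left₀ (abs_nonneg _) ?_ 2)
        refine (abs_riesz_sub_le (hπ _) hc (hov _ ho) (hK _ _ ho)).trans ?_
        gcongr
        exact le_abs_self _
    _ = ENNReal.ofReal ((K / c) ^ 2) * eLpNorm (fun x => π x - π₀ x) 2 (covLaw Q) ^ 2 := by
        have hm : Measurable fun x => ENNReal.ofReal ((π x - π₀ x) ^ 2) :=
          ((hπm.sub hπ₀m).pow_const 2).ennreal_ofReal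
        rw [← lintegral_ofReal_sq_eq, lintegral_covLaw Q hm]
        exact lintegral_const_mul _ (hm.comp measurable_obsCov)
    _ ≤ ENNReal.ofReal ((K / c) ^ 2) * ENNReal.ofReal r ^ 2 := by gcongr
    _ = _ := by
        rw [ENNReal.ofReal_mul (sq_nonneg _), ENNReal.ofReal_pow (le_max_right _ _),
          ofReal_max_zero]

/-- The population part of the product of the errors. -/
lemma abs_integral_riesz_mul_le {Q : Measure (Unit0 p)} [IsProbabilityMeasure Q] {π π₀ : Cov p → ℝ}
    (hπm : Measurable π) (hπ₀m : Measurable π₀) (hπ : ∀ x, 0 < π x ∧ π x < 1) {c : ℝ} (hc : 0 < c)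
    (hov : ∀ x ∈ (covLaw Q).support, c < π₀ x ∧ π₀ x < 1 - c) {K : ℝ} (hK0 : 0 ≤ K)
    (hK : ∀ d, ∀ x ∈ (covLaw Q).support, |riesz π d x| ≤ K) {r : ℝ}
    (hr : eLpNorm (fun x => π x - π₀ x) 2 (covLaw Q) ≤ ENNReal.ofReal r)
    {m m₀ : Bool → Cov p → ℝ} (hm : ∀ d, Measurable (m d)) (hm₀ : ∀ d, Measurable (m₀ d)) {ε : ℝ}
    (hε : ∀ d, eLpNorm (fun x => m d x - m₀ d x) 2 (covLaw Q) ≤ ENNReal.ofReal ε) :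
    |∫ o, (riesz π o.2.1 o.2.2 - riesz π₀ o.2.1 o.2.2)
        * (m o.2.1 o.2.2 - m₀ o.2.1 o.2.2) ∂(obsLaw Q)|
      ≤ K / c * (2 * (max r 0 * max ε 0)) := by
  have hd : ∀ d, ∫⁻ x, ‖π x - π₀ x‖ₑ * ‖m d x - m₀ d x‖ₑ ∂(covLaw Q)
      ≤ ENNReal.ofReal r * ENNReal.ofReal ε := fun d => by
    have h1 := ENNReal.lintegral_mul_le_Lp_mul_Lq (covLaw Q) Real.HolderConjugate.two_two
      (f := fun x => ‖π x - π₀ x‖ₑ) (g := fun x => ‖m d x - m₀ d x‖ₑ)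
      (hπm.sub hπ₀m).enorm.aemeasurable ((hm d).sub (hm₀ d)).enorm.aemeasurable
    have h2 : ∀ f : Cov p → ℝ, (∫⁻ x, ‖f x‖ₑ ^ (2 : ℝ) ∂(covLaw Q)) ^ (1 / (2 : ℝ))
        = eLpNorm f 2 (covLaw Q) := fun f => by
      rw [eLpNorm_eq_lintegral_rpow_enorm_toReal two_ne_zero ENNReal.ofNat_ne_top]
      simp
    rw [h2, h2] at h1
    exact h1.trans (mul_le_mul' hr (hε d))
  have hR : 0 ≤ K / c := by positivity
  have hdm : ∀ d, Measurable fun x => ‖π x - π₀ x‖ₑ * ‖m d x - m₀ d x‖ₑ := fun d =>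
    (hπm.sub hπ₀m).enorm.mul ((hm d).sub (hm₀ d)).enorm
  have h3 : ‖∫ o, (riesz π o.2.1 o.2.2 - riesz π₀ o.2.1 o.2.2)
        * (m o.2.1 o.2.2 - m₀ o.2.1 o.2.2) ∂(obsLaw Q)‖ₑ
      ≤ ENNReal.ofReal (K / c * (2 * (max r 0 * max ε 0))) := by
    calc _ ≤ ∫⁻ o, ‖(riesz π o.2.1 o.2.2 - riesz π₀ o.2.1 o.2.2)
            * (m o.2.1 o.2.2 - m₀ o.2.1 o.2.2)‖ₑ ∂(obsLaw Q) := enorm_integral_le_lintegral_enorm _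
      _ ≤ ∫⁻ o, ENNReal.ofReal (K / c) * (‖π o.2.2 - π₀ o.2.2‖ₑ * ‖m true o.2.2 - m₀ true o.2.2‖ₑ
            + ‖π o.2.2 - π₀ o.2.2‖ₑ * ‖m false o.2.2 - m₀ false o.2.2‖ₑ) ∂(obsLaw Q) := by
          refine lintegral_mono_ae ?_
          filter_upwards [ae_obsLaw_of_ae_covLaw (ae_mem_support Q)] with o ho
          rw [enorm_mul, ← mul_add, ← mul_assoc]
          refine mul_le_mul' ?_ ?_
          · rw [← ofReal_norm, ← ofReal_norm, ← ENNReal.ofReal_mul hR]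
            exact ENNReal.ofReal_le_ofReal (abs_riesz_sub_le (hπ _) hc (hov _ ho) (hK _ _ ho))
          · cases o.2.1
            · exact le_add_self
            · exact le_self_add
      _ = ENNReal.ofReal (K / c) *
            (∫⁻ x, ‖π x - π₀ x‖ₑ * ‖m true x - m₀ true x‖ₑ ∂(covLaw Q)
              + ∫⁻ x, ‖π x - π₀ x‖ₑ * ‖m false x - m₀ false x‖ₑ ∂(covLaw Q)) := by
          rw [lintegral_covLaw Q (hdm true), lintegral_covLaw Q (hdm false),
            ← lintegral_add_left (f := fun o : Obs p =>
              ‖π o.2.2 - π₀ o.2.2‖ₑ * ‖m true o.2.2 - m₀ true o.2.2‖ₑ)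
              ((hdm true).comp measurable_obsCov)]
          exact lintegral_const_mul _ (((hdm true).add (hdm false)).comp measurable_obsCov)
      _ ≤ ENNReal.ofReal (K / c) * (ENNReal.ofReal r * ENNReal.ofReal ε
            + ENNReal.ofReal r * ENNReal.ofReal ε) := by
          gcongr <;> exact hd _
      _ = _ := by
          rw [← two_mul, ENNReal.ofReal_mul hR, ENNReal.ofReal_mul zero_le_two,
            ENNReal.ofReal_mul (le_max_right _ _), ofReal_max_zero,
            ofReal_max_zero, ENNReal.ofReal_ofNat]
  rw [← ofReal_norm, ENNReal.ofReal_le_ofReal_iff (by positivity)] at h3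
  exact h3

/-- A centred empirical average of residuals, weighted by `h`, has variance at most `P h²`. -/
lemma lintegral_sq_residual_le {Q : Measure (Unit0 p)} [IsProbabilityMeasure Q]
    {m₀ : Bool → Cov p → ℝ} (hm₀ : IsConditionalMean Q m₀) {γ γ₀ : Bool → Cov p → ℝ}
    (hγ : ∀ d, Measurable (γ d)) (hγ₀ : ∀ d, Measurable (γ₀ d)) (n : ℕ) :
    ∫⁻ o : Fin n → Obs p, ENNReal.ofReal ((√(n : ℝ) * empMean o fun z =>
        (γ z.2.1 z.2.2 - γ₀ z.2.1 z.2.2) * (num z.1 - m₀ z.2.1 z.2.2)) ^ 2)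
        ∂(Measure.pi fun _ => obsLaw Q) ≤ sqDist (obsLaw Q) γ γ₀ := by
  rcases Nat.eq_zero_or_pos n with rfl | hn
  · simp
  rcases eq_or_ne (sqDist (obsLaw Q) γ γ₀) ∞ with h | hfin
  · rw [h]; exact le_top
  have hn0 : (0 : ℝ) < n := by positivity
  set h : Bool × Cov p → ℝ := fun z => γ z.1 z.2 - γ₀ z.1 z.2
  have hhm : Measurable h := (measurable_uncurry_bool hγ).sub (measurable_uncurry_bool hγ₀)
  have hL2 : MemLp (fun o : Obs p => h o.2) 2 (obsLaw Q) := by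
    refine ⟨(hhm.comp measurable_snd).aestronglyMeasurable, ?_⟩
    have := lintegral_ofReal_sq_eq (obsLaw Q) fun o : Obs p => h o.2
    by_contra hc
    rw [not_lt_top_iff] at hc
    rw [hc] at this
    exact hfin (this.trans (by simp))
  have hresm : Measurable fun o : Obs p => num o.1 - m₀ o.2.1 o.2.2 :=
    (measurable_num.comp measurable_fst).sub ((measurable_uncurry_bool hm₀.1).comp measurable_snd)
  have hm01 := ae_mem_Icc_of_condExp (P := obsLaw Q) measurable_snd
    (measurable_num.comp measurable_fst) (fun o => num_mem_Icc _) hm₀.2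
  have hres : ∀ᵐ o ∂(obsLaw Q), |num o.1 - m₀ o.2.1 o.2.2| ≤ 1 := hm01.mono fun o ho => by
    rw [abs_le]
    constructor <;> linarith [ho.1, ho.2, (num_mem_Icc o.1).1, (num_mem_Icc o.1).2]
  have hle : ∀ᵐ o ∂(obsLaw Q), |h o.2 * (num o.1 - m₀ o.2.1 o.2.2)| ≤ |h o.2| :=
    hres.mono fun o ho => by
      rw [abs_mul]; exact mul_le_of_le_one_right (abs_nonneg _) ho
  have hfm := (hhm.comp measurable_snd).mul hresm
  have hf2 : MemLp (fun o : Obs p => h o.2 * (num o.1 - m₀ o.2.1 o.2.2)) 2 (obsLaw Q) :=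
    hL2.mono hfm.aestronglyMeasurable hle
  have h0 := integral_mul_residual hm₀ hhm (hL2.integrable one_le_two)
  obtain ⟨h1, h2⟩ := integral_sq_sum_pi (obsLaw Q) (n := n)
    (fun _ o => h o.2 * (num o.1 - m₀ o.2.1 o.2.2)) (fun _ => hf2) fun _ => h0
  have e : ∀ o : Fin n → Obs p, (√(n : ℝ) * empMean o fun z =>
        (γ z.2.1 z.2.2 - γ₀ z.2.1 z.2.2) * (num z.1 - m₀ z.2.1 z.2.2)) ^ 2
      = (∑ i, h (o i).2 * (num (o i).1 - m₀ (o i).2.1 (o i).2.2)) ^ 2 * (n : ℝ)⁻¹ := fun o => by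
    rw [mul_pow, Real.sq_sqrt hn0.le, empMean, div_pow]
    simp only [h]
    field_simp
  simp only [e]
  rw [← ofReal_integral_eq_lintegral_ofReal (h1.integrable_sq.mul_const _)
    (ae_of_all _ fun o => by positivity), integral_mul_const, h2, Finset.sum_const,
    Finset.card_univ, Fintype.card_fin, nsmul_eq_mul, mul_comm, ← mul_assoc,
    inv_mul_cancel₀ hn0.ne', one_mul,
    ofReal_integral_eq_lintegral_ofReal hf2.integrable_sq (ae_of_all _ fun o => sq_nonneg _)]
  refine lintegral_mono_ae (hle.mono fun o ho => ENNReal.ofReal_le_ofReal ?_)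
  exact sq_le_sq.2 ho

lemma lintegral_empMean_sq_le (P : Measure (Obs p)) [IsProbabilityMeasure P]
    {γ γ₀ : Bool → Cov p → ℝ} (hγ : ∀ d, Measurable (γ d)) (hγ₀ : ∀ d, Measurable (γ₀ d)) (n : ℕ) :
    ∫⁻ o : Fin n → Obs p, ENNReal.ofReal (empMean o fun z =>
        (γ z.2.1 z.2.2 - γ₀ z.2.1 z.2.2) ^ 2) ∂(Measure.pi fun _ => P) ≤ sqDist P γ γ₀ := by
  rcases Nat.eq_zero_or_pos n with rfl | hn
  · simp [empMean]
  have hn0 : (0 : ℝ) < n := by positivity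
  have hm : Measurable fun o : Obs p => ENNReal.ofReal ((γ o.2.1 o.2.2 - γ₀ o.2.1 o.2.2) ^ 2) :=
    (((measurable_uncurry_bool hγ).sub (measurable_uncurry_bool hγ₀)).comp
      measurable_snd).pow_const 2 |>.ennreal_ofReal
  have e : ∀ o : Fin n → Obs p, ENNReal.ofReal (empMean o fun z =>
        (γ z.2.1 z.2.2 - γ₀ z.2.1 z.2.2) ^ 2)
      = (n : ℝ≥0∞)⁻¹ * ∑ i, ENNReal.ofReal
        ((γ (o i).2.1 (o i).2.2 - γ₀ (o i).2.1 (o i).2.2) ^ 2) := fun o => by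
    rw [empMean, ENNReal.ofReal_div_of_pos hn0,
      ENNReal.ofReal_sum_of_nonneg fun i _ => sq_nonneg _, ENNReal.ofReal_natCast,
      div_eq_mul_inv, mul_comm]
  have hmi : ∀ i : Fin n, Measurable fun o : Fin n → Obs p => ENNReal.ofReal
        ((γ (o i).2.1 (o i).2.2 - γ₀ (o i).2.1 (o i).2.2) ^ 2) := fun i =>
    hm.comp (measurable_pi_apply i)
  simp only [e]
  rw [lintegral_const_mul _ (Finset.measurable_sum _ fun i _ => hmi i),
    lintegral_finsetSum _ fun i _ => hmi i]
  have h1 : ∀ i : Fin n, ∫⁻ o : Fin n → Obs p, ENNReal.ofReal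
        ((γ (o i).2.1 (o i).2.2 - γ₀ (o i).2.1 (o i).2.2) ^ 2) ∂(Measure.pi fun _ => P)
      = sqDist P γ γ₀ := fun i =>
    (measurePreserving_eval (fun _ : Fin n => P) i).lintegral_comp hm
  simp only [h1]
  rw [Finset.sum_const, Finset.card_univ, Fintype.card_fin, nsmul_eq_mul, ← mul_assoc,
    ENNReal.inv_mul_cancel (by exact_mod_cast hn.ne') (by simp), one_mul]

/-- The nuisance term splits into a centred empirical average that is free of `η`, an empirical
process, and a population product of errors. -/
lemma nuisance_eq (P : Measure (Obs p)) (γ γ₀ η m₀ : Bool → Cov p → ℝ) (o : Fin n → Obs p) :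
    nuisance γ γ₀ η o = √(n : ℝ) * empMean o (fun z =>
        (γ z.2.1 z.2.2 - γ₀ z.2.1 z.2.2) * (num z.1 - m₀ z.2.1 z.2.2))
      - empProc P o (fun z => (γ z.2.1 z.2.2 - γ₀ z.2.1 z.2.2)
        * (condMean η z.2.1 z.2.2 - m₀ z.2.1 z.2.2))
      - √(n : ℝ) * ∫ z, (γ z.2.1 z.2.2 - γ₀ z.2.1 z.2.2)
        * (condMean η z.2.1 z.2.2 - m₀ z.2.1 z.2.2) ∂P := by
  have : (fun z : Obs p => (γ z.2.1 z.2.2 - γ₀ z.2.1 z.2.2) * (num z.1 - condMean η z.2.1 z.2.2))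
      = fun z => (γ z.2.1 z.2.2 - γ₀ z.2.1 z.2.2) * (num z.1 - m₀ z.2.1 z.2.2)
        - (γ z.2.1 z.2.2 - γ₀ z.2.1 z.2.2) * (condMean η z.2.1 z.2.2 - m₀ z.2.1 z.2.2) := by
    ext z; ring
  rw [nuisance, this, empMean_sub, empProc]
  ring

lemma empMean_abs_le_sqrt {f : Obs p → ℝ} (o : Fin n → Obs p) :
    empMean o (fun z => |f z|) ≤ √(empMean o fun z => f z ^ 2) := by
  refine Real.le_sqrt_of_sq_le ?_
  rcases Nat.eq_zero_or_pos n with rfl | hn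
  · simp [empMean]
  have hn0 : (0 : ℝ) < n := by positivity
  have h := sq_sum_le_card_mul_sum_sq (s := Finset.univ) (f := fun i => |f (o i)|)
  simp only [sq_abs, Finset.card_univ, Fintype.card_fin] at h
  rw [empMean, empMean, div_pow, div_le_div_iff₀ (by positivity) hn0]
  nlinarith

end Riesz

/-! ### Events of probability tending to one -/

section Whp

variable {Ω : Type*} [MeasurableSpace Ω] {μ : Measure Ω}

/-- The events `E n` have probability tending to one; the complements are measured by outer
probability. -/
def Whp (μ : Measure Ω) (E : ℕ → Ω → Prop) : Prop :=
  Tendsto (fun n => μ {ω | ¬ E n ω}) atTop (𝓝 0)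

lemma Whp.mono {E F : ℕ → Ω → Prop} (hE : Whp μ E) (h : ∀ᶠ n in atTop, ∀ ω, E n ω → F n ω) :
    Whp μ F := by
  refine tendsto_of_tendsto_of_tendsto_of_le_of_le' tendsto_const_nhds hE
    (Eventually.of_forall fun _ => zero_le) ?_
  filter_upwards [h] with n hn
  exact measure_mono fun ω hω hE => hω (hn ω hE)

lemma Whp.and {E F : ℕ → Ω → Prop} (hE : Whp μ E) (hF : Whp μ F) :
    Whp μ fun n ω => E n ω ∧ F n ω := by
  have h := Tendsto.add hE hF
  rw [add_zero] at h
  refine tendsto_of_tendsto_of_tendsto_of_le_of_le tendsto_const_nhds h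
    (fun _ => zero_le) fun n => ?_
  refine le_trans (measure_mono fun ω hω => ?_) (measure_union_le _ _)
  by_contra hc
  simp only [Set.mem_union, Set.mem_ofPred_eq, not_or, not_not] at hc
  exact hω hc

lemma whp_of_ae {E : ℕ → Ω → Prop} (h : ∀ n, ∀ᵐ ω ∂μ, E n ω) : Whp μ E := by
  refine tendsto_const_nhds.congr fun n => ?_
  exact ((ae_iff.1 (h n))).symm

lemma whp_of_tendstoInMeasure {X : ℕ → Ω → ℝ} {a : ℝ}
    (h : TendstoInMeasure μ X atTop fun _ => a) {κ : ℝ} (hκ : 0 < κ) :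
    Whp μ fun n ω => |X n ω - a| < κ := by
  have := tendstoInMeasure_iff_norm.1 h κ hκ
  simpa [Whp, Real.norm_eq_abs] using this

lemma whp_of_tendsto_ae [IsFiniteMeasure μ] {X : ℕ → Ω → ℝ} {a : ℝ} (hX : ∀ n, Measurable (X n))
    (h : ∀ᵐ ω ∂μ, Tendsto (fun n => X n ω) atTop (𝓝 a)) {κ : ℝ} (hκ : 0 < κ) :
    Whp μ fun n ω => |X n ω - a| < κ :=
  whp_of_tendstoInMeasure
    (tendstoInMeasure_of_tendsto_ae (fun n => (hX n).aestronglyMeasurable) h) hκ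

end Whp

/-! ### Conditioning on the auxiliary sample -/

section Sampling

variable {Ω 𝓢 : Type*} [MeasurableSpace Ω] [MeasurableSpace 𝓢] {p : ℕ}

/-- The observations are i.i.d. with law `P`, and the `n`th auxiliary sample is independent of the
first `n` of them. -/
structure IsSamplingScheme (μ : Measure Ω) (P : Measure (Obs p)) (O : ℕ → Ω → Obs p)
    (S : ℕ → Ω → 𝓢) : Prop where
  measurable_obs : ∀ i, Measurable (O i)
  indep_obs : iIndepFun O μ
  law_obs : ∀ i, μ.map (O i) = P
  measurable_aux : ∀ n, Measurable (S n)
  indep_aux : ∀ n, IndepFun (S n) (sample O n) μ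

variable {μ : Measure Ω} {P : Measure (Obs p)} {O : ℕ → Ω → Obs p} {S : ℕ → Ω → 𝓢}

lemma IsSamplingScheme.measurable_sample (h : IsSamplingScheme μ P O S) (n : ℕ) :
    Measurable (sample O n) :=
  measurable_pi_iff.2 fun i => h.measurable_obs i

lemma IsSamplingScheme.map_sample [IsProbabilityMeasure μ] (h : IsSamplingScheme μ P O S) (n : ℕ) :
    μ.map (sample O n) = Measure.pi fun _ => P := by
  have h1 : iIndepFun (fun i : Fin n => O i) μ := h.indep_obs.precomp Fin.val_injective
  have h2 := (iIndepFun_iff_map_fun_eq_pi_map fun i : Fin n =>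
    (h.measurable_obs i).aemeasurable).1 h1
  simp only [h.law_obs] at h2
  exact h2

lemma IsSamplingScheme.lintegral_eq [IsProbabilityMeasure μ] [IsProbabilityMeasure P]
    (h : IsSamplingScheme μ P O S) (n : ℕ)
    {F : 𝓢 × (Fin n → Obs p) → ℝ≥0∞} (hF : Measurable F) :
    ∫⁻ ω, F (S n ω, sample O n ω) ∂μ
      = ∫⁻ s, ∫⁻ o, F (s, o) ∂(Measure.pi fun _ => P) ∂(μ.map (S n)) := by
  have h1 := (indepFun_iff_map_prod_eq_prod_map_map (h.measurable_aux n).aemeasurable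
    (h.measurable_sample n).aemeasurable).1 (h.indep_aux n)
  rw [h.map_sample] at h1
  rw [← lintegral_prod _ hF.aemeasurable, ← h1,
    lintegral_map hF ((h.measurable_aux n).prodMk (h.measurable_sample n))]

/-- Markov's inequality, conditionally on the auxiliary sample. -/
lemma IsSamplingScheme.whp_le [IsProbabilityMeasure μ] [IsProbabilityMeasure P]
    (h : IsSamplingScheme μ P O S)
    {F : (n : ℕ) → 𝓢 × (Fin n → Obs p) → ℝ≥0∞} (hF : ∀ n, Measurable (F n))
    {w : ℕ → 𝓢 → ℝ≥0∞} (hw : ∀ n, Measurable (w n))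
    (hFw : ∀ n s, ∫⁻ o, F n (s, o) ∂(Measure.pi fun _ => P) ≤ w n s) {τ : ℕ → ℝ≥0∞}
    (hτ : Tendsto τ atTop (𝓝 0)) {κ : ℝ≥0∞} (hκ : κ ≠ 0) (hκ' : κ ≠ ∞) :
    Whp μ fun n ω => w n (S n ω) ≤ τ n → F n (S n ω, sample O n ω) ≤ κ := by
  have hset : ∀ n, MeasurableSet {q : 𝓢 × (Fin n → Obs p) | w n q.1 ≤ τ n} := fun n =>
    measurableSet_le ((hw n).comp measurable_fst) measurable_const
  let G : (n : ℕ) → 𝓢 × (Fin n → Obs p) → ℝ≥0∞ := fun n => {q | w n q.1 ≤ τ n}.indicator (F n)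
  have hG : ∀ n, Measurable (G n) := fun n => (hF n).indicator (hset n)
  have h1 : ∀ n, ∫⁻ ω, G n (S n ω, sample O n ω) ∂μ ≤ τ n := fun n => by
    have : IsProbabilityMeasure (μ.map (S n)) :=
      Measure.isProbabilityMeasure_map (h.measurable_aux n).aemeasurable
    rw [h.lintegral_eq n (hG n)]
    calc _ ≤ ∫⁻ _, τ n ∂(μ.map (S n)) := by
          refine lintegral_mono fun s => ?_
          by_cases hs : w n s ≤ τ n
          · simpa [G, hs] using (hFw n s).trans hs
          · simp [G, hs]
      _ = τ n := by simp
  have h2 : Tendsto (fun n => τ n / κ) atTop (𝓝 0) := by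
    have := ENNReal.Tendsto.div_const hτ (b := κ) (Or.inr hκ)
    simpa using this
  refine tendsto_of_tendsto_of_tendsto_of_le_of_le tendsto_const_nhds h2
    (fun _ => zero_le) fun n => ?_
  rw [ENNReal.le_div_iff_mul_le (Or.inl hκ) (Or.inl hκ'), mul_comm]
  refine le_trans (le_trans ?_ (mul_meas_ge_le_lintegral
    ((hG n).comp ((h.measurable_aux n).prodMk (h.measurable_sample n))) κ)) (h1 n)
  gcongr
  intro hs
  obtain ⟨hs1, hs2⟩ := Classical.not_imp.1 hs
  simpa [G, hs1] using (not_le.1 hs2).le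

/-- The law of large numbers for the observations. -/
lemma IsSamplingScheme.whp_empMean [IsProbabilityMeasure μ]
    (h : IsSamplingScheme μ P O S) {f : Obs p → ℝ}
    (hf : Measurable f) (hi : Integrable f P) {κ : ℝ} (hκ : 0 < κ) :
    Whp μ fun n ω => |empMean (sample O n ω) f - ∫ o, f o ∂P| < κ := by
  have h0 : Integrable (fun ω => f (O 0 ω)) μ := by
    rw [← h.law_obs 0] at hi
    exact hi.comp_measurable (h.measurable_obs 0)
  have hint : ∫ ω, f (O 0 ω) ∂μ = ∫ o, f o ∂P := by
    rw [← h.law_obs 0, integral_map (h.measurable_obs 0).aemeasurable hf.aestronglyMeasurable]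
  have hlaw := strong_law_ae_real (fun i ω => f (O i ω)) h0
    (fun i j hij => (h.indep_obs.indepFun hij).comp hf hf) fun i =>
      IdentDistrib.comp ⟨(h.measurable_obs i).aemeasurable, (h.measurable_obs 0).aemeasurable, by
        rw [h.law_obs, h.law_obs]⟩ hf
  rw [hint] at hlaw
  refine whp_of_tendsto_ae (fun n => ?_) ?_ hκ
  · exact (Finset.measurable_sum Finset.univ fun (i : Fin n) _ =>
      hf.comp (h.measurable_obs i)).div_const _
  · filter_upwards [hlaw] with ω hω
    refine hω.congr fun n => ?_
    rw [empMean, Finset.sum_range]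
    rfl

lemma IsSamplingScheme.ae_forall (h : IsSamplingScheme μ P O S) {s : Obs p → Prop}
    (hs : ∀ᵐ o ∂P, s o) (n : ℕ) : ∀ᵐ ω ∂μ, ∀ i, s (sample O n ω i) := by
  rw [ae_all_iff]
  intro i
  rw [← h.law_obs i] at hs
  exact ae_of_ae_map (h.measurable_obs i).aemeasurable hs

end Sampling

/-! ### Behaviour of the remainders under the posterior -/

section Remainders

variable {Ω 𝓢 Ξ : Type*} [MeasurableSpace Ω] [MeasurableSpace 𝓢] [MeasurableSpace Ξ] {p : ℕ}

lemma measurable_riesz_joint {α : Type*} [MeasurableSpace α] {π : α → Cov p → ℝ}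
    (hπ : Measurable fun q : α × Cov p => π q.1 q.2) (d : Bool) :
    Measurable fun q : α × Cov p => riesz (π q.1) d q.2 :=
  (measurable_const.div hπ).sub (measurable_const.div (hπ.const_sub 1))

/-- If a regression function is within `ε` of `m₀` in `L²`, then its mean distance to `m₀` is at
most `2ε`. -/
lemma lintegral_regDist_clip_le {Q : Measure (Unit0 p)} [IsProbabilityMeasure Q]
    {η m₀ : Bool → Cov p → ℝ} (hη : ∀ d, Measurable (condMean η d)) (hm₀ : ∀ d, Measurable (m₀ d))
    (h01 : ∀ᵐ x ∂(covLaw Q), ∀ d, m₀ d x ∈ Set.Icc (0 : ℝ) 1) {ε : ℝ}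
    (hε : ∀ d, eLpNorm (fun x => condMean η d x - m₀ d x) 2 (covLaw Q) ≤ ENNReal.ofReal ε) :
    ∫⁻ o, ENNReal.ofReal (regDist η (clip m₀) o.2.2) ∂(obsLaw Q) ≤ 2 * ENNReal.ofReal ε := by
  have hm : ∀ d, Measurable fun x => ENNReal.ofReal |condMean η d x - m₀ d x| := fun d =>
    ((hη d).sub (hm₀ d)).abs.ennreal_ofReal
  have h1 : ∀ d, ∫⁻ x, ENNReal.ofReal |condMean η d x - m₀ d x| ∂(covLaw Q)
      ≤ ENNReal.ofReal ε := fun d => by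
    have h2 := (eLpNorm_le_eLpNorm_of_exponent_le (p := 1) (q := 2) (μ := covLaw Q) one_le_two
      ((hη d).sub (hm₀ d)).aestronglyMeasurable).trans (hε d)
    rw [eLpNorm_one_eq_lintegral_enorm] at h2
    simpa [← ofReal_norm, Real.norm_eq_abs] using h2
  calc ∫⁻ o, ENNReal.ofReal (regDist η (clip m₀) o.2.2) ∂(obsLaw Q)
      = ∫⁻ o, (ENNReal.ofReal |condMean η true o.2.2 - m₀ true o.2.2|
          + ENNReal.ofReal |condMean η false o.2.2 - m₀ false o.2.2|) ∂(obsLaw Q) := by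
        refine lintegral_congr_ae ?_
        filter_upwards [ae_obsLaw_of_ae_covLaw h01] with o ho
        rw [regDist_clip ho, ofReal_regDist]
    _ = ∫⁻ x, ENNReal.ofReal |condMean η true x - m₀ true x| ∂(covLaw Q)
        + ∫⁻ x, ENNReal.ofReal |condMean η false x - m₀ false x| ∂(covLaw Q) := by
        rw [lintegral_covLaw Q (hm true), lintegral_covLaw Q (hm false)]
        exact lintegral_add_left ((hm true).comp measurable_obsCov) _
    _ ≤ _ := by rw [two_mul]; exact add_le_add (h1 true) (h1 false)

/-- The parameters `(s, θ)` for which the regression function is within `ε` of `m₀` in mean. -/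
def nearSet (P : Measure (Obs p)) (W : Ξ → Bool → Cov p → ℝ) (γ : 𝓢 → Bool → Cov p → ℝ)
    (m₀ : Bool → Cov p → ℝ) (ε : ℝ≥0∞) : Set (𝓢 × (Ξ × ℝ)) :=
  {q | ∫⁻ o, ENNReal.ofReal (regDist (tilt (W q.2.1) q.2.2 (γ q.1)) m₀ o.2.2) ∂P ≤ ε}

lemma measurableSet_nearSet (P : Measure (Obs p)) [SFinite P] {W : Ξ → Bool → Cov p → ℝ}
    (hW : ∀ d, Measurable fun q : Ξ × Cov p => W q.1 d q.2) {γ : 𝓢 → Bool → Cov p → ℝ}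
    (hγ : ∀ d, Measurable fun q : 𝓢 × Cov p => γ q.1 d q.2) {m₀ : Bool → Cov p → ℝ}
    (hm₀ : ∀ d, Measurable (m₀ d)) (ε : ℝ≥0∞) : MeasurableSet (nearSet P W γ m₀ ε) := by
  have h0 : Measurable fun q : (𝓢 × (Ξ × ℝ)) × Obs p => (q.1, q.2.2.2) :=
    measurable_fst.prodMk (measurable_obsCov.comp measurable_snd)
  have h1 : Measurable fun q : (𝓢 × (Ξ × ℝ)) × Obs p => ENNReal.ofReal
      (regDist (tilt (W q.1.2.1) q.1.2.2 (γ q.1.1)) m₀ q.2.2.2) :=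
    ((measurable_regDist_joint hW hγ hm₀).comp h0).ennreal_ofReal
  have h2 : Measurable fun q : 𝓢 × (Ξ × ℝ) => ∫⁻ o, ENNReal.ofReal
      (regDist (tilt (W q.2.1) q.2.2 (γ q.1)) m₀ o.2.2) ∂P := h1.lintegral_prod_right'
  exact h2 measurableSet_Iic

/-- For given data, the posterior mean of the distance of the regression function to the truth is
small if the posterior concentrates near the truth and the reweighted distance is small. -/
lemma integral_posterior_regDist_le {n : ℕ} (ν : Measure Ξ) [IsProbabilityMeasure ν]
    {W : Ξ → Bool → Cov p → ℝ} (hW : ∀ d x, Measurable fun ξ => W ξ d x) (σ : ℝ)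
    (γ : Bool → Cov p → ℝ) {m₀ : Bool → Cov p → ℝ} {o : Fin n → Obs p}
    (h01 : ∀ i d, m₀ d (o i).2.2 ∈ Set.Icc (0 : ℝ) 1) {A B : Set (Ξ × ℝ)} (hA : MeasurableSet A)
    (hBA : B ⊆ A) {κ : ℝ} (hκ : 0 < κ) (h1 : 1 - (posterior ν W σ γ o).real B ≤ κ / 4)
    (h2 : reweightedDist ((prior ν σ).restrict A) W γ (clip m₀) o ≤ ENNReal.ofReal (κ / 2)) :
    ∫ θ, empMean o (fun z => regDist (tilt (W θ.1) θ.2 γ) m₀ z.2.2) ∂(posterior ν W σ γ o)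
      ≤ κ := by
  have := isProbabilityMeasure_posterior ν hW σ γ o
  set ρ := posterior ν W σ γ o
  have hcm : ∀ d x, Measurable fun θ : Ξ × ℝ => condMean (tilt (W θ.1) θ.2 γ) d x :=
    fun d x => by simpa using measurable_condMean_apply hW γ d x 0
  have hrm : Measurable fun θ : Ξ × ℝ =>
      empMean o (fun z => regDist (tilt (W θ.1) θ.2 γ) m₀ z.2.2) :=
    (Finset.measurable_sum _ fun i _ => ((hcm _ _).sub_const _).abs.add
      ((hcm _ _).sub_const _).abs).div_const _
  have h4 : ρ Aᶜ ≤ ENNReal.ofReal (κ / 4) := by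
    rw [← ofReal_measureReal, probReal_compl_eq_one_sub hA]
    exact ENNReal.ofReal_le_ofReal ((sub_le_sub_left (measureReal_mono hBA) 1).trans h1)
  have h5 := lintegral_posterior_regDist_le ν hW σ γ (clip_mem_Icc m₀) o hA
  have h6 : ∀ θ : Ξ × ℝ, empMean o (fun z => regDist (tilt (W θ.1) θ.2 γ) (clip m₀) z.2.2)
      = empMean o (fun z => regDist (tilt (W θ.1) θ.2 γ) m₀ z.2.2) := fun θ => by
    unfold empMean
    congr 1
    exact Finset.sum_congr rfl fun i _ => regDist_clip (h01 i)
  simp only [h6] at h5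
  rw [integral_eq_lintegral_of_nonneg_ae
    (ae_of_all _ fun θ => empMean_nonneg fun i => regDist_nonneg _ _ _) hrm.aestronglyMeasurable]
  refine ENNReal.toReal_le_of_le_ofReal hκ.le (h5.trans ?_)
  calc _ ≤ 2 * ENNReal.ofReal (κ / 4) + ENNReal.ofReal (κ / 2) := by gcongr
    _ = ENNReal.ofReal κ := by
        rw [← ENNReal.ofReal_ofNat 2, ← ENNReal.ofReal_mul zero_le_two,
          ← ENNReal.ofReal_add (by positivity) (by positivity)]
        congr 1
        ring

variable {μ : Measure Ω} [IsProbabilityMeasure μ] {Q : Measure (Unit0 p)} [IsProbabilityMeasure Q]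
  {O : ℕ → Ω → Obs p} {S : ℕ → Ω → 𝓢}

lemma whp_reweightedDist_le (hs : IsSamplingScheme μ (obsLaw Q) O S)
    {m₀ : Bool → Cov p → ℝ} (hm₀ : IsConditionalMean Q m₀)
    (h01 : ∀ᵐ x ∂(covLaw Q), ∀ d, m₀ d x ∈ Set.Icc (0 : ℝ) 1)
    {γ : ℕ → 𝓢 → Bool → Cov p → ℝ} (hγ : ∀ n d, Measurable fun q : 𝓢 × Cov p => γ n q.1 d q.2)
    (ν : Measure Ξ) [IsProbabilityMeasure ν] {W : ℕ → Ξ → Bool → Cov p → ℝ}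
    (hW : ∀ n d, Measurable fun q : Ξ × Cov p => W n q.1 d q.2) (σ : ℕ → ℝ)
    {ε : ℕ → ℝ≥0∞} (hε0 : Tendsto ε atTop (𝓝 0)) {κ : ℝ} (hκ : 0 < κ) :
    Whp μ fun n ω => reweightedDist ((prior ν (σ n)).restrict
      {θ | (S n ω, θ) ∈ nearSet (obsLaw Q) (W n) (γ n) (clip m₀) (ε n)}) (W n) (γ n (S n ω))
        (clip m₀) (sample O n ω) ≤ ENNReal.ofReal κ := by
  have hmc := measurable_clip hm₀.1
  have hA := fun n => measurableSet_nearSet (obsLaw Q) (hW n) (hγ n) hmc (ε n)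
  have hτ : Tendsto (fun n => 5 * ε n) atTop (𝓝 0) := by
    simpa using ENNReal.Tendsto.const_mul (a := 5) hε0 (Or.inr (by simp))
  have hFm := fun n => measurable_reweightedDist (n := n) (hW n) (hγ n) hmc (prior ν (σ n)) (hA n)
  have hFw : ∀ n s, ∫⁻ o : Fin n → Obs p, reweightedDist ((prior ν (σ n)).restrict
      {θ | (s, θ) ∈ nearSet (obsLaw Q) (W n) (γ n) (clip m₀) (ε n)}) (W n) (γ n s)
        (clip m₀) o ∂(Measure.pi fun _ => obsLaw Q) ≤ 5 * ε n := fun n s => by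
    have hAs : MeasurableSet {θ | (s, θ) ∈ nearSet (obsLaw Q) (W n) (γ n) (clip m₀) (ε n)} :=
      measurable_prodMk_left (hA n)
    exact lintegral_reweightedDist_le (hasBernoulliConditional_clip hm₀ h01) hmc (clip_mem_Icc m₀)
      (hW n) (fun d => (hγ n d).comp measurable_prodMk_left)
      (ae_restrict_of_forall_mem hAs fun θ hθ => hθ)
  have h1 := hs.whp_le hFm (w := fun n _ => 5 * ε n) (fun n => measurable_const) hFw hτ
    (κ := ENNReal.ofReal κ) (by simpa using hκ) ENNReal.ofReal_ne_top
  exact h1.mono (Eventually.of_forall fun n ω h => h le_rfl)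

/-- The posterior mean of the distance of the regression function to the truth at the data points
tends to zero. -/
lemma whp_integral_regDist_le (hs : IsSamplingScheme μ (obsLaw Q) O S)
    {m₀ : Bool → Cov p → ℝ} (hm₀ : IsConditionalMean Q m₀)
    (h01 : ∀ᵐ x ∂(covLaw Q), ∀ d, m₀ d x ∈ Set.Icc (0 : ℝ) 1)
    {γ : ℕ → 𝓢 → Bool → Cov p → ℝ} (hγ : ∀ n d, Measurable fun q : 𝓢 × Cov p => γ n q.1 d q.2)
    (ν : Measure Ξ) [IsProbabilityMeasure ν] {W : ℕ → Ξ → Bool → Cov p → ℝ}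
    (hW : ∀ n d, Measurable fun q : Ξ × Cov p => W n q.1 d q.2) (σ : ℕ → ℝ)
    {H : ℕ → 𝓢 → Set (Bool → Cov p → ℝ)}
    (hHpost : ∀ κ : ℝ, 0 < κ → Whp μ fun n ω =>
      1 - (posterior ν (W n) (σ n) (γ n (S n ω)) (sample O n ω)).real
        {θ | tilt (W n θ.1) θ.2 (γ n (S n ω)) ∈ H n (S n ω)} ≤ κ)
    {ε : ℕ → ℝ} (hε0 : Tendsto ε atTop (𝓝 0))
    (hε : Whp μ fun n ω => ∀ d, ∀ η ∈ H n (S n ω),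
      eLpNorm (fun x => condMean η d x - m₀ d x) 2 (covLaw Q) ≤ ENNReal.ofReal (ε n))
    {κ : ℝ} (hκ : 0 < κ) :
    Whp μ fun n ω => ∫ θ, empMean (sample O n ω) (fun z =>
      regDist (tilt (W n θ.1) θ.2 (γ n (S n ω))) m₀ z.2.2)
      ∂(posterior ν (W n) (σ n) (γ n (S n ω)) (sample O n ω)) ≤ κ := by
  have hε2 : Tendsto (fun n => 2 * ENNReal.ofReal (ε n)) atTop (𝓝 0) := by
    have h1 : Tendsto (fun n => ENNReal.ofReal (ε n)) atTop (𝓝 0) := by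
      simpa using ENNReal.tendsto_ofReal hε0
    simpa using ENNReal.Tendsto.const_mul (a := 2) h1 (Or.inr (by simp))
  have h1 := whp_reweightedDist_le hs hm₀ h01 hγ ν hW σ hε2 (half_pos hκ)
  have h2 := hHpost (κ / 4) (by positivity)
  have h3 := whp_of_ae (hs.ae_forall (ae_obsLaw_of_ae_covLaw h01))
  refine (((h1.and h2).and hε).and h3).mono (Eventually.of_forall fun n ω h => ?_)
  obtain ⟨⟨⟨h1, h2⟩, hε⟩, h3⟩ := h
  have hA : MeasurableSet {θ | (S n ω, θ) ∈ nearSet (obsLaw Q) (W n) (γ n) (clip m₀)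
      (2 * ENNReal.ofReal (ε n))} := measurable_prodMk_left
    (measurableSet_nearSet (obsLaw Q) (hW n) (hγ n) (measurable_clip hm₀.1) _)
  refine integral_posterior_regDist_le ν (fun d x => (hW n d).comp measurable_prodMk_right) (σ n)
    (γ n (S n ω)) h3 hA (fun θ hθ => ?_) hκ h2 h1
  have hcm : ∀ d, Measurable (condMean (tilt (W n θ.1) θ.2 (γ n (S n ω))) d) := fun d =>
    (measurable_condMean_apply_cov (hW n) (γ := γ n (S n ω))
      (fun d => (hγ n d).comp measurable_prodMk_left) d).comp (measurable_prodMk_left (x := θ))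
  exact lintegral_regDist_clip_le hcm hm₀.1 h01 fun d => hε d _ hθ

lemma measurable_sqDist {α : Type*} [MeasurableSpace α] (P : Measure (Obs p)) [SFinite P]
    {γ : α → Bool → Cov p → ℝ} (hγ : ∀ d, Measurable fun q : α × Cov p => γ q.1 d q.2)
    {γ₀ : Bool → Cov p → ℝ} (hγ₀ : ∀ d, Measurable (γ₀ d)) :
    Measurable fun s => sqDist P (γ s) γ₀ := by
  have h1 : Measurable fun q : α × Obs p => γ q.1 q.2.2.1 q.2.2.2 :=
    measurable_apply_bool (f := fun (q : α × Obs p) d => γ q.1 d q.2.2.2)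
      (fun d => (hγ d).comp (measurable_fst.prodMk (measurable_obsCov.comp measurable_snd)))
      measurable_snd.snd.fst
  have h2 : Measurable fun q : α × Obs p => γ₀ q.2.2.1 q.2.2.2 :=
    (measurable_uncurry_bool hγ₀).comp measurable_snd.snd
  exact ((h1.sub h2).pow_const 2).ennreal_ofReal.lintegral_prod_right'

lemma tendsto_ofReal_mul_sq {r : ℕ → ℝ} (hr : Tendsto r atTop (𝓝 0)) (a : ℝ) :
    Tendsto (fun n => ENNReal.ofReal (a * max (r n) 0 ^ 2)) atTop (𝓝 0) := by
  have h1 : Tendsto (fun n => a * max (r n) 0 ^ 2) atTop (𝓝 0) := by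
    simpa using ((hr.max (tendsto_const_nhds (x := (0 : ℝ)))).pow 2).const_mul a
  simpa using ENNReal.tendsto_ofReal h1

/-- The residuals weighted by the error of the Riesz representor are negligible. -/
lemma whp_residual_le (hs : IsSamplingScheme μ (obsLaw Q) O S)
    {π₀ : Cov p → ℝ} (hπ₀ : Measurable π₀) {m₀ : Bool → Cov p → ℝ} (hm₀ : IsConditionalMean Q m₀)
    {pihat : ℕ → 𝓢 → Cov p → ℝ} (hpihat : ∀ n, Measurable fun q : 𝓢 × Cov p => pihat n q.1 q.2)
    (hpihat01 : ∀ n s x, 0 < pihat n s x ∧ pihat n s x < 1) {c : ℝ} (hc : 0 < c)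
    (hov : ∀ x ∈ (covLaw Q).support, c < π₀ x ∧ π₀ x < 1 - c) (K : ℝ)
    {r : ℕ → ℝ} (hr0 : Tendsto r atTop (𝓝 0))
    (hr : Whp μ fun n ω =>
      eLpNorm (fun x => pihat n (S n ω) x - π₀ x) 2 (covLaw Q) ≤ ENNReal.ofReal (r n))
    {κ : ℝ} (hκ : 0 < κ) :
    Whp μ fun n ω => (∀ d, ∀ x ∈ (covLaw Q).support, |riesz (pihat n (S n ω)) d x| ≤ K) →
      |√(n : ℝ) * empMean (sample O n ω) fun z =>
        (riesz (pihat n (S n ω)) z.2.1 z.2.2 - riesz π₀ z.2.1 z.2.2)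
          * (num z.1 - m₀ z.2.1 z.2.2)| ≤ κ := by
  have hγ : ∀ n d, Measurable fun q : 𝓢 × Cov p => riesz (pihat n q.1) d q.2 := fun n d =>
    measurable_riesz_joint (hpihat n) d
  have hγ₀ := measurable_riesz hπ₀
  have h := hs.whp_le (F := fun n q => ENNReal.ofReal ((√(n : ℝ) * empMean q.2 fun z =>
        (riesz (pihat n q.1) z.2.1 z.2.2 - riesz π₀ z.2.1 z.2.2)
          * (num z.1 - m₀ z.2.1 z.2.2)) ^ 2))
    (fun n => by
      have ho : ∀ i, Measurable fun q : 𝓢 × (Fin n → Obs p) => q.2 i := fun i =>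
        (measurable_pi_apply i).comp measurable_snd
      refine Measurable.ennreal_ofReal (Measurable.pow_const (measurable_const.mul
        ((Finset.measurable_sum _ fun i _ => ?_).div_const _)) 2)
      refine Measurable.mul (Measurable.sub ?_ ?_) (Measurable.sub ?_ ?_)
      · exact measurable_apply_bool (f := fun (q : 𝓢 × (Fin n → Obs p)) d =>
          riesz (pihat n q.1) d (q.2 i).2.2)
          (fun d => (hγ n d).comp (measurable_fst.prodMk (ho i).snd.snd)) (ho i).snd.fst
      · exact (measurable_uncurry_bool hγ₀).comp (ho i).snd
      · exact measurable_num.comp (ho i).fst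
      · exact (measurable_uncurry_bool hm₀.1).comp (ho i).snd)
    (fun n => measurable_sqDist (obsLaw Q) (hγ n) hγ₀)
    (fun n s => lintegral_sq_residual_le hm₀
      (fun d => (hγ n d).comp (measurable_prodMk_left (x := s))) hγ₀ n)
    (tendsto_ofReal_mul_sq hr0 ((K / c) ^ 2)) (κ := ENNReal.ofReal (κ ^ 2))
    (by simpa using hκ.ne') ENNReal.ofReal_ne_top
  refine (h.and hr).mono (Eventually.of_forall fun n ω ⟨h, hr⟩ hK => ?_)
  have h1 := h (sqDist_riesz_le ((hpihat n).comp measurable_prodMk_left) hπ₀ (hpihat01 n (S n ω))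
    hc hov hK hr)
  exact abs_le_of_sq_le_sq ((ENNReal.ofReal_le_ofReal_iff (sq_nonneg _)).1 h1) hκ.le

/-- The Riesz representor is consistently estimated in mean, at the data points. -/
lemma whp_empMean_riesz_sub_le (hs : IsSamplingScheme μ (obsLaw Q) O S)
    {π₀ : Cov p → ℝ} (hπ₀ : Measurable π₀)
    {pihat : ℕ → 𝓢 → Cov p → ℝ} (hpihat : ∀ n, Measurable fun q : 𝓢 × Cov p => pihat n q.1 q.2)
    (hpihat01 : ∀ n s x, 0 < pihat n s x ∧ pihat n s x < 1) {c : ℝ} (hc : 0 < c)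
    (hov : ∀ x ∈ (covLaw Q).support, c < π₀ x ∧ π₀ x < 1 - c) (K : ℝ)
    {r : ℕ → ℝ} (hr0 : Tendsto r atTop (𝓝 0))
    (hr : Whp μ fun n ω =>
      eLpNorm (fun x => pihat n (S n ω) x - π₀ x) 2 (covLaw Q) ≤ ENNReal.ofReal (r n))
    {κ : ℝ} (hκ : 0 < κ) :
    Whp μ fun n ω => (∀ d, ∀ x ∈ (covLaw Q).support, |riesz (pihat n (S n ω)) d x| ≤ K) →
      empMean (sample O n ω) (fun z =>
        |riesz (pihat n (S n ω)) z.2.1 z.2.2 - riesz π₀ z.2.1 z.2.2|) ≤ κ := by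
  have hγ : ∀ n d, Measurable fun q : 𝓢 × Cov p => riesz (pihat n q.1) d q.2 := fun n d =>
    measurable_riesz_joint (hpihat n) d
  have hγ₀ := measurable_riesz hπ₀
  have h := hs.whp_le (F := fun n q => ENNReal.ofReal (empMean q.2 fun z =>
        (riesz (pihat n q.1) z.2.1 z.2.2 - riesz π₀ z.2.1 z.2.2) ^ 2))
    (fun n => by
      have ho : ∀ i, Measurable fun q : 𝓢 × (Fin n → Obs p) => q.2 i := fun i =>
        (measurable_pi_apply i).comp measurable_snd
      refine Measurable.ennreal_ofReal ((Finset.measurable_sum _ fun i _ => ?_).div_const _)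
      refine Measurable.pow_const (Measurable.sub ?_ ?_) 2
      · exact measurable_apply_bool (f := fun (q : 𝓢 × (Fin n → Obs p)) d =>
          riesz (pihat n q.1) d (q.2 i).2.2)
          (fun d => (hγ n d).comp (measurable_fst.prodMk (ho i).snd.snd)) (ho i).snd.fst
      · exact (measurable_uncurry_bool hγ₀).comp (ho i).snd)
    (fun n => measurable_sqDist (obsLaw Q) (hγ n) hγ₀)
    (fun n s => lintegral_empMean_sq_le (obsLaw Q)
      (fun d => (hγ n d).comp (measurable_prodMk_left (x := s))) hγ₀ n)
    (tendsto_ofReal_mul_sq hr0 ((K / c) ^ 2)) (κ := ENNReal.ofReal (κ ^ 2))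
    (by simpa using hκ.ne') ENNReal.ofReal_ne_top
  refine (h.and hr).mono (Eventually.of_forall fun n ω ⟨h, hr⟩ hK => ?_)
  have h1 := h (sqDist_riesz_le ((hpihat n).comp measurable_prodMk_left) hπ₀ (hpihat01 n (S n ω))
    hc hov hK hr)
  refine (empMean_abs_le_sqrt _).trans ?_
  rw [← Real.sqrt_sq hκ.le]
  exact Real.sqrt_le_sqrt ((ENNReal.ofReal_le_ofReal_iff (sq_nonneg _)).1 h1)

/-- The nuisance term is uniformly negligible on the sets on which the posterior concentrates. -/
lemma whp_nuisance_le (hs : IsSamplingScheme μ (obsLaw Q) O S)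
    {π₀ : Cov p → ℝ} (hπ₀ : Measurable π₀) {m₀ : Bool → Cov p → ℝ} (hm₀ : IsConditionalMean Q m₀)
    {pihat : ℕ → 𝓢 → Cov p → ℝ} (hpihat : ∀ n, Measurable fun q : 𝓢 × Cov p => pihat n q.1 q.2)
    (hpihat01 : ∀ n s x, 0 < pihat n s x ∧ pihat n s x < 1) {c : ℝ} (hc : 0 < c)
    (hov : ∀ x ∈ (covLaw Q).support, c < π₀ x ∧ π₀ x < 1 - c) {K : ℝ} (hK0 : 0 ≤ K)
    {r ε : ℕ → ℝ} (hr0 : Tendsto r atTop (𝓝 0))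
    (hprod : Tendsto (fun n : ℕ => √(n : ℝ) * ε n * r n) atTop (𝓝 0))
    (hr : Whp μ fun n ω =>
      eLpNorm (fun x => pihat n (S n ω) x - π₀ x) 2 (covLaw Q) ≤ ENNReal.ofReal (r n))
    {W : ℕ → Ξ → Bool → Cov p → ℝ} (hW : ∀ n d, Measurable fun q : Ξ × Cov p => W n q.1 d q.2)
    {H : ℕ → 𝓢 → Set (Bool → Cov p → ℝ)}
    (hε : Whp μ fun n ω => ∀ d, ∀ η ∈ H n (S n ω),
      eLpNorm (fun x => condMean η d x - m₀ d x) 2 (covLaw Q) ≤ ENNReal.ofReal (ε n))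
    (hG : ∀ δ : ℝ, 0 < δ → Whp μ fun n ω => ∀ η ∈ H n (S n ω),
      |empProc (obsLaw Q) (sample O n ω) (fun z =>
        (riesz (pihat n (S n ω)) z.2.1 z.2.2 - riesz π₀ z.2.1 z.2.2)
          * (condMean η z.2.1 z.2.2 - m₀ z.2.1 z.2.2))| ≤ δ)
    {κ : ℝ} (hκ : 0 < κ) :
    Whp μ fun n ω => (∀ d, ∀ x ∈ (covLaw Q).support, |riesz (pihat n (S n ω)) d x| ≤ K) →
      ∀ θ ∈ {θ : Ξ × ℝ | tilt (W n θ.1) θ.2 (riesz (pihat n (S n ω))) ∈ H n (S n ω)},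
        |nuisance (riesz (pihat n (S n ω))) (riesz π₀)
          (tilt (W n θ.1) θ.2 (riesz (pihat n (S n ω)))) (sample O n ω)| ≤ κ := by
  have h1 := whp_residual_le hs hπ₀ hm₀ hpihat hpihat01 hc hov K hr0 hr
    (κ := κ / 3) (by positivity)
  have h2 := hG (κ / 3) (by positivity)
  have h3 : ∀ᶠ n : ℕ in atTop, K / c * 2 * |√(n : ℝ) * ε n * r n| ≤ κ / 3 := by
    have := (hprod.abs.const_mul (K / c * 2))
    rw [abs_zero, mul_zero] at this
    exact this.eventually_le_const (by positivity)
  refine (((h1.and h2).and hr).and hε).mono ?_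
  filter_upwards [h3] with n h3 ω ⟨⟨⟨h1, h2⟩, hr⟩, hε⟩ hK θ hθ
  have hγs : ∀ d, Measurable (riesz (pihat n (S n ω)) d) := fun d =>
    (measurable_riesz_joint (hpihat n) d).comp measurable_prodMk_left
  have h4 := abs_integral_riesz_mul_le ((hpihat n).comp measurable_prodMk_left) hπ₀
    (hpihat01 n (S n ω)) hc hov hK0 hK hr (m := condMean (tilt (W n θ.1) θ.2
      (riesz (pihat n (S n ω))))) (fun d => (measurable_condMean_apply_cov (hW n) hγs d).comp
        (measurable_prodMk_left (x := θ))) hm₀.1 fun d => hε d _ hθ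
  have h5 : max (r n) 0 * max (ε n) 0 ≤ |ε n * r n| := by
    rw [abs_mul, mul_comm]
    exact mul_le_mul (max_le (le_abs_self _) (abs_nonneg _))
      (max_le (le_abs_self _) (abs_nonneg _)) (le_max_right _ _) (abs_nonneg _)
  have hKc : 0 ≤ K / c := by positivity
  have h6 : |√(n : ℝ) * ∫ z, (riesz (pihat n (S n ω)) z.2.1 z.2.2 - riesz π₀ z.2.1 z.2.2)
        * (condMean (tilt (W n θ.1) θ.2 (riesz (pihat n (S n ω)))) z.2.1 z.2.2
          - m₀ z.2.1 z.2.2) ∂(obsLaw Q)| ≤ κ / 3 := by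
    rw [abs_mul, abs_of_nonneg (Real.sqrt_nonneg _)]
    refine le_trans (mul_le_mul_of_nonneg_left (h4.trans (mul_le_mul_of_nonneg_left
      (mul_le_mul_of_nonneg_left h5 zero_le_two) hKc)) (Real.sqrt_nonneg _)) ?_
    refine le_trans (le_of_eq ?_) h3
    rw [mul_assoc (√(n : ℝ)), abs_mul (√(n : ℝ)), abs_of_nonneg (Real.sqrt_nonneg (n : ℝ))]
    ring
  rw [nuisance_eq (obsLaw Q) _ _ _ m₀]
  refine (abs_sub _ _).trans ((add_le_add ((abs_sub _ _).trans
    (add_le_add (h1 hK) (h2 _ hθ))) h6).trans (le_of_eq (by ring)))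

end Remainders

/-! ### Convergence of the posterior law -/

section Final

variable {p : ℕ}

lemma integral_sq_sub_sq_integral_nonneg {α : Type*} [MeasurableSpace α] (P : Measure α)
    [IsProbabilityMeasure P] {f : α → ℝ} (hf : MemLp f 2 P) :
    0 ≤ ∫ x, f x ^ 2 ∂P - (∫ x, f x ∂P) ^ 2 := by
  have h := variance_nonneg f P
  rw [variance_eq_sub hf] at h
  exact h

/-- For given data, the posterior mean distance of the information to its limit. -/
lemma integral_abs_info_sub_le {n : ℕ} {Ξ : Type*} [MeasurableSpace Ξ] (ρ : Measure (Ξ × ℝ))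
    [IsProbabilityMeasure ρ] {W : Ξ → Bool → Cov p → ℝ}
    (hW : ∀ d x, Measurable fun ξ => W ξ d x) {γ γ₀ m₀ : Bool → Cov p → ℝ} {o : Fin n → Obs p}
    {K C : ℝ} (hK : ∀ i, |γ (o i).2.1 (o i).2.2| ≤ K) (hC : ∀ i, |γ₀ (o i).2.1 (o i).2.2| ≤ C)
    (hm₀ : ∀ i d, m₀ d (o i).2.2 ∈ Set.Icc (0 : ℝ) 1) (v : ℝ) :
    ∫ θ, |info γ (tilt (W θ.1) θ.2 γ) o - v| ∂ρ
      ≤ K ^ 2 * ∫ θ, empMean o (fun z => regDist (tilt (W θ.1) θ.2 γ) m₀ z.2.2) ∂ρ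
        + ((K + C) * empMean o (fun z => |γ z.2.1 z.2.2 - γ₀ z.2.1 z.2.2|)
          + |empMean o (fun z => γ₀ z.2.1 z.2.2 ^ 2 * outcomeVar m₀ z) - v|) := by
  have hcm : ∀ d x, Measurable fun θ : Ξ × ℝ => condMean (tilt (W θ.1) θ.2 γ) d x :=
    fun d x => by simpa using measurable_condMean_apply hW γ d x 0
  have hrm : Measurable fun θ : Ξ × ℝ =>
      empMean o (fun z => regDist (tilt (W θ.1) θ.2 γ) m₀ z.2.2) :=
    (Finset.measurable_sum _ fun i _ => ((hcm _ _).sub_const _).abs.add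
      ((hcm _ _).sub_const _).abs).div_const _
  have hri : Integrable (fun θ : Ξ × ℝ =>
      empMean o (fun z => regDist (tilt (W θ.1) θ.2 γ) m₀ z.2.2)) ρ :=
    Integrable.of_bound hrm.aestronglyMeasurable 2 (ae_of_all _ fun θ => by
      rw [Real.norm_eq_abs, abs_of_nonneg (empMean_nonneg fun i => regDist_nonneg _ _ _)]
      exact empMean_le zero_le_two fun i => regDist_le_two (hm₀ i))
  rw [← integral_const_mul]
  have h2 := integral_add (hri.const_mul (K ^ 2)) (integrable_const (μ := ρ)
    ((K + C) * empMean o (fun z => |γ z.2.1 z.2.2 - γ₀ z.2.1 z.2.2|)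
      + |empMean o (fun z => γ₀ z.2.1 z.2.2 ^ 2 * outcomeVar m₀ z) - v|))
  simp only [integral_const, probReal_univ, one_smul] at h2
  rw [← h2]
  refine integral_mono_of_nonneg (ae_of_all _ fun θ => abs_nonneg _)
    ((hri.const_mul _).add (integrable_const _)) (ae_of_all _ fun θ => ?_)
  exact (abs_info_sub_le hK hC hm₀ v).trans (le_of_eq (add_assoc _ _ _))

/-- The empirical variance of a bounded function of the covariate converges. -/
lemma whp_abs_avg_sub_le {Ω 𝓢 : Type*} [MeasurableSpace Ω] [MeasurableSpace 𝓢] {μ : Measure Ω}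
    [IsProbabilityMeasure μ] {P : Measure (Obs p)} [IsProbabilityMeasure P] {O : ℕ → Ω → Obs p}
    {S : ℕ → Ω → 𝓢} (hs : IsSamplingScheme μ P O S) {f : Obs p → ℝ} (hf : Measurable f)
    (hb : ∀ᵐ o ∂P, |f o| ≤ 1) {τ : ℝ} (hτ : 0 < τ) :
    Whp μ fun n ω => |avg (fun i => f (sample O n ω i) ^ 2)
      - avg (fun i => f (sample O n ω i)) ^ 2 - (∫ o, f o ^ 2 ∂P - (∫ o, f o ∂P) ^ 2)| ≤ τ := by
  have hi : Integrable f P := Integrable.of_bound hf.aestronglyMeasurable 1 hb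
  have hi2 : Integrable (fun o => f o ^ 2) P :=
    Integrable.of_bound (hf.pow_const 2).aestronglyMeasurable 1 (hb.mono fun o ho => by
      rw [Real.norm_eq_abs, abs_pow]; exact pow_le_one₀ (abs_nonneg _) ho)
  have hE : |∫ o, f o ∂P| ≤ 1 := by
    simpa using norm_integral_le_of_norm_le_const (μ := P) (f := f) (C := 1) hb
  have h1 := hs.whp_empMean hf hi (κ := τ / 3) (by positivity)
  have h2 := hs.whp_empMean (hf.pow_const 2) hi2 (κ := τ / 3) (by positivity)
  have h3 := whp_of_ae (hs.ae_forall hb)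
  refine ((h1.and h2).and h3).mono (Eventually.of_forall fun n ω ⟨⟨h1, h2⟩, h3⟩ => ?_)
  have e1 : avg (fun i => f (sample O n ω i)) = empMean (sample O n ω) f := rfl
  have e2 : avg (fun i => f (sample O n ω i) ^ 2) = empMean (sample O n ω) fun z => f z ^ 2 := rfl
  rw [e1, e2]
  have h4 : |empMean (sample O n ω) f| ≤ 1 :=
    (abs_empMean_le _ _).trans (empMean_le zero_le_one h3)
  set a := empMean (sample O n ω) f
  set b := empMean (sample O n ω) fun z => f z ^ 2
  set a' := ∫ o, f o ∂P
  set b' := ∫ o, f o ^ 2 ∂P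
  have h5 : |a ^ 2 - a' ^ 2| ≤ 2 * (τ / 3) := by
    rw [sq_sub_sq, abs_mul]
    exact mul_le_mul ((abs_add_le _ _).trans (by linarith)) h1.le (abs_nonneg _) zero_le_two
  rw [show b - a ^ 2 - (b' - a' ^ 2) = (b - b') - (a ^ 2 - a' ^ 2) by ring]
  exact (abs_sub _ _).trans (by linarith)

lemma PosteriorProbToOne.whp {Ω 𝓢 Ξ : Type*} [MeasurableSpace Ω] [MeasurableSpace Ξ]
    {μ : Measure Ω} {O : ℕ → Ω → Obs p} {S : ℕ → Ω → 𝓢} {pihat : ℕ → 𝓢 → Cov p → ℝ}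
    {ν : Measure Ξ} {W : ℕ → Ξ → Bool → Cov p → ℝ} {σ : ℕ → ℝ} {A : ℕ → 𝓢 → Set (Ξ × ℝ)}
    (h : PosteriorProbToOne μ O S pihat ν W σ A) {κ : ℝ} (hκ : 0 < κ) :
    Whp μ fun n ω => 1 - (posterior ν (W n) (σ n) (riesz (pihat n (S n ω)))
      (sample O n ω)).real (A n (S n ω)) ≤ κ :=
  (whp_of_tendstoInMeasure h hκ).mono (Eventually.of_forall fun n ω h => by
    linarith [(abs_lt.1 h).1])

/-- The conclusion, on the event that the estimated Riesz representor is bounded by `K`. -/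
lemma whp_dBL_marginalPosterior_lt {Ω 𝓢 : Type*} {Ξ : Type u}
    [MeasurableSpace Ω] [MeasurableSpace 𝓢] [MeasurableSpace Ξ]
    {Q : Measure (Unit0 p)} [IsProbabilityMeasure Q] {π₀ : Cov p → ℝ}
    (hπ₀ : IsPropensityScore Q π₀) {m₀ : Bool → Cov p → ℝ} (hm₀ : IsConditionalMean Q m₀)
    {μ : Measure Ω} [IsProbabilityMeasure μ] {O : ℕ → Ω → Obs p} {S : ℕ → Ω → 𝓢}
    (hs : IsSamplingScheme μ (obsLaw Q) O S) {pihat : ℕ → 𝓢 → Cov p → ℝ}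
    (hpihat : ∀ n, Measurable fun q : 𝓢 × Cov p => pihat n q.1 q.2)
    (hpihat01 : ∀ n s x, 0 < pihat n s x ∧ pihat n s x < 1)
    {mhat : ℕ → 𝓢 → Bool → Cov p → ℝ} (ν : Measure Ξ) [IsProbabilityMeasure ν]
    {W : ℕ → Ξ → Bool → Cov p → ℝ} (hW : ∀ n d, Measurable fun q : Ξ × Cov p => W n q.1 d q.2)
    {σ : ℕ → ℝ} {H : ℕ → 𝓢 → Set (Bool → Cov p → ℝ)}
    (hH : ∀ n, MeasurableSet {q : 𝓢 × (Ξ × ℝ) |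
      tilt (W n q.2.1) q.2.2 (riesz (pihat n q.1)) ∈ H n q.1})
    (hHpost : PosteriorProbToOne μ O S pihat ν W σ (shiftedSieve pihat W H fun _ => 0))
    {r ε : ℕ → ℝ} (hunconf : Unconfounded Q) (hoverlap : Overlap Q π₀)
    (hrate : RateConditions μ Q π₀ m₀ S pihat mhat H r ε)
    (hcomplexity : ComplexityConditions μ Q π₀ m₀ O S pihat H)
    (hstable : PriorStability μ O S pihat ν W σ H) {χhat : ℕ → Ω → ℝ}
    (hχhat : TendstoInMeasure μ (fun (n : ℕ) ω => √(n : ℝ) * (χhat n ω - ate Q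
      - empMean (sample O n ω) (eif Q π₀ m₀))) atTop (fun _ => (0 : ℝ)))
    {K : ℝ} (hK0 : 0 ≤ K) {δ : ℝ} (hδ : 0 < δ) :
    Whp μ fun n ω => (∀ d, ∀ x ∈ (covLaw Q).support, |riesz (pihat n (S n ω)) d x| ≤ K) →
      dBL (marginalPosterior ν (W n) (σ n) (riesz (pihat n (S n ω))) π₀ m₀ (χhat n ω)
        (sample O n ω)) (gaussianReal 0 (effBound Q π₀ m₀)) < δ := by
  obtain ⟨c, hc, hov⟩ := hoverlap
  obtain ⟨hr0, hε0, hprod, hrates, -⟩ := hrate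
  obtain ⟨hσ, hnσ, ⟨t, ht0, hlam⟩, -⟩ := hstable
  have hWx : ∀ n d x, Measurable fun ξ => W n ξ d x := fun n d x =>
    (hW n d).comp measurable_prodMk_right
  have h01 := ae_condMean_mem_Icc hπ₀ hm₀ hc hov
  have hr : Whp μ fun n ω =>
      eLpNorm (fun x => pihat n (S n ω) x - π₀ x) 2 (covLaw Q) ≤ ENNReal.ofReal (r n) :=
    Whp.mono hrates (Eventually.of_forall fun n ω h => h.1)
  have hε : Whp μ fun n ω => ∀ d, ∀ η ∈ H n (S n ω),
      eLpNorm (fun x => condMean η d x - m₀ d x) 2 (covLaw Q) ≤ ENNReal.ofReal (ε n) :=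
    Whp.mono hrates (Eventually.of_forall fun n ω h => h.2.2)
  have hG : ∀ δ : ℝ, 0 < δ → Whp μ fun n ω => ∀ η ∈ H n (S n ω),
      |empProc (obsLaw Q) (sample O n ω) (fun z =>
        (riesz (pihat n (S n ω)) z.2.1 z.2.2 - riesz π₀ z.2.1 z.2.2)
          * (condMean η z.2.1 z.2.2 - m₀ z.2.1 z.2.2))| ≤ δ := fun δ hδ => by
    simpa only [Whp, not_forall, exists_prop, not_le] using hcomplexity.2 δ hδ
  have hHp : ∀ κ : ℝ, 0 < κ → Whp μ fun n ω =>
      1 - (posterior ν (W n) (σ n) (riesz (pihat n (S n ω))) (sample O n ω)).real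
        {θ | tilt (W n θ.1) θ.2 (riesz (pihat n (S n ω))) ∈ H n (S n ω)} ≤ κ := fun κ hκ => by
    simpa [shiftedSieve] using hHpost.whp hκ
  -- the two parts of the limiting variance
  set V₁ : ℝ := ∫ o, riesz π₀ o.2.1 o.2.2 ^ 2 * outcomeVar m₀ o ∂(obsLaw Q) with hV₁
  set V₂ : ℝ := ∫ o, bar m₀ o.2.2 ^ 2 ∂(obsLaw Q) - (∫ o, bar m₀ o.2.2 ∂(obsLaw Q)) ^ 2 with hV₂
  have hbm : Measurable fun o : Obs p => bar m₀ o.2.2 :=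
    ((hm₀.1 true).sub (hm₀.1 false)).comp measurable_obsCov
  have hbb : ∀ᵐ o ∂(obsLaw Q), |bar m₀ o.2.2| ≤ 1 :=
    (ae_obsLaw_of_ae_covLaw h01).mono fun o ho => by
      rw [bar, abs_le]
      constructor <;> linarith [(ho true).1, (ho true).2, (ho false).1, (ho false).2]
  have hV₁0 : 0 ≤ V₁ := integral_nonneg_of_ae
    ((ae_obsLaw_of_ae_covLaw h01).mono fun o ho =>
      mul_nonneg (sq_nonneg _) (mul_nonneg (ho _).1 (by linarith [(ho o.2.1).2])))
  have hV₂0 : 0 ≤ V₂ := integral_sq_sub_sq_integral_nonneg _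
    (MemLp.of_bound hbm.aestronglyMeasurable 1 hbb)
  have hRb : ∀ᵐ o ∂(obsLaw Q), |riesz π₀ o.2.1 o.2.2| ≤ 1 / c :=
    (ae_obsLaw_of_ae_covLaw (ae_mem_support Q)).mono fun o ho => abs_riesz_le hc (hov _ ho) _
  have hfm : Measurable fun o : Obs p => riesz π₀ o.2.1 o.2.2 ^ 2 * outcomeVar m₀ o :=
    (((measurable_uncurry_bool (measurable_riesz hπ₀.1)).comp measurable_snd).pow_const 2).mul
      (((measurable_uncurry_bool hm₀.1).comp measurable_snd).mul
        (((measurable_uncurry_bool hm₀.1).comp measurable_snd).const_sub 1))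
  have hfi : Integrable (fun o : Obs p => riesz π₀ o.2.1 o.2.2 ^ 2 * outcomeVar m₀ o)
      (obsLaw Q) := by
    refine Integrable.of_bound hfm.aestronglyMeasurable ((1 / c) ^ 2 * 1) ?_
    filter_upwards [hRb, ae_obsLaw_of_ae_covLaw h01] with o h1 h2
    rw [Real.norm_eq_abs, abs_mul, abs_pow]
    refine mul_le_mul (pow_le_pow_left₀ (abs_nonneg _) h1 2) ?_ (abs_nonneg _) (by positivity)
    have := h2 o.2.1
    rw [outcomeVar, abs_le]
    constructor <;> nlinarith [this.1, this.2]
  rw [effBound_eq hπ₀ hm₀ hunconf hc hov, ← hV₁, ← hV₂]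
  obtain ⟨ε₀, hε₀, hscore⟩ := exists_dBL_score_le.{u} V₁.toNNReal K (δ := δ / 8) (by positivity)
  obtain ⟨τ, hτ, hboot⟩ := exists_dBL_bootMean_le V₂.toNNReal (δ := δ / 8) (by positivity)
  -- the admissible sizes of the remainders
  set C : ℝ := 1 / c
  have hC0 : 0 < C := by positivity
  set κ : ℝ := δ / 100
  have hκ : 0 < κ := by positivity
  set κ₁ : ℝ := min (κ ^ 2 / 8) (ε₀ / (3 * (K ^ 2 + 1)))
  have hκ₁ : 0 < κ₁ := by positivity
  set κ₂ : ℝ := ε₀ / (3 * (K + C))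
  have hκ₂ : 0 < κ₂ := by positivity
  have e1 := whp_integral_regDist_le hs hm₀ h01 (γ := fun n s => riesz (pihat n s))
    (fun n d => measurable_riesz_joint (hpihat n) d) ν hW σ hHp hε0 hε hκ₁
  have e2 := whp_empMean_riesz_sub_le hs hπ₀.1 hpihat hpihat01 hc hov K hr0 hr hκ₂
  have e3 := whp_nuisance_le hs hπ₀.1 hm₀ hpihat hpihat01 hc hov hK0 hr0 hprod hr hW hε hG hκ
  have e4 := hs.whp_empMean hfm hfi (κ := ε₀ / 3) (by positivity)
  have e5 := whp_abs_avg_sub_le hs hbm hbb hτ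
  have e6 := hHp κ hκ
  have e7 := hlam.whp hκ
  have e8 := whp_of_tendstoInMeasure hχhat hκ
  have e9 := whp_of_ae (hs.ae_forall (ae_obsLaw_of_ae_covLaw ((ae_mem_support Q).and h01)))
  have d1 : ∀ᶠ n : ℕ in atTop, (4 : ℝ) / n < κ :=
    (tendsto_const_div_atTop_nhds_zero_nat 4).eventually_lt_const hκ
  have d2 : ∀ᶠ n : ℕ in atTop, |t n| < κ := by
    have := ht0.abs
    rw [abs_zero] at this
    exact this.eventually_lt_const hκ
  have d3 : ∀ᶠ n : ℕ in atTop, 1 / ((n : ℝ) * σ n ^ 2) ≤ ε₀ := by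
    have := hnσ.inv_tendsto_atTop.eventually_le_const hε₀
    simpa using this
  refine (((((((((e1.and e2).and e3).and e4).and e5).and e6).and e7).and e8).and e9)).mono ?_
  filter_upwards [d1, d2, d3, hscore, hboot, eventually_gt_atTop 0] with n d1 d2 d3 hscore hboot hn
    ω ⟨⟨⟨⟨⟨⟨⟨⟨e1, e2⟩, e3⟩, e4⟩, e5⟩, e6⟩, e7⟩, e8⟩, e9⟩ hK
  set γ := riesz (pihat n (S n ω))
  set o := sample O n ω
  have := isProbabilityMeasure_posterior ν (hWx n) (σ n) γ o
  have hKi : ∀ i, |γ (o i).2.1 (o i).2.2| ≤ K := fun i => hK _ _ (e9 i).1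
  have hCi : ∀ i, |riesz π₀ (o i).2.1 (o i).2.2| ≤ C := fun i =>
    abs_riesz_le hc (hov _ (e9 i).1) _
  have hmi : ∀ i d, m₀ d (o i).2.2 ∈ Set.Icc (0 : ℝ) 1 := fun i => (e9 i).2
  have hinfo : ∫ θ, |info γ (tilt (W n θ.1) θ.2 γ) o - V₁| ∂(posterior ν (W n) (σ n) γ o)
      ≤ ε₀ := by
    refine (integral_abs_info_sub_le _ (hWx n) hKi hCi hmi V₁).trans ?_
    have f1 : K ^ 2 * ∫ θ, empMean o (fun z => regDist (tilt (W n θ.1) θ.2 γ) m₀ z.2.2)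
        ∂(posterior ν (W n) (σ n) γ o) ≤ ε₀ / 3 := by
      refine (mul_le_mul_of_nonneg_left (e1.trans (min_le_right _ _)) (sq_nonneg _)).trans ?_
      rw [mul_div_assoc', div_le_div_iff₀ (by positivity) (by norm_num)]
      nlinarith [sq_nonneg K]
    have f2 : (K + C) * empMean o (fun z => |γ z.2.1 z.2.2 - riesz π₀ z.2.1 z.2.2|)
        ≤ ε₀ / 3 := by
      refine (mul_le_mul_of_nonneg_left (e2 hK) (by positivity)).trans (le_of_eq ?_)
      simp only [κ₂]
      field_simp
    linarith [e4.le]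
  have g1 := hscore ν (W n) (σ n) γ o (hWx n) (hσ n) d3 hKi (by
    rwa [Real.coe_toNNReal _ hV₁0])
  have g2 := hboot (fun i => bar m₀ (o i).2.2) (fun i => by
    have h1 := hmi i true
    have h2 := hmi i false
    rw [bar, abs_le]
    constructor <;> linarith [h1.1, h1.2, h2.1, h2.2]) (by rwa [Real.coe_toNNReal _ hV₂0])
  have hB : MeasurableSet {θ : Ξ × ℝ | tilt (W n θ.1) θ.2 γ ∈ H n (S n ω)} :=
    measurable_prodMk_left (hH n)
  have hA : MeasurableSet {θ : Ξ × ℝ | |θ.2| ≤ t n * σ n ^ 2 * √(n : ℝ)} :=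
    measurableSet_le measurable_snd.abs measurable_const
  have hmain := dBL_marginalPosterior_le hn Q π₀ m₀ ν (hWx n) (hσ n) γ (χhat n ω) o hmi
    V₁.toNNReal V₂.toNNReal hA hB (u := |t n|) (fun θ hθ => le_trans hθ (by
      gcongr; exact le_abs_self _)) (abs_nonneg _) hκ.le (e3 hK)
  have g3 : √(2 * ∫ θ, empMean o (fun z => regDist (tilt (W n θ.1) θ.2 γ) m₀ z.2.2)
      ∂(posterior ν (W n) (σ n) γ o)) ≤ κ := by
    rw [Real.sqrt_le_left hκ.le]
    have := e1.trans (min_le_left _ _)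
    nlinarith
  rw [sub_zero] at e8
  refine hmain.trans_lt ?_
  have hκδ : κ = δ / 100 := rfl
  linarith

end Final

end DRBayes

end

theorem theorem1 {p : ℕ} {Ω 𝓢 Ξ : Type*}
    [MeasurableSpace Ω] [MeasurableSpace 𝓢] [MeasurableSpace Ξ]
    -- the law of `((Y(0), Y(1)), D, X)`, with propensity score and conditional mean
    (Q : Measure (DRBayes.Unit0 p)) [IsProbabilityMeasure Q]
    (π₀ : DRBayes.Cov p → ℝ) (hπ₀ : DRBayes.IsPropensityScore Q π₀)
    (m₀ : Bool → DRBayes.Cov p → ℝ) (hm₀ : DRBayes.IsConditionalMean Q m₀)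
    -- i.i.d. observations and independent auxiliary samples
    (μ : Measure Ω) [IsProbabilityMeasure μ]
    (O : ℕ → Ω → DRBayes.Obs p) (hO : ∀ i, Measurable (O i))
    (hOindep : iIndepFun O μ) (hOlaw : ∀ i, μ.map (O i) = DRBayes.obsLaw Q)
    (S : ℕ → Ω → 𝓢) (hS : ∀ n, Measurable (S n))
    (hSO : ∀ n, IndepFun (S n) (DRBayes.sample O n) μ)
    -- pilot estimators, functions of the auxiliary sample
    (pihat : ℕ → 𝓢 → DRBayes.Cov p → ℝ)
    (hpihat : ∀ n, Measurable fun q : 𝓢 × DRBayes.Cov p => pihat n q.1 q.2)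
    (hpihat01 : ∀ n s x, 0 < pihat n s x ∧ pihat n s x < 1)
    (mhat : ℕ → 𝓢 → Bool → DRBayes.Cov p → ℝ)
    (hmhat : ∀ n d, Measurable fun q : 𝓢 × DRBayes.Cov p => mhat n q.1 d q.2)
    -- prior: a continuous process `W` and the scale of the normal variable
    (ν : Measure Ξ) [IsProbabilityMeasure ν]
    (W : ℕ → Ξ → Bool → DRBayes.Cov p → ℝ)
    (hW : ∀ n d, Measurable fun q : Ξ × DRBayes.Cov p => W n q.1 d q.2)
    (hWcont : ∀ n ξ d, ContinuousOn (W n ξ d) (DRBayes.covLaw Q).support)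
    (σ : ℕ → ℝ)
    -- the measurable sets of functions on which the posterior concentrates
    (H : ℕ → 𝓢 → Set (Bool → DRBayes.Cov p → ℝ))
    (hH : ∀ n, MeasurableSet {q : 𝓢 × (Ξ × ℝ) |
      DRBayes.tilt (W n q.2.1) q.2.2 (DRBayes.riesz (pihat n q.1)) ∈ H n q.1})
    (hHpost : DRBayes.PosteriorProbToOne μ O S pihat ν W σ
      (DRBayes.shiftedSieve pihat W H fun _ => 0))
    (r ε : ℕ → ℝ)
    -- assumptions
    (hunconf : DRBayes.Unconfounded Q) (hoverlap : DRBayes.Overlap Q π₀)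
    (hrate : DRBayes.RateConditions μ Q π₀ m₀ S pihat mhat H r ε)
    (hcomplexity : DRBayes.ComplexityConditions μ Q π₀ m₀ O S pihat H)
    (hstable : DRBayes.PriorStability μ O S pihat ν W σ H)
    -- an asymptotically efficient estimator
    (χhat : ℕ → Ω → ℝ)
    (hχhat : TendstoInMeasure μ (fun (n : ℕ) ω => √(n : ℝ) * (χhat n ω - DRBayes.ate Q
      - DRBayes.empMean (DRBayes.sample O n ω) (DRBayes.eif Q π₀ m₀))) atTop (fun _ => (0 : ℝ))) :
    TendstoInMeasure μ (fun n ω => DRBayes.dBL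
      (DRBayes.marginalPosterior ν (W n) (σ n) (DRBayes.riesz (pihat n (S n ω))) π₀ m₀
        (χhat n ω) (DRBayes.sample O n ω))
      (gaussianReal 0 (DRBayes.effBound Q π₀ m₀))) atTop (fun _ => (0 : ℝ)) := by
  have hs : DRBayes.IsSamplingScheme μ (DRBayes.obsLaw Q) O S := ⟨hO, hOindep, hOlaw, hS, hSO⟩
  rw [tendstoInMeasure_iff_norm]
  intro δ hδ
  rw [ENNReal.tendsto_nhds_zero]
  intro α hα
  -- the bound on the estimated Riesz representor holds up to probability `α / 2`
  obtain ⟨K, hK⟩ := hrate.2.2.2.2 (α / 2) (ENNReal.half_pos hα.ne')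
  have h := DRBayes.whp_dBL_marginalPosterior_lt hπ₀ hm₀ hs hpihat hpihat01 ν hW hH hHpost hunconf
    hoverlap hrate hcomplexity hstable hχhat (le_max_right K 0) hδ
  have h2 := ENNReal.tendsto_nhds_zero.1 h (α / 2) (ENNReal.half_pos hα.ne')
  filter_upwards [hK, h2] with n hK h2
  rw [← ENNReal.add_halves α]
  refine le_trans (measure_mono fun ω hω => ?_) ((measure_union_le _ _).trans (add_le_add hK h2))
  by_contra hc
  simp only [Set.mem_union, Set.mem_ofPred_eq, not_or, not_not] at hc
  have h3 := hc.2 fun d x hx => (hc.1 d x hx).trans (le_max_left _ _)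
  have h4 : δ ≤ ‖_ - (0 : ℝ)‖ := hω
  rw [sub_zero, Real.norm_eq_abs, abs_of_nonneg (DRBayes.dBL_nonneg _ _)] at h4
  exact absurd h3 (not_lt.2 h4)
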